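/- **Theorem 4.7.** Let $k$ be a field of characteristic zero. A $k$-cdg algebra is a unital associative algebra $A=\bigoplus_{n\ge 0}A^n$ over $k$, graded commutative, with a differential $d$ of degree $+1$ satisfying the graded Leibniz rule; morphisms are the unital algebra morphisms of degree $0$ commuting with $d$. It is $1$-connected if $H^0(A)=k$ and $H^1(A)=0$. Let $\mathbf{Adgc}(k)_1$ be the category of $1$-connected $k$-cdg algebras. For a $k$-cdg algebra $B$ let $\mathrm{Path}(B)=B\otimes_k k[t,dt]$, where $t$ has degree $0$, $dt$ has degree $1$ and $d(t)=dt$, and let $\delta_0,\delta_1:\mathrm{Path}(B)\to B$ be the evaluations at $t=0$ and $t=1$. A right homotopy from $f_0$ to $f_1:A\to B$ is a morphism $H:A\to\mathrm{Path}(B)$ with $\delta_iH=f_i$ for $i=0,1$, and $\sim$ is the equivalence relation generated by right homotopy. Let $\mathcal S$ be the class of homotopy equivalences of $\mathbf{Adgc}(k)_1$ (morphisms having an inverse up to $\sim$) and $\mathcal W$ the class of quasi-isomorphisms. We use the following notions for a category $\mathcal C$ with two classes of morphisms $\mathcal S$, $\mathcal W$. * $(\mathcal C,\mathcal S,\mathcal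 W)$ is a *category with strong and weak equivalences* if $\mathcal S$ and $\mathcal W$ are closed under composition and contain all isomorphisms, and each morphism in $\mathcal S$ becomes an isomorphism in $\mathcal C[\mathcal W^{-1}]$. * An object $M$ is *cofibrant* if for each $w:Y\to X$ in $\mathcal W$ the map $w_*:\mathcal C[\mathcal S^{-1}](M,Y)\to\mathcal C[\mathcal S^{-1}](M,X)$ is bijective; a cofibrant $M$ is *minimal* if $\mathrm{End}_{\mathcal C}(M)\cap\mathcal W=\mathrm{Aut}_{\mathcal C}(M)$. * A *left model* of $X$ is an object $M$ with a morphism $M\to X$ in $\mathcal C[\mathcal S^{-1}]$ which becomes an isomorphism in $\mathcal C[\mathcal W^{-1}]$. * A category with strong and weak equivalences is a *left Sullivan category* if each of its objects has a left model which is a minimal object. Then $(\mathbf{Adgc}(k)_1,\mathcal S,\mathcal W)$ is a left Sullivan category. Moreover, an object $M$ of $\mathbf{Adgc}(k)_1$ is minimal if and only if it is a $1$-connected Sullivan minimal algebra, that is: as a graded algebra $M$ is isomorphic to a free graded commutative algebra $\Lambda(V)$ on a graded vector space $V$, and $M^0=k$, $M^1=0$ and $dM^+\subset M^+\cdot M^+$,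 where $M^+=\bigoplus_{i>0}M^i$. -/

import Mathlib

open CategoryTheory DirectSum TensorProduct

universe v u

/-! ## Categories with strong and weak equivalences -/

section CartanEilenberg

variable {C : Type u} [Category.{v} C]

/-- The saturation of a class `W` of morphisms: the morphisms which become invertible in the
localisation `C[W⁻¹]`. -/
def saturation (W : MorphismProperty C) : MorphismProperty C :=
  fun _ _ f => IsIso (W.Q.map f)

/-- A category with weak equivalences: `W` is stable by composition and contains all the
isomorphisms. -/
structure IsWeakEquivalenceClass (W : MorphismProperty C) : Prop where
  comp_mem : ∀ {X Y Z : C} (f : X ⟶ Y) (g : Y ⟶ Z), W f → W g → W (f ≫ g)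
  of_isIso : ∀ {X Y : C} (f : X ⟶ Y), IsIso f → W f

/-- `(C, S, W)` is a category with strong and weak equivalences: both classes are stable by
composition and contain the isomorphisms, and `S` is contained in the saturation of `W`. -/
structure IsStrongWeak (S W : MorphismProperty C) : Prop where
  strong : IsWeakEquivalenceClass S
  weak : IsWeakEquivalenceClass W
  le_saturation : S ≤ saturation W

/-- The canonical functor `γ' : C[S⁻¹] ⥤ C[W⁻¹]` with `γ' ∘ δ = γ`. -/
noncomputable def strongToWeak {S W : MorphismProperty C} (h : S ≤ saturation W) :
    S.Localization ⥤ W.Localization :=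
  Localization.Construction.lift W.Q (fun _ _ f hf => h f hf)

/-- `M` is a left `(S, W)`-model of `X`: there is a morphism `ε : M ⟶ X` in `C[S⁻¹]` which is an
isomorphism in `C[W⁻¹]`. -/
def IsLeftModel {S W : MorphismProperty C} (h : S ≤ saturation W) (M X : C) : Prop :=
  ∃ ε : S.Q.obj M ⟶ S.Q.obj X, IsIso ((strongToWeak h).map ε)

/-- `M` is `(S, W)`-cofibrant: for each `w : Y ⟶ X` in `W`, composition with `w` is a bijection
`C[S⁻¹](M, Y) → C[S⁻¹](M, X)`. -/
def IsCofibrantObject (S W : MorphismProperty C) (M : C) : Prop :=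
  ∀ ⦃Y X : C⦄ (w : Y ⟶ X), W w →
    Function.Bijective (fun g : S.Q.obj M ⟶ S.Q.obj Y => g ≫ S.Q.map w)

/-- `M` is minimal: it is cofibrant and `End(M) ∩ W = Aut(M)`. -/
structure IsMinimalObject (S W : MorphismProperty C) (M : C) : Prop where
  cofibrant : IsCofibrantObject S W M
  end_inter : ∀ w : M ⟶ M, W w ↔ IsIso w

/-- `(C, S, W)` is a left Sullivan category: a category with strong and weak equivalences in which
each object has a minimal left model. -/
def IsLeftSullivan (S W : MorphismProperty C) : Prop :=
  ∃ h : IsStrongWeak S W, ∀ X : C, ∃ M : C,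
    IsMinimalObject S W M ∧ IsLeftModel h.le_saturation M X

/-- The class of equivalences associated to a relation `r` between parallel morphisms: the
morphisms having an inverse up to `r`. -/
def equivalenceClass (r : HomRel C) : MorphismProperty C :=
  fun X Y f => ∃ g : Y ⟶ X, r (g ≫ f) (𝟙 Y) ∧ r (f ≫ g) (𝟙 X)

end CartanEilenberg

/-! ## Commutative differential graded algebras -/

/-- A commutative differential graded `k`-algebra, graded by the natural numbers, with a
differential of degree `1`. -/
structure CDGA (k : Type u) [Field k] where
  carrier : Type u
  [ring : Ring carrier]
  [algebra : Algebra k carrier]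
  grading : ℕ → Submodule k carrier
  [gradedAlgebra : GradedAlgebra grading]
  d : carrier →ₗ[k] carrier
  d_mem : ∀ {i : ℕ} {a : carrier}, a ∈ grading i → d a ∈ grading (i + 1)
  d_d : ∀ a : carrier, d (d a) = 0
  leibniz : ∀ {i : ℕ} {a : carrier} (b : carrier), a ∈ grading i →
    d (a * b) = d a * b + (-1 : k) ^ i • (a * d b)
  comm : ∀ {i j : ℕ} {a b : carrier}, a ∈ grading i → b ∈ grading j →
    a * b = (-1 : k) ^ (i * j) • (b * a)

namespace CDGA

attribute [instance] CDGA.ring CDGA.algebra CDGA.gradedAlgebra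

variable {k : Type u} [Field k]

/-- Morphisms of cdg algebras: algebra morphisms of degree `0` commuting with the differentials. -/
@[ext]
structure Hom (A B : CDGA k) where
  toAlgHom : A.carrier →ₐ[k] B.carrier
  map_mem : ∀ {i : ℕ} {a : A.carrier}, a ∈ A.grading i → toAlgHom a ∈ B.grading i
  map_d : ∀ a : A.carrier, toAlgHom (A.d a) = B.d (toAlgHom a)

instance : Category (CDGA k) where
  Hom := Hom
  id A := ⟨AlgHom.id k A.carrier, fun h => h, fun _ => rfl⟩
  comp f g := ⟨g.toAlgHom.comp f.toAlgHom, fun h => g.map_mem (f.map_mem h), fun a => by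
    simp only [AlgHom.comp_apply, f.map_d, g.map_d]⟩

/-! ### Cohomology -/

/-- The cocycles of degree `n`. -/
def cocycles (A : CDGA k) (n : ℕ) : Submodule k A.carrier :=
  LinearMap.ker A.d ⊓ A.grading n

/-- The coboundaries of degree `n`, as a subspace of the cocycles of degree `n`: since `d` is
homogeneous of degree `1`, these are the elements of degree `n` in the image of `d`. -/
def boundaries (A : CDGA k) (n : ℕ) : Submodule k (A.cocycles n) :=
  (LinearMap.range A.d).comap (A.cocycles n).subtype

/-- The cohomology `Hⁿ(A)`. -/
abbrev cohomology (A : CDGA k) (n : ℕ) : Type u :=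
  A.cocycles n ⧸ A.boundaries n

/-- The map induced by a morphism on cocycles. -/
def cocyclesMap {A B : CDGA k} (f : A ⟶ B) (n : ℕ) : A.cocycles n →ₗ[k] B.cocycles n :=
  f.toAlgHom.toLinearMap.restrict (by
    rintro a ⟨ha, hn⟩
    refine ⟨?_, f.map_mem hn⟩
    have ha : A.d a = 0 := ha
    change B.d (f.toAlgHom a) = 0
    rw [← f.map_d, ha, map_zero])

/-- The map `Hⁿ(f)` induced by a morphism on cohomology. -/
def cohomologyMap {A B : CDGA k} (f : A ⟶ B) (n : ℕ) : A.cohomology n →ₗ[k] B.cohomology n :=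
  Submodule.mapQ _ _ (cocyclesMap f n) (by
    rintro a ⟨b, hb⟩
    refine ⟨f.toAlgHom b, ?_⟩
    rw [← f.map_d, hb]
    rfl)

lemma d_one (A : CDGA k) : A.d 1 = 0 := by
  have h := A.leibniz (1 : A.carrier) (SetLike.GradedOne.one_mem (A := A.grading))
  simpa using h

/-- The unit `k → H⁰(A)`. -/
def unitCohomology (A : CDGA k) : k →ₗ[k] A.cohomology 0 :=
  LinearMap.toSpanSingleton k _
    (Submodule.Quotient.mk ⟨1, A.d_one, SetLike.GradedOne.one_mem (A := A.grading)⟩)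

/-- `A` is `1`-connected (simply connected): `H⁰(A) = k` and `H¹(A) = 0`. -/
structure IsOneConnected (A : CDGA k) : Prop where
  h_zero : Function.Bijective A.unitCohomology
  h_one : Subsingleton (A.cohomology 1)

/-- Quasi-isomorphisms: morphisms inducing isomorphisms in cohomology. -/
def IsQuasiIso {A B : CDGA k} (f : A ⟶ B) : Prop :=
  ∀ n : ℕ, Function.Bijective (cohomologyMap f n)

/-! ### Tensor products -/

/-- The degree involution `a ↦ (-1)^|a| a`. -/
def sign (A : CDGA k) : A.carrier →ₗ[k] A.carrier :=
  DirectSum.toModule k ℕ A.carrier (fun i => (-1 : k) ^ i • (A.grading i).subtype) ∘ₗ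
    (DirectSum.decomposeLinearEquiv A.grading).toLinearMap

lemma sign_apply (A : CDGA k) {i : ℕ} {a : A.carrier} (ha : a ∈ A.grading i) :
    A.sign a = (-1 : k) ^ i • a := by
  lift a to A.grading i using ha
  simp [sign]

/-- The underlying algebra of `A ⊗ B`: the tensor product of the underlying vector spaces, with the
product `(a ⊗ b) (a' ⊗ b') = (-1)^(|b| |a'|) a a' ⊗ b b'`. -/
abbrev TensorCarrier (A B : CDGA k) : Type u := A.grading ᵍ⊗[k] B.grading

/-- The canonical bilinear map `(a, b) ↦ a ⊗ b`. -/
noncomputable def tmul (A B : CDGA k) : A.carrier →ₗ[k] B.carrier →ₗ[k] TensorCarrier A B :=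
  (TensorProduct.mk k A.carrier B.carrier).compr₂
    (GradedTensorProduct.of k A.grading B.grading).toLinearMap

/-- The degree `n` part of `A ⊗ B`, spanned by the `a ⊗ b` with `|a| + |b| = n`. -/
noncomputable def tensorGrading (A B : CDGA k) (n : ℕ) : Submodule k (TensorCarrier A B) :=
  Submodule.span k {x | ∃ i j : ℕ, i + j = n ∧ ∃ a ∈ A.grading i, ∃ b ∈ B.grading j,
    x = tmul A B a b}

lemma tmul_mem (A B : CDGA k) {i j n : ℕ} (h : i + j = n) {a : A.carrier} {b : B.carrier}
    (ha : a ∈ A.grading i) (hb : b ∈ B.grading j) : tmul A B a b ∈ tensorGrading A B n :=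
  Submodule.subset_span ⟨i, j, h, a, ha, b, hb, rfl⟩

lemma tmul_mul_tmul (A B : CDGA k) {i j : ℕ} (a : A.carrier) {b : B.carrier} {a' : A.carrier}
    (b' : B.carrier) (hb : b ∈ B.grading j) (ha' : a' ∈ A.grading i) :
    tmul A B a b * tmul A B a' b' = (-1 : k) ^ (j * i) • tmul A B (a * a') (b * b') := by
  have h := GradedTensorProduct.tmul_coe_mul_coe_tmul A.grading B.grading a ⟨b, hb⟩ ⟨a', ha'⟩ b'
  refine h.trans ?_
  rw [← uzpow_natCast (R := ℕ), Nat.cast_id]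
  rcases Nat.even_or_odd (j * i) with h' | h'
  · rw [h'.neg_one_pow, h'.neg_one_pow, one_smul, one_smul]; rfl
  · rw [h'.neg_one_pow, h'.neg_one_pow, neg_smul, one_smul, Units.neg_smul, one_smul]; rfl

/-- Two linear maps out of `A ⊗ B` agree if they agree on tensors of homogeneous elements. -/
lemma tensor_hom_ext (A B : CDGA k) {M : Type*} [AddCommGroup M] [Module k M]
    {f g : TensorCarrier A B →ₗ[k] M}
    (h : ∀ (i j : ℕ) (a : A.carrier) (b : B.carrier), a ∈ A.grading i → b ∈ B.grading j →
      f (tmul A B a b) = g (tmul A B a b)) : f = g := by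
  apply GradedTensorProduct.hom_ext
  refine TensorProduct.ext ?_
  refine DirectSum.decompose_lhom_ext A.grading fun i => ?_
  refine LinearMap.ext fun a => ?_
  refine DirectSum.decompose_lhom_ext B.grading fun j => ?_
  refine LinearMap.ext fun b => ?_
  exact h i j a b a.2 b.2

/-- The decomposition of `A ⊗ B` into its homogeneous components. -/
noncomputable def tensorDecompose (A B : CDGA k) :
    TensorCarrier A B →ₗ[k] ⨁ n, tensorGrading A B n :=
  TensorProduct.lift
    (DirectSum.toModule k ℕ _ fun i => LinearMap.flip (DirectSum.toModule k ℕ _ fun j =>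
      LinearMap.flip (LinearMap.mk₂ k
        (fun (a : A.grading i) (b : B.grading j) =>
          DirectSum.lof k ℕ (fun n => tensorGrading A B n) (i + j)
            ⟨tmul A B a b, tmul_mem A B rfl a.2 b.2⟩)
        (fun a a' b => by
          rw [← map_add]; congr 1; ext1; simp)
        (fun c a b => by
          rw [← map_smul]; congr 1)
        (fun a b b' => by
          rw [← map_add]; congr 1; ext1; simp)
        (fun c a b => by
          rw [← map_smul]; congr 1; ext1; simp)))) ∘ₗ
    (GradedTensorProduct.auxEquiv k A.grading B.grading).toLinearMap

lemma tensorDecompose_tmul (A B : CDGA k) {i j : ℕ} {a : A.carrier} {b : B.carrier}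
    (ha : a ∈ A.grading i) (hb : b ∈ B.grading j) :
    tensorDecompose A B (tmul A B a b) =
      DirectSum.lof k ℕ (fun n => tensorGrading A B n) (i + j)
        ⟨tmul A B a b, tmul_mem A B rfl ha hb⟩ := by
  lift a to A.grading i using ha
  lift b to B.grading j using hb
  have h : GradedTensorProduct.auxEquiv k A.grading B.grading (tmul A B a b) =
      DirectSum.lof k ℕ (fun n => A.grading n) i a ⊗ₜ[k]
        DirectSum.lof k ℕ (fun n => B.grading n) j b := by
    refine (GradedTensorProduct.auxEquiv_tmul A.grading B.grading _ _).trans ?_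
    rw [DirectSum.decompose_coe, DirectSum.decompose_coe, DirectSum.lof_eq_of, DirectSum.lof_eq_of]
  rw [tensorDecompose, LinearMap.comp_apply, LinearEquiv.coe_coe, h, TensorProduct.lift.tmul,
    DirectSum.toModule_lof, LinearMap.flip_apply, DirectSum.toModule_lof, LinearMap.flip_apply,
    LinearMap.mk₂_apply]

lemma tensorGrading_mul_le (A B : CDGA k) (m n : ℕ) :
    tensorGrading A B m * tensorGrading A B n ≤ tensorGrading A B (m + n) := by
  rw [tensorGrading, tensorGrading, Submodule.span_mul_span, Submodule.span_le]
  rintro _ ⟨_, ⟨i, j, rfl, a, ha, b, hb, rfl⟩, _, ⟨i', j', rfl, a', ha', b', hb', rfl⟩, rfl⟩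
  simp only [tmul_mul_tmul A B a b' hb ha']
  exact Submodule.smul_mem _ _ (tmul_mem A B (by ring)
    (SetLike.GradedMul.mul_mem ha ha') (SetLike.GradedMul.mul_mem hb hb'))

noncomputable instance (A B : CDGA k) : DirectSum.Decomposition (tensorGrading A B) :=
  DirectSum.Decomposition.ofLinearMap _ (tensorDecompose A B)
    (tensor_hom_ext A B fun i j a b ha hb => by
      rw [LinearMap.comp_apply, tensorDecompose_tmul A B ha hb, DirectSum.coeLinearMap_lof]
      rfl)
    (by
      refine DirectSum.linearMap_ext k fun n => ?_
      refine LinearMap.ext fun ⟨x, hx⟩ => ?_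
      simp only [LinearMap.comp_apply, DirectSum.coeLinearMap_lof, LinearMap.id_apply]
      induction hx using Submodule.span_induction with
      | mem x h =>
        obtain ⟨i, j, rfl, a, ha, b, hb, rfl⟩ := h
        exact tensorDecompose_tmul A B ha hb
      | zero => rw [map_zero]; exact (map_zero _).symm
      | add x y hx hy ihx ihy => rw [map_add, ihx, ihy, ← map_add]; rfl
      | smul c x hx ih => rw [map_smul, ih, ← map_smul]; rfl)

lemma tensorGrading_one_mem (A B : CDGA k) : (1 : TensorCarrier A B) ∈ tensorGrading A B 0 :=
  tmul_mem A B (zero_add 0) (SetLike.GradedOne.one_mem (A := A.grading))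
    (SetLike.GradedOne.one_mem (A := B.grading))

instance (A B : CDGA k) : SetLike.GradedMonoid (tensorGrading A B) where
  one_mem := tensorGrading_one_mem A B
  mul_mem _ _ _ _ hx hy := tensorGrading_mul_le A B _ _ (Submodule.mul_mem_mul hx hy)

noncomputable instance (A B : CDGA k) : GradedAlgebra (tensorGrading A B) where

/-- The differential of `A ⊗ B`: `d (a ⊗ b) = d a ⊗ b + (-1)^|a| a ⊗ d b`. -/
noncomputable def tensorD (A B : CDGA k) : TensorCarrier A B →ₗ[k] TensorCarrier A B :=
  (GradedTensorProduct.of k A.grading B.grading).toLinearMap ∘ₗ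
    (TensorProduct.map A.d LinearMap.id + TensorProduct.map A.sign B.d) ∘ₗ
    (GradedTensorProduct.of k A.grading B.grading).symm.toLinearMap

lemma tensorD_tmul (A B : CDGA k) {i : ℕ} {a : A.carrier} (b : B.carrier)
    (ha : a ∈ A.grading i) :
    tensorD A B (tmul A B a b) = tmul A B (A.d a) b + (-1 : k) ^ i • tmul A B a (B.d b) := by
  have h : tensorD A B (tmul A B a b) = tmul A B (A.d a) b + tmul A B (A.sign a) (B.d b) := rfl
  rw [h, sign_apply A ha, map_smul, LinearMap.smul_apply]

/-- The tensor product of cdg algebras. -/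
noncomputable def tensor (A B : CDGA k) : CDGA k where
  carrier := TensorCarrier A B
  grading := tensorGrading A B
  d := tensorD A B
  d_mem := by
    intro n x hx
    induction hx using Submodule.span_induction with
    | mem x h =>
      obtain ⟨i, j, rfl, a, ha, b, hb, rfl⟩ := h
      rw [tensorD_tmul A B b ha]
      exact Submodule.add_mem _ (tmul_mem A B (by ring) (A.d_mem ha) hb)
        (Submodule.smul_mem _ _ (tmul_mem A B (by ring) ha (B.d_mem hb)))
    | zero => rw [map_zero]; exact Submodule.zero_mem _
    | add x y hx hy ihx ihy => rw [map_add]; exact Submodule.add_mem _ ihx ihy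
    | smul c x hx ih => rw [map_smul]; exact Submodule.smul_mem _ _ ih
  d_d := by
    have h : tensorD A B ∘ₗ tensorD A B = 0 := tensor_hom_ext A B fun i j a b ha hb => by
      simp only [LinearMap.comp_apply, tensorD_tmul A B _ ha, map_add, map_smul,
        tensorD_tmul A B _ (A.d_mem ha), A.d_d, B.d_d, LinearMap.zero_apply, map_zero]
      simp [pow_succ]
    exact fun a => LinearMap.congr_fun h a
  leibniz := by
    intro n x y hx
    induction hx using Submodule.span_induction with
    | mem x h =>
      obtain ⟨i, j, rfl, a, ha, b, hb, rfl⟩ := h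
      have h : tensorD A B ∘ₗ LinearMap.mulLeft k (tmul A B a b) =
          LinearMap.mulLeft k (tensorD A B (tmul A B a b)) +
          (-1 : k) ^ (i + j) • (LinearMap.mulLeft k (tmul A B a b) ∘ₗ tensorD A B) :=
        tensor_hom_ext A B fun i' j' a' b' ha' hb' => by
          simp only [LinearMap.comp_apply, LinearMap.add_apply, LinearMap.smul_apply,
            LinearMap.mulLeft_apply, tensorD_tmul A B _ ha, tensorD_tmul A B _ ha',
            mul_add, add_mul, smul_mul_assoc, map_smul,
            tmul_mul_tmul A B _ _ hb ha', tmul_mul_tmul A B _ _ hb (A.d_mem ha'),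
            tmul_mul_tmul A B _ _ (B.d_mem hb) ha',
            tensorD_tmul A B _ (SetLike.GradedMul.mul_mem ha ha'),
            A.leibniz a' ha, B.leibniz b' hb, map_add]
          simp only [smul_add, smul_smul, ← pow_add]
          have e1 : (-1 : k) ^ (i + j + (j * i' + j * 1)) = (-1 : k) ^ (j * i' + i) := by
            rw [show i + j + (j * i' + j * 1) = j * i' + i + 2 * j by ring,
              pow_add _ _ (2 * j), pow_mul _ 2]
            simp
          rw [e1, show j * i' + (i + i') = i + (j * i' + 1 * i') by ring,
            show j * i' + (i + i' + j) = i + j + (i' + j * i') by ring]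
          abel
      exact LinearMap.congr_fun h y
    | zero => simp only [map_zero, zero_mul, smul_zero, add_zero]
    | add x y hx hy ihx ihy => simp only [map_add, add_mul, ihx, ihy, smul_add]; abel
    | smul c x hx ih => simp only [map_smul, smul_mul_assoc, ih, smul_add, smul_comm c]
  comm := by
    intro m n x y hx hy
    induction hx using Submodule.span_induction with
    | mem x h =>
      obtain ⟨i, j, rfl, a, ha, b, hb, rfl⟩ := h
      induction hy using Submodule.span_induction with
      | mem y h =>
        obtain ⟨i', j', rfl, a', ha', b', hb', rfl⟩ := h
        rw [tmul_mul_tmul A B _ _ hb ha', tmul_mul_tmul A B _ _ hb' ha, A.comm ha ha',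
          B.comm hb hb', map_smul, map_smul, LinearMap.smul_apply,
          smul_smul, smul_smul, smul_smul, ← pow_add, ← pow_add, ← pow_add]
        congr 1
        rw [show (i + j) * (i' + j') + j' * i = j * i' + j * j' + i * i' + 2 * (i * j') by ring,
          pow_add _ _ (2 * _), pow_mul _ 2]
        simp
      | zero => simp only [mul_zero, zero_mul, smul_zero]
      | add x y hx hy ihx ihy => simp only [mul_add, add_mul, ihx, ihy, smul_add]
      | smul c x hx ih => simp only [smul_mul_assoc, mul_smul_comm, ih, smul_comm c]
    | zero => simp only [mul_zero, zero_mul, smul_zero]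
    | add x y hx hy ihx ihy => simp only [mul_add, add_mul, ihx, ihy, smul_add]
    | smul c x hx ih => simp only [smul_mul_assoc, mul_smul_comm, ih, smul_comm c]

/-! ### The path object and homotopies -/

open Polynomial in
/-- The grading of `k[t, dt] = k[t] ⊕ k[t] dt`. -/
noncomputable def intervalGrading (k : Type u) [Field k] :
    ℕ → Submodule k (TrivSqZeroExt k[X] k[X])
  | 0 => LinearMap.ker ((TrivSqZeroExt.sndHom k[X] k[X]).restrictScalars k)
  | 1 => LinearMap.ker (TrivSqZeroExt.fstHom k k[X] k[X]).toLinearMap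
  | _ + 2 => ⊥

open Polynomial in
lemma mem_intervalGrading_zero {x : TrivSqZeroExt k[X] k[X]} :
    x ∈ intervalGrading k 0 ↔ x.snd = 0 := Iff.rfl

open Polynomial in
lemma mem_intervalGrading_one {x : TrivSqZeroExt k[X] k[X]} :
    x ∈ intervalGrading k 1 ↔ x.fst = 0 := Iff.rfl

open Polynomial in
lemma mem_intervalGrading_add_two {n : ℕ} {x : TrivSqZeroExt k[X] k[X]} :
    x ∈ intervalGrading k (n + 2) ↔ x = 0 := Iff.rfl

open Polynomial in
instance (k : Type u) [Field k] : SetLike.GradedMonoid (intervalGrading k) where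
  one_mem := mem_intervalGrading_zero.2 TrivSqZeroExt.snd_one
  mul_mem := by
    rintro (_ | _ | i) (_ | _ | j) x y hx hy <;>
      simp only [zero_add, mem_intervalGrading_zero, mem_intervalGrading_one,
        mem_intervalGrading_add_two] at hx hy
    · simp [mem_intervalGrading_zero, hx, hy]
    · simp [mem_intervalGrading_one, hy]
    · simp [hy]
    · simp [mem_intervalGrading_one, hx]
    · have h : x * y = 0 := by ext <;> simp [hx, hy]
      rw [h]; exact Submodule.zero_mem _
    · simp [hy]
    all_goals simp [hx]

open Polynomial in
/-- The decomposition of `k[t, dt]` into its homogeneous components. -/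
noncomputable def intervalDecompose (k : Type u) [Field k] :
    TrivSqZeroExt k[X] k[X] →+ ⨁ n, intervalGrading k n :=
  AddMonoidHom.mk' (fun x =>
    DirectSum.of (fun n => intervalGrading k n) 0
      ⟨TrivSqZeroExt.inl x.fst, mem_intervalGrading_zero.2 (TrivSqZeroExt.snd_inl k[X] _)⟩ +
    DirectSum.of (fun n => intervalGrading k n) 1
      ⟨TrivSqZeroExt.inr x.snd, mem_intervalGrading_one.2 (TrivSqZeroExt.fst_inr k[X] _)⟩)
    (fun x y => by
      simp only [TrivSqZeroExt.fst_add, TrivSqZeroExt.snd_add, TrivSqZeroExt.inl_add,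
        TrivSqZeroExt.inr_add]
      rw [add_add_add_comm, ← map_add, ← map_add]
      rfl)

open Polynomial in
lemma intervalDecompose_apply (x : TrivSqZeroExt k[X] k[X]) :
    intervalDecompose k x = DirectSum.of (fun n => intervalGrading k n) 0
      ⟨TrivSqZeroExt.inl x.fst, mem_intervalGrading_zero.2 (TrivSqZeroExt.snd_inl k[X] _)⟩ +
    DirectSum.of (fun n => intervalGrading k n) 1
      ⟨TrivSqZeroExt.inr x.snd, mem_intervalGrading_one.2 (TrivSqZeroExt.fst_inr k[X] _)⟩ := rfl

open Polynomial in
noncomputable instance (k : Type u) [Field k] : DirectSum.Decomposition (intervalGrading k) where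
  decompose' := intervalDecompose k
  left_inv x := by
    rw [intervalDecompose_apply, map_add, DirectSum.coeAddMonoidHom_of, DirectSum.coeAddMonoidHom_of]
    exact TrivSqZeroExt.inl_fst_add_inr_snd_eq x
  right_inv x := by
    induction x using DirectSum.induction_on with
    | zero => rw [map_zero, map_zero]
    | of n x =>
      obtain ⟨x, hx⟩ := x
      rw [DirectSum.coeAddMonoidHom_of, intervalDecompose_apply]
      rcases n with _ | _ | n
      · have hx' := mem_intervalGrading_zero.1 hx
        have h : (TrivSqZeroExt.inl x.fst : TrivSqZeroExt k[X] k[X]) = x := by ext <;> simp [hx']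
        simp only [hx', TrivSqZeroExt.inr_zero, h]
        rw [← ZeroMemClass.zero_def, map_zero, add_zero]
      · have hx' := mem_intervalGrading_one.1 hx
        have h : (TrivSqZeroExt.inr x.snd : TrivSqZeroExt k[X] k[X]) = x := by ext <;> simp [hx']
        simp only [hx', TrivSqZeroExt.inl_zero, h]
        rw [← ZeroMemClass.zero_def, map_zero, zero_add]
      · have hx' := mem_intervalGrading_add_two.1 hx
        subst hx'
        simp only [TrivSqZeroExt.fst_zero, TrivSqZeroExt.snd_zero, TrivSqZeroExt.inl_zero,
          TrivSqZeroExt.inr_zero]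
        rw [← ZeroMemClass.zero_def, ← ZeroMemClass.zero_def, ← ZeroMemClass.zero_def, map_zero,
          map_zero, map_zero, add_zero]
    | add x y hx hy => rw [map_add, map_add, hx, hy]

noncomputable instance (k : Type u) [Field k] : GradedAlgebra (intervalGrading k) where

open Polynomial in
/-- The differential of `k[t, dt]`: `d (p + q dt) = p' dt`. -/
noncomputable def intervalD (k : Type u) [Field k] :
    TrivSqZeroExt k[X] k[X] →ₗ[k] TrivSqZeroExt k[X] k[X] :=
  ((TrivSqZeroExt.inrHom k[X] k[X]).restrictScalars k) ∘ₗ Polynomial.derivative ∘ₗ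
    (TrivSqZeroExt.fstHom k k[X] k[X]).toLinearMap

open Polynomial in
lemma intervalD_apply (x : TrivSqZeroExt k[X] k[X]) :
    intervalD k x = TrivSqZeroExt.inr (derivative x.fst) := rfl

open Polynomial in
/-- The cdg algebra `k[t, dt]`: its elements are `p(t) + q(t) dt`, with `t` of degree `0`, `dt` of
degree `1`, `dt² = 0` and `d p = p' dt`. The pair `(p, q)` of the trivial square zero extension
stands for `p(t) + q(t) dt`. -/
noncomputable def interval (k : Type u) [Field k] : CDGA k where
  carrier := TrivSqZeroExt k[X] k[X]
  grading := intervalGrading k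
  d := intervalD k
  d_mem := by
    rintro (_ | _ | i) x hx
    · exact mem_intervalGrading_one.2 (TrivSqZeroExt.fst_inr k[X] _)
    · have h : intervalD k x = 0 := by
        rw [intervalD_apply, mem_intervalGrading_one.1 hx, map_zero, TrivSqZeroExt.inr_zero]
      rw [h]; exact Submodule.zero_mem _
    · rw [mem_intervalGrading_add_two.1 hx, map_zero]; exact Submodule.zero_mem _
  d_d x := by
    rw [intervalD_apply, intervalD_apply, TrivSqZeroExt.fst_inr, map_zero, TrivSqZeroExt.inr_zero]
  leibniz := by
    rintro (_ | _ | i) x y hx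
    · have hx' := mem_intervalGrading_zero.1 hx
      simp only [intervalD_apply]
      ext
      · simp
      · simp [mul_comm, add_comm]
    · have hx' := mem_intervalGrading_one.1 hx
      simp only [intervalD_apply]
      ext <;> simp [hx']
    · rw [mem_intervalGrading_add_two.1 hx]; simp
  comm := by
    rintro i j x y hx hy
    rcases Nat.even_or_odd (i * j) with h | h
    · rw [h.neg_one_pow, one_smul, mul_comm]
    · rw [Nat.odd_mul] at h
      have h1 : x.fst = 0 := by
        rcases i with _ | _ | i
        · simp at h
        · exact mem_intervalGrading_one.1 hx
        · rw [mem_intervalGrading_add_two.1 hx]; rfl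
      have h2 : y.fst = 0 := by
        rcases j with _ | _ | j
        · simp at h
        · exact mem_intervalGrading_one.1 hy
        · rw [mem_intervalGrading_add_two.1 hy]; rfl
      ext <;> simp [h1, h2]

/-- The path object `Path(B) = B ⊗ k[t, dt]`. -/
noncomputable def path (B : CDGA k) : CDGA k := tensor B (interval k)

/-- The evaluation `k[t, dt] → B`, `p(t) + q(t) dt ↦ p(c)`. -/
noncomputable def intervalEval (B : CDGA k) (c : k) : (interval k).carrier →ₐ[k] B.carrier :=
  ((Algebra.ofId k B.carrier).comp (Polynomial.aeval c)).comp
    (TrivSqZeroExt.fstHom k (Polynomial k) (Polynomial k))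

lemma intervalEval_apply (B : CDGA k) (c : k) (b : (interval k).carrier) :
    intervalEval B c b = algebraMap k B.carrier (Polynomial.aeval c (TrivSqZeroExt.fst b)) := rfl

lemma intervalEval_pos (B : CDGA k) (c : k) {j : ℕ} {b : (interval k).carrier}
    (hb : b ∈ (interval k).grading (j + 1)) : intervalEval B c b = 0 := by
  have hb : TrivSqZeroExt.fst b = 0 := by
    rcases j with _ | j
    · exact mem_intervalGrading_one.1 hb
    · rw [(mem_intervalGrading_add_two (n := j)).1 hb]; rfl
  rw [intervalEval_apply, hb, map_zero, map_zero]

/-- The algebra morphism `Path(B) → B` evaluating at `t = c`: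
`b ⊗ (p(t) + q(t) dt) ↦ p(c) b`. -/
noncomputable def pathEvalAlgHom (B : CDGA k) (c : k) :
    TensorCarrier B (interval k) →ₐ[k] B.carrier :=
  GradedTensorProduct.lift B.grading (interval k).grading (AlgHom.id k B.carrier)
    (intervalEval B c) (by
      rintro i (_ | j) a ⟨b, hb⟩
      · rw [zero_mul, uzpow_zero, one_smul]
        exact (Algebra.commutes _ _).symm
      · rw [intervalEval_pos B c hb, mul_zero, zero_mul, smul_zero])

lemma pathEvalAlgHom_tmul (B : CDGA k) (c : k) (b : B.carrier) (x : (interval k).carrier) :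
    pathEvalAlgHom B c (tmul B (interval k) b x) = b * intervalEval B c x := rfl

lemma pathEvalAlgHom_mem (B : CDGA k) (c : k) {n : ℕ} {x : TensorCarrier B (interval k)}
    (hx : x ∈ tensorGrading B (interval k) n) : pathEvalAlgHom B c x ∈ B.grading n := by
  induction hx using Submodule.span_induction with
  | mem x h =>
    obtain ⟨i, j, rfl, b, hb, y, hy, rfl⟩ := h
    rw [pathEvalAlgHom_tmul]
    rcases j with _ | j
    · rw [intervalEval_apply, ← Algebra.commutes, ← Algebra.smul_def]
      exact Submodule.smul_mem _ _ hb
    · rw [intervalEval_pos B c hy, mul_zero]; exact Submodule.zero_mem _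
  | zero => rw [map_zero]; exact Submodule.zero_mem _
  | add x y hx hy ihx ihy => rw [map_add]; exact Submodule.add_mem _ ihx ihy
  | smul c x hx ih => rw [map_smul]; exact Submodule.smul_mem _ _ ih

/-- The morphism `Path(B) → B` evaluating at `t = c`. The structure maps `δ₀`, `δ₁` of the path
object are the evaluations at `0` and `1`. -/
noncomputable def pathEval (B : CDGA k) (c : k) : path B ⟶ B where
  toAlgHom := pathEvalAlgHom B c
  map_mem := pathEvalAlgHom_mem B c
  map_d := by
    have h : (pathEvalAlgHom B c).toLinearMap ∘ₗ tensorD B (interval k) =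
        B.d ∘ₗ (pathEvalAlgHom B c).toLinearMap :=
      tensor_hom_ext B (interval k) fun i j b y hb hy => by
        have hd : intervalEval B c ((interval k).d y) = 0 := intervalEval_pos B c (j := 0)
          (mem_intervalGrading_one.2 (TrivSqZeroExt.fst_inr (Polynomial k) _))
        simp only [LinearMap.comp_apply, AlgHom.toLinearMap_apply, tensorD_tmul _ _ _ hb,
          map_add, map_smul, pathEvalAlgHom_tmul, hd, mul_zero, smul_zero, add_zero]
        rw [intervalEval_apply, ← Algebra.commutes, ← Algebra.commutes, ← Algebra.smul_def,
          ← Algebra.smul_def, map_smul]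
    exact fun x => LinearMap.congr_fun h x

/-- A right homotopy from `f₀` to `f₁`: a morphism `H : A ⟶ Path(B)` with `δ₀ H = f₀` and
`δ₁ H = f₁`. -/
def RightHomotopic {A B : CDGA k} (f₀ f₁ : A ⟶ B) : Prop :=
  ∃ H : A ⟶ path B, H ≫ pathEval B 0 = f₀ ∧ H ≫ pathEval B 1 = f₁

/-! ### Sullivan minimal algebras -/

/-- The relations `v w = (-1)^(i j) w v` for `v ∈ V i` and `w ∈ V j`. -/
inductive FreeRel (k : Type u) [Field k] (V : ℕ → Type u) [∀ i, AddCommGroup (V i)]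
    [∀ i, Module k (V i)] : TensorAlgebra k (⨁ i, V i) → TensorAlgebra k (⨁ i, V i) → Prop
  | swap (i j : ℕ) (v : V i) (w : V j) : FreeRel k V
      (TensorAlgebra.ι k (DirectSum.lof k ℕ V i v) * TensorAlgebra.ι k (DirectSum.lof k ℕ V j w))
      ((-1 : k) ^ (i * j) • (TensorAlgebra.ι k (DirectSum.lof k ℕ V j w) *
        TensorAlgebra.ι k (DirectSum.lof k ℕ V i v)))

/-- The free graded commutative algebra `Λ(V)` on a graded vector space `V`, over a field of
characteristic different from `2`: the quotient of the tensor algebra of `V` by the relations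
`v w = (-1)^(|v| |w|) w v`. -/
abbrev FreeGradedCommutative (k : Type u) [Field k] (V : ℕ → Type u) [∀ i, AddCommGroup (V i)]
    [∀ i, Module k (V i)] : Type u :=
  RingQuot (FreeRel k V)

/-- The algebra morphism `Λ(V) → A` induced by a graded subspace `V` of `A`. -/
noncomputable def freeMap (A : CDGA k) (V : ℕ → Submodule k A.carrier)
    (hV : ∀ i, V i ≤ A.grading i) : FreeGradedCommutative k (fun i => V i) →ₐ[k] A.carrier :=
  RingQuot.liftAlgHom k ⟨TensorAlgebra.lift k (DirectSum.coeLinearMap V), by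
    rintro _ _ ⟨i, j, v, w⟩
    simp only [map_mul, map_smul, TensorAlgebra.lift_ι_apply, DirectSum.coeLinearMap_lof]
    exact A.comm (hV i v.2) (hV j w.2)⟩

/-- The underlying graded algebra of `A` is a free graded commutative algebra `Λ(V)`. -/
def IsFree (A : CDGA k) : Prop :=
  ∃ (V : ℕ → Submodule k A.carrier) (hV : ∀ i, V i ≤ A.grading i),
    Function.Bijective (A.freeMap V hV)

/-- The subspace `A⁺ = ⨁_{i > 0} Aⁱ`. -/
def plus (A : CDGA k) : Submodule k A.carrier :=
  ⨆ i : ℕ, A.grading (i + 1)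

/-- `A` is a `1`-connected Sullivan minimal algebra: `A = Λ(V)` is free as a graded commutative
algebra, `A⁰ = k`, `A¹ = 0` and `d A⁺ ⊆ A⁺ · A⁺`. -/
structure IsSullivanMinimal (A : CDGA k) : Prop where
  free : A.IsFree
  unit_injective : Function.Injective (algebraMap k A.carrier)
  grading_zero : A.grading 0 = LinearMap.range (Algebra.linearMap k A.carrier)
  grading_one : A.grading 1 = ⊥
  d_plus : A.plus.map A.d ≤ A.plus * A.plus

end CDGA

/-- The category of `1`-connected cdg algebras over `k`, a full subcategory of the category of
cdg algebras. -/
abbrev Adgc₁ (k : Type u) [Field k] : Type (u + 1) :=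
  ObjectProperty.FullSubcategory (fun A : CDGA k => A.IsOneConnected)

namespace Adgc₁

variable (k : Type u) [Field k]

/-- The equivalence relation transitively generated by right homotopy. -/
def homotopic : HomRel (Adgc₁ k) :=
  fun A B => Relation.EqvGen (fun f g : A ⟶ B => CDGA.RightHomotopic f.hom g.hom)

/-- The strong equivalences: the homotopy equivalences. -/
def strong : MorphismProperty (Adgc₁ k) := equivalenceClass (homotopic k)

/-- The weak equivalences: the quasi-isomorphisms. -/
def weak : MorphismProperty (Adgc₁ k) := fun _ _ f => CDGA.IsQuasiIso f.hom

end Adgc₁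

namespace CDGA
variable {k : Type u} [Field k]

/-! ### Homogeneous components -/

/-- The homogeneous component of degree `n`. -/
noncomputable def proj (A : CDGA k) (n : ℕ) : A.carrier →ₗ[k] A.carrier :=
  GradedAlgebra.proj A.grading n

lemma proj_mem (A : CDGA k) (n : ℕ) (a : A.carrier) : A.proj n a ∈ A.grading n :=
  (DirectSum.decompose A.grading a n).2

lemma proj_of_mem (A : CDGA k) {n : ℕ} {a : A.carrier} (ha : a ∈ A.grading n) :
    A.proj n a = a :=
  DirectSum.decompose_of_mem_same A.grading ha

lemma proj_of_mem_ne (A : CDGA k) {m n : ℕ} {a : A.carrier} (ha : a ∈ A.grading m)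
    (h : m ≠ n) : A.proj n a = 0 :=
  DirectSum.decompose_of_mem_ne A.grading ha h

lemma linearMap_ext (A : CDGA k) {N : Type*} [AddCommGroup N] [Module k N]
    {f g : A.carrier →ₗ[k] N} (h : ∀ n, ∀ a ∈ A.grading n, f a = g a) : f = g :=
  DirectSum.decompose_lhom_ext A.grading fun n => LinearMap.ext fun a => h n a a.2

lemma ext_proj (A : CDGA k) {a b : A.carrier} (h : ∀ n, A.proj n a = A.proj n b) : a = b := by
  apply (DirectSum.decompose A.grading).injective
  ext n
  exact h n

lemma eq_zero_of_mem_of_mem (A : CDGA k) {m n : ℕ} {a : A.carrier} (h : a ∈ A.grading m)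
    (h' : a ∈ A.grading n) (hmn : m ≠ n) : a = 0 := by
  rw [← A.proj_of_mem h', A.proj_of_mem_ne h hmn]

lemma induction_homogeneous (A : CDGA k) {p : A.carrier → Prop}
    (h0 : p 0) (h : ∀ n, ∀ a ∈ A.grading n, p a) (hadd : ∀ a b, p a → p b → p (a + b))
    (a : A.carrier) : p a :=
  DirectSum.Decomposition.inductionOn A.grading h0 (fun m => h _ m m.2) hadd a

lemma d_proj (A : CDGA k) (n : ℕ) (a : A.carrier) : A.d (A.proj n a) = A.proj (n + 1) (A.d a) := by
  have h : A.d ∘ₗ A.proj n = A.proj (n + 1) ∘ₗ A.d := A.linearMap_ext fun m a ha => by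
    simp only [LinearMap.comp_apply]
    by_cases hm : m = n
    · subst hm
      rw [A.proj_of_mem ha, A.proj_of_mem (A.d_mem ha)]
    · rw [A.proj_of_mem_ne ha hm, A.proj_of_mem_ne (A.d_mem ha) (by omega), map_zero]
  exact LinearMap.congr_fun h a

lemma proj_zero_d (A : CDGA k) (a : A.carrier) : A.proj 0 (A.d a) = 0 := by
  have h : A.proj 0 ∘ₗ A.d = 0 := A.linearMap_ext fun m a ha =>
    A.proj_of_mem_ne (A.d_mem ha) (by omega)
  exact LinearMap.congr_fun h a

lemma map_proj {A B : CDGA k} (f : A ⟶ B) (n : ℕ) (a : A.carrier) :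
    f.toAlgHom (A.proj n a) = B.proj n (f.toAlgHom a) := by
  have h : f.toAlgHom.toLinearMap ∘ₗ A.proj n = B.proj n ∘ₗ f.toAlgHom.toLinearMap :=
    A.linearMap_ext fun m a ha => by
      simp only [LinearMap.comp_apply, AlgHom.toLinearMap_apply]
      by_cases hm : m = n
      · subst hm
        rw [A.proj_of_mem ha, B.proj_of_mem (f.map_mem ha)]
      · rw [A.proj_of_mem_ne ha hm, B.proj_of_mem_ne (f.map_mem ha) hm, map_zero]
  exact LinearMap.congr_fun h a

lemma exists_homogeneous_primitive (A : CDGA k) {n : ℕ} {a b : A.carrier}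
    (ha : a ∈ A.grading (n + 1)) (h : a = A.d b) : ∃ b ∈ A.grading n, a = A.d b :=
  ⟨A.proj n b, A.proj_mem n b, by rw [d_proj, ← h, A.proj_of_mem ha]⟩

lemma eq_zero_of_exact_of_mem_zero (A : CDGA k) {a b : A.carrier}
    (ha : a ∈ A.grading 0) (h : a = A.d b) : a = 0 := by
  rw [← A.proj_of_mem ha, h, proj_zero_d]

lemma one_mem_zero (A : CDGA k) : (1 : A.carrier) ∈ A.grading 0 :=
  SetLike.GradedOne.one_mem (A := A.grading)

lemma mul_mem_grading (A : CDGA k) {i j n : ℕ} {a b : A.carrier} (ha : a ∈ A.grading i)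
    (hb : b ∈ A.grading j) (h : i + j = n) : a * b ∈ A.grading n :=
  h ▸ SetLike.GradedMul.mul_mem ha hb

lemma algebraMap_mem_zero (A : CDGA k) (c : k) : algebraMap k A.carrier c ∈ A.grading 0 := by
  rw [Algebra.algebraMap_eq_smul_one]
  exact Submodule.smul_mem _ _ A.one_mem_zero

lemma d_algebraMap (A : CDGA k) (c : k) : A.d (algebraMap k A.carrier c) = 0 := by
  rw [Algebra.algebraMap_eq_smul_one, map_smul, d_one, smul_zero]

/-! ### The degree involution -/

lemma sign_mem (A : CDGA k) {n : ℕ} {a : A.carrier} (ha : a ∈ A.grading n) :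
    A.sign a ∈ A.grading n := by
  rw [sign_apply A ha]; exact Submodule.smul_mem _ _ ha

lemma sign_mul (A : CDGA k) (a b : A.carrier) : A.sign (a * b) = A.sign a * A.sign b := by
  induction a using A.induction_homogeneous with
  | h0 => simp
  | hadd a a' h h' => simp only [add_mul, map_add, h, h']
  | h i a ha =>
    induction b using A.induction_homogeneous with
    | h0 => simp
    | hadd b b' h h' => simp only [mul_add, map_add, h, h']
    | h j b hb =>
      rw [sign_apply A ha, sign_apply A hb, sign_apply A (A.mul_mem_grading ha hb rfl),
        smul_mul_smul_comm, pow_add]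

lemma sign_d (A : CDGA k) (a : A.carrier) : A.sign (A.d a) = - A.d (A.sign a) := by
  have h : A.sign ∘ₗ A.d = - (A.d ∘ₗ A.sign) := A.linearMap_ext fun m a ha => by
    simp only [LinearMap.comp_apply, LinearMap.neg_apply]
    rw [sign_apply A ha, sign_apply A (A.d_mem ha), map_smul, pow_succ]
    simp
  exact LinearMap.congr_fun h a

lemma map_sign {A B : CDGA k} (f : A.carrier →ₐ[k] B.carrier)
    (hf : ∀ i, ∀ a ∈ A.grading i, f a ∈ B.grading i) (a : A.carrier) :
    f (A.sign a) = B.sign (f a) := by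
  have h : f.toLinearMap ∘ₗ A.sign = B.sign ∘ₗ f.toLinearMap := A.linearMap_ext fun m a ha => by
    simp only [LinearMap.comp_apply, AlgHom.toLinearMap_apply]
    rw [sign_apply A ha, sign_apply B (hf _ a ha), map_smul]
  exact LinearMap.congr_fun h a

lemma d_mul (A : CDGA k) (a b : A.carrier) : A.d (a * b) = A.d a * b + A.sign a * A.d b := by
  induction a using A.induction_homogeneous with
  | h0 => simp
  | hadd a a' h h' => simp only [add_mul, map_add, h, h']; abel
  | h i a ha => rw [A.leibniz b ha, sign_apply A ha, smul_mul_assoc]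

/-! ### Morphisms -/

@[simp] lemma id_apply (A : CDGA k) (a : A.carrier) : Hom.toAlgHom (𝟙 A) a = a := rfl

@[simp] lemma comp_apply {A B C : CDGA k} (f : A ⟶ B) (g : B ⟶ C) (a : A.carrier) :
    (f ≫ g).toAlgHom a = g.toAlgHom (f.toAlgHom a) := rfl

lemma hom_ext {A B : CDGA k} {f g : A ⟶ B} (h : ∀ a, f.toAlgHom a = g.toAlgHom a) : f = g :=
  Hom.ext (AlgHom.ext h)

/-- A bijective morphism is an isomorphism. -/
lemma isIso_of_bijective {A B : CDGA k} (f : A ⟶ B) (hf : Function.Bijective f.toAlgHom) :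
    IsIso f := by
  let e := AlgEquiv.ofBijective f.toAlgHom hf
  have he : ∀ a, f.toAlgHom (e.symm a) = a := e.apply_symm_apply
  have he' : ∀ a, e.symm (f.toAlgHom a) = a := e.symm_apply_apply
  let g : B ⟶ A :=
    { toAlgHom := e.symm.toAlgHom
      map_mem := by
        intro i b hb
        change e.symm b ∈ A.grading i
        have : e.symm b = A.proj i (e.symm b) := hf.1 (by
          rw [map_proj, he, B.proj_of_mem hb])
        rw [this]
        exact A.proj_mem _ _
      map_d := fun b => hf.1 (by
        change f.toAlgHom (e.symm _) = f.toAlgHom (A.d (e.symm _))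
        rw [he, f.map_d, he]) }
  exact ⟨g, hom_ext he', hom_ext he⟩

lemma bijective_of_isIso {A B : CDGA k} (f : A ⟶ B) [IsIso f] :
    Function.Bijective f.toAlgHom := by
  refine Function.bijective_iff_has_inverse.2 ⟨(inv f).toAlgHom, fun a => ?_, fun b => ?_⟩
  · rw [← comp_apply, IsIso.hom_inv_id, id_apply]
  · rw [← comp_apply, IsIso.inv_hom_id, id_apply]

/-! ### Quasi-isomorphisms, elementwise -/

lemma cohomologyMap_mk {A B : CDGA k} (f : A ⟶ B) (n : ℕ) (a : A.cocycles n) :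
    cohomologyMap f n (Submodule.Quotient.mk a) = Submodule.Quotient.mk (cocyclesMap f n a) := rfl

lemma mem_boundaries (A : CDGA k) {n : ℕ} (a : A.cocycles n) :
    a ∈ A.boundaries n ↔ ∃ b, A.d b = a := Iff.rfl

@[simp] lemma coe_cocyclesMap {A B : CDGA k} (f : A ⟶ B) (n : ℕ) (a : A.cocycles n) :
    (cocyclesMap f n a : B.carrier) = f.toAlgHom a := rfl

lemma cohomologyMap_id (A : CDGA k) (n : ℕ) (x : A.cohomology n) : cohomologyMap (𝟙 A) n x = x := by
  obtain ⟨a, rfl⟩ := Submodule.Quotient.mk_surjective _ x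
  rfl

lemma cohomologyMap_comp {A B C : CDGA k} (f : A ⟶ B) (g : B ⟶ C) (n : ℕ) (x : A.cohomology n) :
    cohomologyMap (f ≫ g) n x = cohomologyMap g n (cohomologyMap f n x) := by
  obtain ⟨a, rfl⟩ := Submodule.Quotient.mk_surjective _ x
  rfl

lemma surjective_cohomologyMap_iff {A B : CDGA k} (f : A ⟶ B) (n : ℕ) :
    Function.Surjective (cohomologyMap f n) ↔ ∀ b ∈ B.grading n, B.d b = 0 →
      ∃ a ∈ A.grading n, A.d a = 0 ∧ ∃ c, b = f.toAlgHom a + B.d c := by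
  constructor
  · intro h b hb hd
    obtain ⟨x, hx⟩ := h (Submodule.Quotient.mk ⟨b, hd, hb⟩)
    obtain ⟨a, rfl⟩ := Submodule.Quotient.mk_surjective _ x
    rw [cohomologyMap_mk, eq_comm, Submodule.Quotient.eq, mem_boundaries] at hx
    obtain ⟨c, hc⟩ := hx
    refine ⟨a, a.2.2, a.2.1, c, ?_⟩
    rw [hc]
    simp
  · intro h y
    obtain ⟨b, rfl⟩ := Submodule.Quotient.mk_surjective _ y
    obtain ⟨a, ha, hd, c, hc⟩ := h b b.2.2 b.2.1
    refine ⟨Submodule.Quotient.mk ⟨a, hd, ha⟩, ?_⟩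
    rw [cohomologyMap_mk, eq_comm, Submodule.Quotient.eq, mem_boundaries]
    exact ⟨c, by simp [hc]⟩

lemma injective_cohomologyMap_iff {A B : CDGA k} (f : A ⟶ B) (n : ℕ) :
    Function.Injective (cohomologyMap f n) ↔ ∀ a ∈ A.grading n, A.d a = 0 →
      ∀ b, f.toAlgHom a = B.d b → ∃ c, a = A.d c := by
  rw [injective_iff_map_eq_zero]
  constructor
  · intro h a ha hd b hb
    have := h (Submodule.Quotient.mk ⟨a, hd, ha⟩) (by
      rw [cohomologyMap_mk, Submodule.Quotient.mk_eq_zero, mem_boundaries]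
      exact ⟨b, hb.symm⟩)
    rw [Submodule.Quotient.mk_eq_zero, mem_boundaries] at this
    exact this.imp fun c hc => hc.symm
  · intro h x hx
    obtain ⟨a, rfl⟩ := Submodule.Quotient.mk_surjective _ x
    rw [cohomologyMap_mk, Submodule.Quotient.mk_eq_zero, mem_boundaries] at hx
    obtain ⟨b, hb⟩ := hx
    rw [Submodule.Quotient.mk_eq_zero, mem_boundaries]
    exact (h a a.2.2 a.2.1 b hb.symm).imp fun c hc => hc.symm

lemma isQuasiIso_iff {A B : CDGA k} (f : A ⟶ B) : IsQuasiIso f ↔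
    (∀ n, ∀ a ∈ A.grading n, A.d a = 0 → ∀ b, f.toAlgHom a = B.d b → ∃ c, a = A.d c) ∧
    ∀ n, ∀ b ∈ B.grading n, B.d b = 0 →
      ∃ a ∈ A.grading n, A.d a = 0 ∧ ∃ c, b = f.toAlgHom a + B.d c := by
  simp only [IsQuasiIso, Function.Bijective, forall_and, injective_cohomologyMap_iff,
    surjective_cohomologyMap_iff]

lemma IsQuasiIso.comp {A B C : CDGA k} {f : A ⟶ B} {g : B ⟶ C} (hf : IsQuasiIso f)
    (hg : IsQuasiIso g) : IsQuasiIso (f ≫ g) := fun n => by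
  have : ⇑(cohomologyMap (f ≫ g) n) = cohomologyMap g n ∘ cohomologyMap f n :=
    funext fun x => cohomologyMap_comp f g n x
  rw [this]
  exact (hg n).comp (hf n)

lemma isQuasiIso_of_isIso {A B : CDGA k} (f : A ⟶ B) [IsIso f] : IsQuasiIso f := fun n => by
  refine Function.bijective_iff_has_inverse.2 ⟨cohomologyMap (inv f) n, fun x => ?_, fun x => ?_⟩
  · rw [← cohomologyMap_comp, IsIso.hom_inv_id, cohomologyMap_id]
  · rw [← cohomologyMap_comp, IsIso.inv_hom_id, cohomologyMap_id]

lemma cohomologyMap_unit {A B : CDGA k} (f : A ⟶ B) (c : k) :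
    cohomologyMap f 0 (A.unitCohomology c) = B.unitCohomology c := by
  simp only [unitCohomology, LinearMap.toSpanSingleton_apply, map_smul, cohomologyMap_mk]
  congr 2
  ext
  simp

lemma IsQuasiIso.isOneConnected_iff {A B : CDGA k} {f : A ⟶ B} (hf : IsQuasiIso f) :
    A.IsOneConnected ↔ B.IsOneConnected := by
  have h0 : ⇑B.unitCohomology = cohomologyMap f 0 ∘ A.unitCohomology :=
    funext fun c => (cohomologyMap_unit f c).symm
  have h0' : Function.Bijective A.unitCohomology ↔ Function.Bijective B.unitCohomology := by
    rw [h0, Function.Bijective.of_comp_iff' (hf 0)]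
  have h1 : Subsingleton (A.cohomology 1) ↔ Subsingleton (B.cohomology 1) :=
    (Equiv.ofBijective _ (hf 1)).subsingleton_congr
  exact ⟨fun h => ⟨h0'.1 h.h_zero, h1.1 h.h_one⟩, fun h => ⟨h0'.2 h.h_zero, h1.2 h.h_one⟩⟩

lemma IsOneConnected.algebraMap_injective {A : CDGA k} (hA : A.IsOneConnected) :
    Function.Injective (algebraMap k A.carrier) := by
  rw [injective_iff_map_eq_zero]
  intro c hc
  apply hA.h_zero.1
  rw [map_zero]
  simp only [unitCohomology, LinearMap.toSpanSingleton_apply]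
  rw [← Submodule.Quotient.mk_smul, Submodule.Quotient.mk_eq_zero, mem_boundaries]
  exact ⟨0, by rw [map_zero]; simpa [Algebra.algebraMap_eq_smul_one] using hc.symm⟩

lemma IsOneConnected.exists_algebraMap {A : CDGA k} (hA : A.IsOneConnected) {a : A.carrier}
    (ha : a ∈ A.grading 0) (hd : A.d a = 0) : ∃ c : k, a = algebraMap k A.carrier c := by
  obtain ⟨c, hc⟩ := hA.h_zero.2 (Submodule.Quotient.mk ⟨a, hd, ha⟩)
  simp only [unitCohomology, LinearMap.toSpanSingleton_apply] at hc
  rw [← Submodule.Quotient.mk_smul, eq_comm, Submodule.Quotient.eq, mem_boundaries] at hc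
  obtain ⟨b, hb⟩ := hc
  refine ⟨c, sub_eq_zero.1 (A.eq_zero_of_exact_of_mem_zero (b := b)
    (Submodule.sub_mem _ ha (A.algebraMap_mem_zero c)) ?_)⟩
  rw [hb]
  simp [Algebra.algebraMap_eq_smul_one]

lemma IsOneConnected.exists_primitive {A : CDGA k} (hA : A.IsOneConnected) {a : A.carrier}
    (ha : a ∈ A.grading 1) (hd : A.d a = 0) : ∃ b, a = A.d b := by
  have := hA.h_one.elim (Submodule.Quotient.mk ⟨a, hd, ha⟩) 0
  rw [Submodule.Quotient.mk_eq_zero, mem_boundaries] at this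
  exact this.imp fun b hb => hb.symm

end CDGA

namespace CDGA
variable {k : Type u} [Field k]

/-! ### Morphisms out of tensor products and paths -/

lemma comm_zero (C : CDGA k) {a : C.carrier} (ha : a ∈ C.grading 0) (b : C.carrier) :
    a * b = b * a := by
  induction b using C.induction_homogeneous with
  | h0 => simp
  | hadd b b' h h' => rw [mul_add, add_mul, h, h']
  | h j b hb => simpa using C.comm ha hb

/-- The algebra morphism `A ⊗ B → C` with given components. -/
noncomputable def tensorDescAlgHom {A B C : CDGA k} (f : A ⟶ C) (g : B ⟶ C) :
    TensorCarrier A B →ₐ[k] C.carrier :=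
  GradedTensorProduct.lift A.grading B.grading f.toAlgHom g.toAlgHom (by
    rintro i j a b
    rw [C.comm (f.map_mem a.2) (g.map_mem b.2), mul_comm i j, ← uzpow_natCast (R := ℕ),
      Nat.cast_id]
    rcases Nat.even_or_odd (j * i) with h' | h'
    · rw [h'.neg_one_pow, h'.neg_one_pow, one_smul, one_smul]
    · rw [h'.neg_one_pow, h'.neg_one_pow, neg_smul, one_smul, Units.neg_smul, one_smul])

lemma tensorDescAlgHom_tmul {A B C : CDGA k} (f : A ⟶ C) (g : B ⟶ C) (a : A.carrier)
    (b : B.carrier) : tensorDescAlgHom f g (tmul A B a b) = f.toAlgHom a * g.toAlgHom b := rfl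

lemma tensorDescAlgHom_mem {A B C : CDGA k} (f : A ⟶ C) (g : B ⟶ C) {n : ℕ}
    {x : TensorCarrier A B} (hx : x ∈ tensorGrading A B n) :
    tensorDescAlgHom f g x ∈ C.grading n := by
  induction hx using Submodule.span_induction with
  | mem x h =>
    obtain ⟨i, j, rfl, a, ha, b, hb, rfl⟩ := h
    exact C.mul_mem_grading (f.map_mem ha) (g.map_mem hb) rfl
  | zero => rw [map_zero]; exact Submodule.zero_mem _
  | add x y hx hy ihx ihy => rw [map_add]; exact Submodule.add_mem _ ihx ihy
  | smul c x hx ih => rw [map_smul]; exact Submodule.smul_mem _ _ ih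

/-- The morphism `A ⊗ B ⟶ C` with given components. -/
noncomputable def tensorDesc {A B C : CDGA k} (f : A ⟶ C) (g : B ⟶ C) : tensor A B ⟶ C where
  toAlgHom := tensorDescAlgHom f g
  map_mem := tensorDescAlgHom_mem f g
  map_d := by
    have h : (tensorDescAlgHom f g).toLinearMap ∘ₗ tensorD A B =
        C.d ∘ₗ (tensorDescAlgHom f g).toLinearMap :=
      tensor_hom_ext A B fun i j a b ha hb => by
        simp only [LinearMap.comp_apply, tensorD_tmul A B b ha, map_add, map_smul,
          AlgHom.toLinearMap_apply, tensorDescAlgHom_tmul]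
        rw [C.leibniz _ (f.map_mem ha), f.map_d, g.map_d]
    exact fun x => LinearMap.congr_fun h x

lemma tensorDesc_tmul {A B C : CDGA k} (f : A ⟶ C) (g : B ⟶ C) (a : A.carrier) (b : B.carrier) :
    (tensorDesc f g).toAlgHom (tmul A B a b) = f.toAlgHom a * g.toAlgHom b := rfl

/-- The inclusion `A ⟶ A ⊗ B`. -/
noncomputable def tensorInl (A B : CDGA k) : A ⟶ tensor A B where
  toAlgHom := GradedTensorProduct.includeLeft A.grading B.grading
  map_mem ha := tmul_mem A B (add_zero _) ha B.one_mem_zero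
  map_d a := by
    have h : ∀ a, tmul A B (A.d a) 1 = tensorD A B (tmul A B a 1) := by
      intro a
      change _ = tmul A B (A.d a) 1 + tmul A B (A.sign a) (B.d 1)
      rw [d_one, map_zero, add_zero]
    exact h a

/-- The inclusion `B ⟶ A ⊗ B`. -/
noncomputable def tensorInr (A B : CDGA k) : B ⟶ tensor A B where
  toAlgHom := GradedTensorProduct.includeRight A.grading B.grading
  map_mem hb := tmul_mem A B (zero_add _) A.one_mem_zero hb
  map_d b := by
    have h : ∀ b, tmul A B 1 (B.d b) = tensorD A B (tmul A B 1 b) := by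
      intro b
      rw [tensorD_tmul A B b A.one_mem_zero, d_one, map_zero, LinearMap.zero_apply, zero_add,
        pow_zero, one_smul]
    exact h b

lemma tmul_eq_mul (A B : CDGA k) (a : A.carrier) (b : B.carrier) :
    tmul A B a b = tmul A B a 1 * tmul A B 1 b := by
  rw [tmul_mul_tmul A B a b B.one_mem_zero A.one_mem_zero]
  simp

lemma tensor_ext {A B C : CDGA k} {f g : tensor A B ⟶ C}
    (hl : tensorInl A B ≫ f = tensorInl A B ≫ g) (hr : tensorInr A B ≫ f = tensorInr A B ≫ g) :
    f = g := by
  refine Hom.ext (GradedTensorProduct.algHom_ext A.grading B.grading ?_ ?_)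
  · exact congrArg Hom.toAlgHom hl
  · exact congrArg Hom.toAlgHom hr

/-- The element `t` of `k[t, dt]`. -/
noncomputable def intervalT (k : Type u) [Field k] : (interval k).carrier :=
  (TrivSqZeroExt.inl Polynomial.X : TrivSqZeroExt (Polynomial k) (Polynomial k))

lemma intervalT_mem : intervalT k ∈ (interval k).grading 0 :=
  mem_intervalGrading_zero.2 (TrivSqZeroExt.snd_inl _ _)

section intervalDesc

variable (C : CDGA k) {x : C.carrier} (hx : x ∈ C.grading 0)
include hx

lemma aeval_mem_zero (p : Polynomial k) : Polynomial.aeval x p ∈ C.grading 0 := by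
  induction p using Polynomial.induction_on' with
  | add p q hp hq => rw [map_add]; exact Submodule.add_mem _ hp hq
  | monomial n a =>
    rw [Polynomial.aeval_monomial]
    refine C.mul_mem_grading (C.algebraMap_mem_zero a) ?_ (zero_add 0)
    induction n with
    | zero => rw [pow_zero]; exact C.one_mem_zero
    | succ n ih => rw [pow_succ]; exact C.mul_mem_grading ih hx rfl

lemma d_aeval (p : Polynomial k) :
    C.d (Polynomial.aeval x p) = Polynomial.aeval x (Polynomial.derivative p) * C.d x := by
  have hd : ∀ n : ℕ, C.d (x ^ n) = n • (x ^ (n - 1) * C.d x) := by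
    intro n
    induction n with
    | zero => simp [d_one]
    | succ n ih =>
      rw [pow_succ', C.leibniz _ hx, ih, pow_zero, one_smul, ← C.comm_zero
        (by simpa using C.aeval_mem_zero hx (Polynomial.X ^ n))]
      rcases n with _ | n
      · simp
      · simp only [Nat.add_sub_cancel, mul_smul_comm, ← mul_assoc, ← pow_succ']
        rw [← succ_nsmul']
  induction p using Polynomial.induction_on' with
  | add p q hp hq => simp only [map_add, add_mul, hp, hq]
  | monomial n a =>
    rw [Polynomial.derivative_monomial, Polynomial.aeval_monomial, Polynomial.aeval_monomial,
      ← Algebra.smul_def, map_smul, hd, Algebra.smul_def, map_mul, mul_assoc, mul_assoc]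
    congr 1
    rw [map_natCast, nsmul_eq_mul]

variable [CharZero k]

lemma d_mul_d_eq_zero : C.d x * C.d x = 0 := by
  have h := C.comm (C.d_mem hx) (C.d_mem hx)
  rw [zero_add, mul_one, pow_one, neg_smul, one_smul, eq_neg_iff_add_eq_zero, ← two_smul k] at h
  exact (smul_eq_zero.1 h).resolve_left two_ne_zero

open Polynomial in
/-- The algebra morphism `k[t, dt] → C` sending `t` to an element of degree `0`. -/
noncomputable def intervalDescAlgHom : TrivSqZeroExt k[X] k[X] →ₐ[k] C.carrier :=
  TrivSqZeroExt.lift (aeval x)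
    (LinearMap.mulRight k (C.d x) ∘ₗ (aeval x).toLinearMap)
    (fun p q => by
      simp only [LinearMap.comp_apply, LinearMap.mulRight_apply, AlgHom.toLinearMap_apply]
      rw [mul_assoc, ← mul_assoc (C.d x), ← C.comm_zero (C.aeval_mem_zero hx q), mul_assoc,
        C.d_mul_d_eq_zero hx, mul_zero, mul_zero])
    (fun p q => by simp [mul_assoc])
    (fun p q => by
      simp only [LinearMap.comp_apply, LinearMap.mulRight_apply, AlgHom.toLinearMap_apply,
        MulOpposite.smul_eq_mul_unop, MulOpposite.unop_op, map_mul]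
      rw [mul_assoc, mul_assoc, C.comm_zero (C.aeval_mem_zero hx p)])

open Polynomial in
lemma intervalDescAlgHom_apply (y : TrivSqZeroExt k[X] k[X]) :
    C.intervalDescAlgHom hx y = aeval x y.fst + aeval x y.snd * C.d x := rfl

/-- The morphism `k[t, dt] ⟶ C` sending `t` to an element of degree `0`. -/
noncomputable def intervalDesc : interval k ⟶ C where
  toAlgHom := C.intervalDescAlgHom hx
  map_mem := by
    have h : ∀ n, ∀ y ∈ intervalGrading k n, C.intervalDescAlgHom hx y ∈ C.grading n := by
      rintro (_ | _ | n) y hy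
      · rw [intervalDescAlgHom_apply, mem_intervalGrading_zero.1 hy, map_zero, zero_mul, add_zero]
        exact C.aeval_mem_zero hx _
      · rw [intervalDescAlgHom_apply, mem_intervalGrading_one.1 hy, map_zero]
        exact Submodule.add_mem _ (Submodule.zero_mem _)
          (C.mul_mem_grading (C.aeval_mem_zero hx _) (C.d_mem hx) rfl)
      · rw [mem_intervalGrading_add_two.1 hy, map_zero]
        exact Submodule.zero_mem _
    exact fun {n y} => h n y
  map_d := by
    have h : ∀ y, C.intervalDescAlgHom hx (intervalD k y) = C.d (C.intervalDescAlgHom hx y) := by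
      intro y
      rw [intervalDescAlgHom_apply, intervalDescAlgHom_apply, intervalD_apply,
        TrivSqZeroExt.fst_inr, TrivSqZeroExt.snd_inr, map_zero, zero_add, map_add,
        C.d_aeval hx, C.leibniz _ (C.aeval_mem_zero hx _), C.d_aeval hx, C.d_d, mul_assoc,
        C.d_mul_d_eq_zero hx, mul_zero, mul_zero, smul_zero, add_zero, add_zero]
    exact h

lemma intervalDesc_T : (C.intervalDesc hx).toAlgHom (intervalT k) = x := by
  change Polynomial.aeval x Polynomial.X + Polynomial.aeval x 0 * C.d x = x
  simp

end intervalDesc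

lemma interval_ext {C : CDGA k} {f g : interval k ⟶ C}
    (h : f.toAlgHom (intervalT k) = g.toAlgHom (intervalT k)) : f = g := by
  have h1 : f.toAlgHom.comp (TrivSqZeroExt.inlAlgHom k (Polynomial k) (Polynomial k)) =
      g.toAlgHom.comp (TrivSqZeroExt.inlAlgHom k (Polynomial k) (Polynomial k)) :=
    Polynomial.algHom_ext h
  refine Hom.ext (TrivSqZeroExt.algHom_ext' h1 ?_)
  refine LinearMap.ext fun q => ?_
  have hq : (TrivSqZeroExt.inr q : TrivSqZeroExt (Polynomial k) (Polynomial k)) =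
      TrivSqZeroExt.inl q * intervalD k (TrivSqZeroExt.inl Polynomial.X) := by
    rw [intervalD_apply, TrivSqZeroExt.fst_inl, Polynomial.derivative_X,
      TrivSqZeroExt.inl_mul_inr, smul_eq_mul, mul_one]
  have key : ∀ f : interval k ⟶ C, f.toAlgHom (TrivSqZeroExt.inr q :
      TrivSqZeroExt (Polynomial k) (Polynomial k)) =
      f.toAlgHom.comp (TrivSqZeroExt.inlAlgHom k (Polynomial k) (Polynomial k)) q *
        C.d (f.toAlgHom (intervalT k)) := by
    intro f
    rw [← f.map_d, hq]
    exact map_mul f.toAlgHom _ _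
  have hf := key f
  rw [h1, h] at hf
  exact hf.trans (key g).symm

/-- The constant paths. -/
noncomputable def pathConst (B : CDGA k) : B ⟶ path B := tensorInl B (interval k)

/-- The element `1 ⊗ t` of `Path(B)`. -/
noncomputable def pathT (B : CDGA k) : (path B).carrier := tmul B (interval k) 1 (intervalT k)

lemma pathT_mem (B : CDGA k) : B.pathT ∈ (path B).grading 0 :=
  tmul_mem B (interval k) (zero_add 0) B.one_mem_zero intervalT_mem

lemma path_ext {B C : CDGA k} {f g : path B ⟶ C}
    (h : ∀ b, f.toAlgHom (B.pathConst.toAlgHom b) = g.toAlgHom (B.pathConst.toAlgHom b))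
    (hT : f.toAlgHom B.pathT = g.toAlgHom B.pathT) : f = g :=
  tensor_ext (hom_ext h) (interval_ext hT)

@[simp] lemma pathEval_const (B : CDGA k) (c : k) (b : B.carrier) :
    (pathEval B c).toAlgHom (B.pathConst.toAlgHom b) = b := by
  refine (pathEvalAlgHom_tmul B c b 1).trans ?_
  rw [map_one, mul_one]

@[simp] lemma pathEval_T (B : CDGA k) (c : k) :
    (pathEval B c).toAlgHom B.pathT = algebraMap k B.carrier c := by
  refine (pathEvalAlgHom_tmul B c 1 _).trans ?_
  rw [one_mul, intervalEval_apply]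
  change algebraMap k _ (Polynomial.aeval c Polynomial.X) = _
  rw [Polynomial.aeval_X]

@[simp] lemma pathConst_pathEval (B : CDGA k) (c : k) : B.pathConst ≫ pathEval B c = 𝟙 B :=
  hom_ext fun b => B.pathEval_const c b

/-- The morphism `Path(A) ⟶ Path(B)` induced by a morphism `A ⟶ B`. -/
noncomputable def pathMap {A B : CDGA k} (f : A ⟶ B) : path A ⟶ path B :=
  tensorDesc (f ≫ B.pathConst) (tensorInr B (interval k))

lemma pathMap_tmul {A B : CDGA k} (f : A ⟶ B) (a : A.carrier) (y : (interval k).carrier) :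
    (pathMap f).toAlgHom (tmul A (interval k) a y) = tmul B (interval k) (f.toAlgHom a) y :=
  (tmul_eq_mul B (interval k) (f.toAlgHom a) y).symm

@[simp] lemma pathMap_const {A B : CDGA k} (f : A ⟶ B) (a : A.carrier) :
    (pathMap f).toAlgHom (A.pathConst.toAlgHom a) = B.pathConst.toAlgHom (f.toAlgHom a) :=
  pathMap_tmul f a 1

@[simp] lemma pathMap_T {A B : CDGA k} (f : A ⟶ B) : (pathMap f).toAlgHom A.pathT = B.pathT := by
  refine (pathMap_tmul f 1 _).trans ?_
  rw [map_one, pathT]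

lemma pathMap_pathEval {A B : CDGA k} (f : A ⟶ B) (c : k) :
    pathMap f ≫ pathEval B c = pathEval A c ≫ f :=
  path_ext (fun a => by simp) (by simp)

lemma pathEval_pathMap_apply {A B : CDGA k} (f : A ⟶ B) (c : k) (z : (path A).carrier) :
    (pathEval B c).toAlgHom ((pathMap f).toAlgHom z) = f.toAlgHom ((pathEval A c).toAlgHom z) :=
  AlgHom.congr_fun (congrArg Hom.toAlgHom (pathMap_pathEval f c)) z

lemma pathMap_surjective {A B : CDGA k} (f : A ⟶ B) (hf : Function.Surjective f.toAlgHom) :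
    Function.Surjective (pathMap f).toAlgHom := by
  intro z
  have hz : z ∈ LinearMap.range (pathMap f).toAlgHom.toLinearMap := by
    induction z using TensorProduct.induction_on with
    | zero => exact Submodule.zero_mem _
    | add x y hx hy => exact Submodule.add_mem _ hx hy
    | tmul b y =>
      obtain ⟨a, rfl⟩ := hf b
      exact ⟨tmul A (interval k) a y, pathMap_tmul f a y⟩
  exact hz

/-! ### Integration along paths -/

section CharZero

variable [CharZero k]

lemma exists_antiderivative (k : Type u) [Field k] [CharZero k] :
    ∃ P : Polynomial k →ₗ[k] Polynomial k, ∀ q, Polynomial.derivative (P q) = q ∧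
      Polynomial.aeval (0 : k) (P q) = 0 := by
  have hs : Function.Surjective (Polynomial.derivative : Polynomial k →ₗ[k] Polynomial k) := by
    intro q
    induction q using Polynomial.induction_on' with
    | add p q hp hq =>
      obtain ⟨p', rfl⟩ := hp
      obtain ⟨q', rfl⟩ := hq
      exact ⟨p' + q', map_add _ _ _⟩
    | monomial n a =>
      refine ⟨Polynomial.monomial (n + 1) (a / ((n : k) + 1)), ?_⟩
      rw [Polynomial.derivative_monomial, Nat.add_sub_cancel, Nat.cast_add_one,
        div_mul_cancel₀ _ (Nat.cast_add_one_ne_zero n)]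
  obtain ⟨S, hS⟩ := LinearMap.exists_rightInverse_of_surjective _ (LinearMap.range_eq_top.2 hs)
  refine ⟨S - (Algebra.linearMap k (Polynomial k)) ∘ₗ (Polynomial.aeval (0 : k)).toLinearMap ∘ₗ S,
    fun q => ⟨?_, ?_⟩⟩
  · have h : Polynomial.derivative (S q) = q := LinearMap.congr_fun hS q
    simp [h]
  · simp

/-- The antiderivative of polynomials which vanishes at `0`. -/
noncomputable def antiderivative (k : Type u) [Field k] [CharZero k] :
    Polynomial k →ₗ[k] Polynomial k := (exists_antiderivative k).choose

lemma derivative_antiderivative (q : Polynomial k) :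
    Polynomial.derivative (antiderivative k q) = q := ((exists_antiderivative k).choose_spec q).1

lemma aeval_zero_antiderivative (q : Polynomial k) :
    Polynomial.aeval (0 : k) (antiderivative k q) = 0 := ((exists_antiderivative k).choose_spec q).2

lemma antiderivative_derivative (p : Polynomial k) :
    antiderivative k (Polynomial.derivative p) =
      p - algebraMap k (Polynomial k) (Polynomial.aeval (0 : k) p) := by
  have h : Polynomial.derivative (antiderivative k (Polynomial.derivative p) - p) = 0 := by
    rw [map_sub, derivative_antiderivative, sub_self]
  have h' := Polynomial.eq_C_of_derivative_eq_zero h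
  have h0 := congrArg (Polynomial.aeval (0 : k)) h'
  rw [map_sub, aeval_zero_antiderivative, zero_sub, Polynomial.aeval_C] at h0
  rw [sub_eq_iff_eq_add] at h'
  rw [h', add_comm, sub_eq_add_neg p, ← map_neg, h0]
  rfl

/-- The operator `p + q dt ↦ ∫₀ᵗ q` on `k[t, dt]`. -/
noncomputable def intervalInt (k : Type u) [Field k] [CharZero k] :
    (interval k).carrier →ₗ[k] (interval k).carrier :=
  (TrivSqZeroExt.inlAlgHom k (Polynomial k) (Polynomial k)).toLinearMap ∘ₗ antiderivative k ∘ₗ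
    (TrivSqZeroExt.sndHom (Polynomial k) (Polynomial k)).restrictScalars k

lemma intervalEval_zero_int (B : CDGA k) (y : (interval k).carrier) :
    intervalEval B 0 (intervalInt k y) = 0 := by
  rw [intervalEval_apply]
  change algebraMap k _ (Polynomial.aeval 0 (antiderivative k (TrivSqZeroExt.snd y))) = 0
  rw [aeval_zero_antiderivative, map_zero]

lemma intervalInt_d_add (y : (interval k).carrier) :
    intervalInt k ((interval k).d y) + (interval k).d (intervalInt k y) =
      y - algebraMap k (interval k).carrier (Polynomial.aeval (0 : k) (TrivSqZeroExt.fst y)) := by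
  have h : ∀ y : TrivSqZeroExt (Polynomial k) (Polynomial k),
      (TrivSqZeroExt.inl (antiderivative k (Polynomial.derivative y.fst)) +
        TrivSqZeroExt.inr (Polynomial.derivative (antiderivative k y.snd)) :
        TrivSqZeroExt (Polynomial k) (Polynomial k)) =
      y - algebraMap k (TrivSqZeroExt (Polynomial k) (Polynomial k))
        (Polynomial.aeval (0 : k) y.fst) := by
    intro y
    ext
    · simp [antiderivative_derivative, TrivSqZeroExt.algebraMap_eq_inl']
    · simp [derivative_antiderivative, TrivSqZeroExt.algebraMap_eq_inl']
  exact h y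

/-- The operator `b ⊗ (p + q dt) ↦ (-1)^|b| b ⊗ ∫₀ᵗ q` on `B ⊗ k[t, dt]`. -/
noncomputable def tensorInt (B : CDGA k) :
    TensorCarrier B (interval k) →ₗ[k] TensorCarrier B (interval k) :=
  (GradedTensorProduct.of k B.grading (interval k).grading).toLinearMap ∘ₗ
    TensorProduct.map B.sign (intervalInt k) ∘ₗ
    (GradedTensorProduct.of k B.grading (interval k).grading).symm.toLinearMap

lemma tensorInt_tmul (B : CDGA k) (b : B.carrier) (y : (interval k).carrier) :
    B.tensorInt (tmul B (interval k) b y) = tmul B (interval k) (B.sign b) (intervalInt k y) := rfl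

/-- The operator `b ⊗ (p + q dt) ↦ (-1)^|b| b ⊗ ∫₀ᵗ q` on `Path(B)`. -/
noncomputable def pathInt (B : CDGA k) : (path B).carrier →ₗ[k] (path B).carrier := B.tensorInt

lemma pathInt_tmul (B : CDGA k) (b : B.carrier) (y : (interval k).carrier) :
    B.pathInt (tmul B (interval k) b y) = tmul B (interval k) (B.sign b) (intervalInt k y) := rfl

lemma pathEval_zero_int (B : CDGA k) (z : (path B).carrier) :
    (pathEval B 0).toAlgHom (B.pathInt z) = 0 := by
  refine LinearMap.congr_fun (f := AlgHom.toLinearMap (pathEval B 0).toAlgHom ∘ₗ B.pathInt)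
    (g := 0) ?_ z
  refine tensor_hom_ext B (interval k) fun i j b y hb hy => ?_
  refine (pathEvalAlgHom_tmul B 0 _ _).trans ?_
  rw [intervalEval_zero_int, mul_zero]
  rfl

lemma pathMap_int {A B : CDGA k} (f : A ⟶ B) (z : (path A).carrier) :
    (pathMap f).toAlgHom (A.pathInt z) = B.pathInt ((pathMap f).toAlgHom z) := by
  refine LinearMap.congr_fun (f := AlgHom.toLinearMap (pathMap f).toAlgHom ∘ₗ A.pathInt)
    (g := B.pathInt ∘ₗ AlgHom.toLinearMap (pathMap f).toAlgHom) ?_ z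
  refine tensor_hom_ext A (interval k) fun i j b y hb hy => ?_
  refine (pathMap_tmul f _ _).trans ?_
  refine Eq.trans ?_ (congrArg B.pathInt (pathMap_tmul f b y)).symm
  rw [pathInt_tmul, map_sign f.toAlgHom fun i a ha => f.map_mem ha]

lemma d_pathInt_add (B : CDGA k) (z : (path B).carrier) :
    (path B).d (B.pathInt z) + B.pathInt ((path B).d z) =
      z - B.pathConst.toAlgHom ((pathEval B 0).toAlgHom z) := by
  refine LinearMap.congr_fun (f := (path B).d ∘ₗ B.pathInt + B.pathInt ∘ₗ (path B).d)
    (g := LinearMap.id - B.pathConst.toAlgHom.toLinearMap ∘ₗ (pathEval B 0).toAlgHom.toLinearMap)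
    ?_ z
  refine tensor_hom_ext B (interval k) fun i j b y hb hy => ?_
  change tensorD B (interval k) (tmul B (interval k) (B.sign b) (intervalInt k y)) +
    B.tensorInt (tensorD B (interval k) (tmul B (interval k) b y)) =
    tmul B (interval k) b y -
      tmul B (interval k) (pathEvalAlgHom B 0 (tmul B (interval k) b y)) 1
  rw [tensorD_tmul _ _ _ (B.sign_mem hb), tensorD_tmul _ _ _ hb, pathEvalAlgHom_tmul,
    intervalEval_apply, ← Algebra.commutes, ← Algebra.smul_def]
  rw [map_add, map_smul, tensorInt_tmul, tensorInt_tmul, sign_d, sign_apply B hb]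
  have e : (-1 : k) ^ i * (-1 : k) ^ i = 1 := by rw [← mul_pow]; simp
  simp only [map_neg, map_smul, LinearMap.neg_apply, LinearMap.smul_apply, smul_smul, e, one_smul]
  have h2 := congrArg (tmul B (interval k) b) (intervalInt_d_add y)
  rw [map_add, map_sub, Algebra.algebraMap_eq_smul_one, map_smul] at h2
  rw [← h2]
  abel

lemma eq_d_pathInt (B : CDGA k) {z : (path B).carrier} (hd : (path B).d z = 0)
    (h0 : (pathEval B 0).toAlgHom z = 0) : (path B).d (B.pathInt z) = z := by
  have h := B.d_pathInt_add z
  rwa [hd, h0, map_zero, map_zero, add_zero, sub_zero] at h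

lemma isQuasiIso_pathConst (B : CDGA k) : IsQuasiIso B.pathConst := by
  rw [isQuasiIso_iff]
  constructor
  · intro n a ha hd z hz
    refine ⟨(pathEval B 0).toAlgHom z, ?_⟩
    rw [← (pathEval B 0).map_d, ← hz, pathEval_const]
  · intro n z hz hd
    refine ⟨(pathEval B 0).toAlgHom z, (pathEval B 0).map_mem hz, ?_, B.pathInt z, ?_⟩
    · rw [← (pathEval B 0).map_d, hd, map_zero]
    · have h := B.d_pathInt_add z
      rw [hd, map_zero, add_zero] at h
      rw [h, add_sub_cancel]

/-- Contraction of paths. -/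
lemma rightHomotopic_pathEval_pathConst (B : CDGA k) :
    RightHomotopic (pathEval B 0 ≫ B.pathConst) (𝟙 (path B)) := by
  have hT : (path B).pathConst.toAlgHom B.pathT * (path B).pathT ∈ (path (path B)).grading 0 :=
    (path (path B)).mul_mem_grading ((path B).pathConst.map_mem B.pathT_mem) (path B).pathT_mem rfl
  let H : path B ⟶ path (path B) :=
    tensorDesc (B.pathConst ≫ (path B).pathConst) ((path (path B)).intervalDesc hT)
  have hc : ∀ b, H.toAlgHom (B.pathConst.toAlgHom b) =
      (path B).pathConst.toAlgHom (B.pathConst.toAlgHom b) := by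
    intro b
    refine (tensorDesc_tmul _ _ b 1).trans ?_
    rw [map_one, mul_one, comp_apply]
  have hT' : H.toAlgHom B.pathT = (path B).pathConst.toAlgHom B.pathT * (path B).pathT := by
    refine (tensorDesc_tmul _ _ 1 _).trans ?_
    rw [map_one, one_mul, intervalDesc_T]
  refine ⟨H, path_ext (fun b => ?_) ?_, path_ext (fun b => ?_) ?_⟩
  · simp [hc]
  · simp [hT']
  · simp [hc]
  · simp [hT']

lemma RightHomotopic.cohomologyMap_eq {A B : CDGA k} {f g : A ⟶ B} (h : RightHomotopic f g)
    (n : ℕ) : cohomologyMap f n = cohomologyMap g n := by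
  obtain ⟨H, rfl, rfl⟩ := h
  have key : ∀ y, cohomologyMap (pathEval B 0) n y = cohomologyMap (pathEval B 1) n y := by
    intro y
    obtain ⟨x, rfl⟩ := (B.isQuasiIso_pathConst n).2 y
    rw [← cohomologyMap_comp, ← cohomologyMap_comp, pathConst_pathEval, pathConst_pathEval]
  refine LinearMap.ext fun x => ?_
  rw [cohomologyMap_comp, cohomologyMap_comp, key]

end CharZero

lemma RightHomotopic.refl {A B : CDGA k} (f : A ⟶ B) : RightHomotopic f f :=
  ⟨f ≫ B.pathConst, by simp, by simp⟩

lemma RightHomotopic.comp_left {A B C : CDGA k} (f : A ⟶ B) {g g' : B ⟶ C}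
    (h : RightHomotopic g g') : RightHomotopic (f ≫ g) (f ≫ g') := by
  obtain ⟨H, rfl, rfl⟩ := h
  exact ⟨f ≫ H, by simp, by simp⟩

lemma RightHomotopic.comp_right {A B C : CDGA k} {f f' : A ⟶ B} (g : B ⟶ C)
    (h : RightHomotopic f f') : RightHomotopic (f ≫ g) (f' ≫ g) := by
  obtain ⟨H, rfl, rfl⟩ := h
  exact ⟨H ≫ pathMap g, by simp [pathMap_pathEval], by simp [pathMap_pathEval]⟩

end CDGA

/-! ### Localisation at the equivalences of a congruence -/

section EquivalenceClass

variable {C : Type u} [Category.{v} C] (r : HomRel C)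

lemma isIso_map_of_equivalenceClass {D : Type*} [Category D] (F : C ⥤ D)
    (hF : ∀ {X Y : C} (f g : X ⟶ Y), r f g → F.map f = F.map g) {X Y : C} (f : X ⟶ Y)
    (hf : equivalenceClass r f) : IsIso (F.map f) := by
  obtain ⟨g, h, h'⟩ := hf
  refine ⟨F.map g, ?_, ?_⟩
  · rw [← F.map_comp, hF _ _ h', F.map_id]
  · rw [← F.map_comp, hF _ _ h, F.map_id]

lemma Q_map_surjective
    (hQ : ∀ {X Y : C} (f g : X ⟶ Y), r f g →
      (equivalenceClass r).Q.map f = (equivalenceClass r).Q.map g) {X Y : C}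
    (φ : (equivalenceClass r).Q.obj X ⟶ (equivalenceClass r).Q.obj Y) :
    ∃ f : X ⟶ Y, (equivalenceClass r).Q.map f = φ := by
  let P : MorphismProperty (equivalenceClass r).Localization := fun X Y φ =>
    ∃ (f : (Localization.Construction.objEquiv _).symm X ⟶
      (Localization.Construction.objEquiv _).symm Y), (equivalenceClass r).Q.map f = φ
  have : P.IsStableUnderComposition := ⟨by
    rintro X Y Z _ _ ⟨f, rfl⟩ ⟨g, rfl⟩
    exact ⟨f ≫ g, Functor.map_comp _ _ _⟩⟩
  have hP : P = ⊤ := by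
    refine Localization.Construction.morphismProperty_eq_top P (fun X Y f => ⟨f, rfl⟩) ?_
    rintro X Y w ⟨g, hg, hg'⟩
    refine ⟨g, ?_⟩
    change (equivalenceClass r).Q.map g =
      (Localization.Construction.wIso (W := equivalenceClass r) w ⟨g, hg, hg'⟩).inv
    have hw : IsIso ((equivalenceClass r).Q.map w) :=
      (equivalenceClass r).Q_inverts w ⟨g, hg, hg'⟩
    rw [← cancel_epi ((equivalenceClass r).Q.map w), ← Functor.map_comp, hQ _ _ hg']
    exact ((equivalenceClass r).Q.map_id X).trans (Localization.Construction.wIso (W := equivalenceClass r) w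
      ⟨g, hg, hg'⟩).hom_inv_id.symm
  have h : P φ := by rw [hP]; trivial
  exact h

variable [Congruence r]

lemma isWeakEquivalenceClass_equivalenceClass :
    IsWeakEquivalenceClass (equivalenceClass r) where
  comp_mem := by
    rintro X Y Z f g ⟨f', hf, hf'⟩ ⟨g', hg, hg'⟩
    refine ⟨g' ≫ f', ?_, ?_⟩
    · have h := HomRel.comp_left g' (HomRel.comp_right g hf)
      rw [Category.id_comp] at h
      simpa using (Congruence.equivalence (r := r)).trans h hg
    · have h := HomRel.comp_left f (HomRel.comp_right f' hg')
      rw [Category.id_comp] at h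
      simpa using (Congruence.equivalence (r := r)).trans h hf'
  of_isIso f _ := ⟨inv f, by
    rw [IsIso.inv_hom_id]; exact (Congruence.equivalence (r := r)).refl _, by
    rw [IsIso.hom_inv_id]; exact (Congruence.equivalence (r := r)).refl _⟩

lemma rel_of_Q_map_eq {X Y : C} (f g : X ⟶ Y)
    (h : (equivalenceClass r).Q.map f = (equivalenceClass r).Q.map g) : r f g := by
  have hF : (equivalenceClass r).IsInvertedBy (Quotient.functor r) := fun _ _ f hf =>
    isIso_map_of_equivalenceClass r (Quotient.functor r) (fun _ _ h => CategoryTheory.Quotient.sound r h) f hf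
  have e := Localization.Construction.fac (Quotient.functor r) hF
  rw [← Quotient.functor_map_eq_iff r]
  have h' : ∀ f : X ⟶ Y, HEq ((Quotient.functor r).map f)
      ((Localization.Construction.lift (Quotient.functor r) hF).map
        ((equivalenceClass r).Q.map f)) := fun f =>
    (CategoryTheory.Functor.hcongr_hom e f).symm
  exact eq_of_heq ((h' f).trans ((heq_of_eq (by rw [h])).trans (h' g).symm))

end EquivalenceClass

namespace Adgc₁

variable {k : Type u} [Field k]

open CDGA

instance : Congruence (homotopic k) where
  comp_left f g g' h := by
    induction h with
    | rel g g' h => exact .rel _ _ (h.comp_left f.hom)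
    | refl g => exact .refl _
    | symm g g' _ ih => exact ih.symm
    | trans g g' g'' _ _ ih ih' => exact ih.trans _ _ _ ih'
  comp_right g h := by
    induction h with
    | rel f f' h => exact .rel _ _ (h.comp_right g.hom)
    | refl f => exact .refl _
    | symm f f' _ ih => exact ih.symm
    | trans f f' f'' _ _ ih ih' => exact ih.trans _ _ _ ih'
  equivalence := Relation.EqvGen.is_equivalence _

lemma isIso_iff_bijective {A B : Adgc₁ k} (f : A ⟶ B) :
    IsIso f ↔ Function.Bijective f.hom.toAlgHom := by
  rw [← ObjectProperty.isIso_hom_iff]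
  exact ⟨fun _ => bijective_of_isIso _, isIso_of_bijective _⟩

variable [CharZero k]

/-- The path object in the category of `1`-connected cdg algebras. -/
noncomputable def path (B : Adgc₁ k) : Adgc₁ k :=
  ⟨B.obj.path, B.obj.isQuasiIso_pathConst.isOneConnected_iff.1 B.property⟩

/-- The inclusion of the constant paths. -/
noncomputable def pathConst (B : Adgc₁ k) : B ⟶ path B := ObjectProperty.homMk B.obj.pathConst

/-- The evaluations of paths. -/
noncomputable def pathEval (B : Adgc₁ k) (c : k) : path B ⟶ B :=
  ObjectProperty.homMk (B.obj.pathEval c)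

lemma pathConst_pathEval (B : Adgc₁ k) (c : k) : pathConst B ≫ pathEval B c = 𝟙 B :=
  ObjectProperty.hom_ext _ (B.obj.pathConst_pathEval c)

lemma strong_pathConst (B : Adgc₁ k) : strong k (pathConst B) :=
  ⟨pathEval B 0, .rel _ _ B.obj.rightHomotopic_pathEval_pathConst, by
    rw [pathConst_pathEval]; exact .refl _⟩

lemma weak_pathConst (B : Adgc₁ k) : weak k (pathConst B) := B.obj.isQuasiIso_pathConst

lemma map_eq_of_homotopic {D : Type*} [Category D] (F : Adgc₁ k ⥤ D)
    (hF : ∀ B, IsIso (F.map (pathConst B))) {A B : Adgc₁ k} {f g : A ⟶ B}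
    (h : homotopic k f g) : F.map f = F.map g := by
  induction h with
  | rel f g h =>
    obtain ⟨H, hf, hg⟩ := h
    have e : F.map (pathEval B 0) = F.map (pathEval B 1) := by
      have := hF B
      rw [← cancel_epi (F.map (pathConst B)), ← F.map_comp, ← F.map_comp, pathConst_pathEval,
        pathConst_pathEval]
    let H' : A ⟶ path B := ObjectProperty.homMk H
    have hf' : f = H' ≫ pathEval B 0 := ObjectProperty.hom_ext _ hf.symm
    have hg' : g = H' ≫ pathEval B 1 := ObjectProperty.hom_ext _ hg.symm
    rw [hf', hg', F.map_comp, F.map_comp, e]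
  | refl f => rfl
  | symm f g _ ih => exact ih.symm
  | trans f g h _ _ ih ih' => exact ih.trans ih'

lemma strong_Q_map_eq_iff {A B : Adgc₁ k} (f g : A ⟶ B) :
    (strong k).Q.map f = (strong k).Q.map g ↔ homotopic k f g :=
  ⟨rel_of_Q_map_eq (homotopic k) f g, fun h => map_eq_of_homotopic _
    (fun B => (strong k).Q_inverts _ (strong_pathConst B)) h⟩

lemma strong_Q_map_surjective {A B : Adgc₁ k} (φ : (strong k).Q.obj A ⟶ (strong k).Q.obj B) :
    ∃ f : A ⟶ B, (strong k).Q.map f = φ :=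
  Q_map_surjective (homotopic k) (fun f g h => (strong_Q_map_eq_iff f g).2 h) φ

lemma isStrongWeak : IsStrongWeak (strong k) (weak k) where
  strong := isWeakEquivalenceClass_equivalenceClass (homotopic k)
  weak :=
    { comp_mem := fun _ _ hf hg => IsQuasiIso.comp hf hg
      of_isIso := fun f hf => by
        have : IsIso f.hom := (ObjectProperty.isIso_hom_iff f).2 hf
        exact isQuasiIso_of_isIso f.hom }
  le_saturation _ _ f hf := isIso_map_of_equivalenceClass (homotopic k) (weak k).Q
    (fun _ _ h => map_eq_of_homotopic _
      (fun B => (weak k).Q_inverts _ (weak_pathConst B)) h) f hf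

lemma weak_of_homotopic {A B : Adgc₁ k} {f g : A ⟶ B} (h : homotopic k f g) (hf : weak k f) :
    weak k g := by
  have : ∀ n, cohomologyMap f.hom n = cohomologyMap g.hom n := by
    clear hf
    intro n
    induction h with
    | rel f g h => exact h.cohomologyMap_eq n
    | refl f => rfl
    | symm f g _ ih => exact ih.symm
    | trans f g h _ _ ih ih' => exact ih.trans ih'
  exact fun n => this n ▸ hf n

end Adgc₁

/-- A family of submodules with projections onto them is a decomposition. -/
@[reducible] noncomputable def decompositionOfProjections {k S : Type*} [Ring k] [AddCommGroup S] [Module k S]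
    (𝒢 : ℕ → Submodule k S) (π : ℕ → S →ₗ[k] S)
    (hsame : ∀ n, ∀ x ∈ 𝒢 n, π n x = x) (hne : ∀ m n, m ≠ n → ∀ x ∈ 𝒢 m, π n x = 0)
    (hsup : ∀ x, x ∈ ⨆ n, 𝒢 n) : DirectSum.Decomposition 𝒢 :=
  DirectSum.IsInternal.chooseDecomposition _
    (DirectSum.isInternal_submodule_of_iSupIndep_of_iSup_eq_top
      (by
        rw [iSupIndep_def]
        intro n
        rw [Submodule.disjoint_def]
        intro x hx hx'
        have h : ⨆ j, ⨆ (_ : j ≠ n), 𝒢 j ≤ LinearMap.ker (π n) :=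
          iSup₂_le fun j hj x hx => hne j n hj x hx
        rw [← hsame n x hx]
        exact h hx')
      (eq_top_iff.2 fun x _ => hsup x))

namespace CDGA
variable {k : Type u} [Field k]

lemma exists_sum_proj (A : CDGA k) (a : A.carrier) :
    ∃ s : Finset ℕ, ∀ t, s ⊆ t → ∑ n ∈ t, A.proj n a = a := by
  classical
  refine ⟨(DirectSum.decompose A.grading a).support, fun t ht => ?_⟩
  conv_rhs => rw [← DirectSum.sum_support_decompose A.grading a]
  refine (Finset.sum_subset ht fun n _ hn => ?_).symm
  have h : DirectSum.decompose A.grading a n = 0 := by simpa using hn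
  exact congrArg Subtype.val h

lemma mem_of_proj_mem (A : CDGA k) (p : Submodule k A.carrier) {a : A.carrier}
    (h : ∀ n, A.proj n a ∈ p) : a ∈ p := by
  obtain ⟨s, hs⟩ := A.exists_sum_proj a
  rw [← hs s subset_rfl]
  exact Submodule.sum_mem _ fun n _ => h n

lemma IsQuasiIso.exists_primitive {A B : CDGA k} {f : A ⟶ B} (hf : IsQuasiIso f) {a : A.carrier}
    (hd : A.d a = 0) {b : B.carrier} (hb : f.toAlgHom a = B.d b) : ∃ c, A.d c = a := by
  refine A.mem_of_proj_mem (LinearMap.range A.d) fun n => ?_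
  have h : ∃ b', f.toAlgHom (A.proj n a) = B.d b' := by
    rw [map_proj, hb]
    rcases n with _ | n
    · exact ⟨0, by rw [proj_zero_d, map_zero]⟩
    · exact ⟨B.proj n b, (B.d_proj n b).symm⟩
  obtain ⟨b', hb'⟩ := h
  obtain ⟨c, hc⟩ := ((isQuasiIso_iff f).1 hf).1 n (A.proj n a) (A.proj_mem n a)
    (by rw [d_proj, hd, map_zero]) b' hb'
  exact ⟨c, hc.symm⟩

lemma IsQuasiIso.exists_cocycle {A B : CDGA k} {f : A ⟶ B} (hf : IsQuasiIso f) {b : B.carrier}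
    (hd : B.d b = 0) : ∃ a, A.d a = 0 ∧ ∃ c, b = f.toAlgHom a + B.d c := by
  have h : b ∈ (LinearMap.ker A.d).map f.toAlgHom.toLinearMap ⊔ LinearMap.range B.d := by
    refine B.mem_of_proj_mem _ fun n => ?_
    obtain ⟨a, -, ha, c, hc⟩ := ((isQuasiIso_iff f).1 hf).2 n (B.proj n b) (B.proj_mem n b)
      (by rw [d_proj, hd, map_zero])
    rw [hc]
    exact Submodule.add_mem_sup ⟨a, ha, rfl⟩ ⟨c, rfl⟩
  obtain ⟨_, ⟨a, ha, rfl⟩, _, ⟨c, rfl⟩, h⟩ := Submodule.mem_sup.1 h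
  exact ⟨a, ha, c, h.symm⟩

/-! ### Pullbacks -/

section Pullback

variable {A B C : CDGA k} (f : A ⟶ C) (g : B ⟶ C)

/-- The underlying algebra of the pullback `A ×_C B`. -/
def pullbackSubalgebra : Subalgebra k (A.carrier × B.carrier) :=
  AlgHom.equalizer (f.toAlgHom.comp (AlgHom.fst k A.carrier B.carrier))
    (g.toAlgHom.comp (AlgHom.snd k A.carrier B.carrier))

/-- The homogeneous elements of degree `n` of the pullback. -/
def pullbackGrading (n : ℕ) : Submodule k (pullbackSubalgebra f g) :=
  ((A.grading n).prod (B.grading n)).comap (pullbackSubalgebra f g).val.toLinearMap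

/-- A pair of compatible linear endomorphisms induces an endomorphism of the pullback. -/
def pullbackEnd (a : A.carrier →ₗ[k] A.carrier) (b : B.carrier →ₗ[k] B.carrier)
    (c : C.carrier →ₗ[k] C.carrier) (ha : ∀ x, f.toAlgHom (a x) = c (f.toAlgHom x))
    (hb : ∀ x, g.toAlgHom (b x) = c (g.toAlgHom x)) :
    pullbackSubalgebra f g →ₗ[k] pullbackSubalgebra f g :=
  (a.prodMap b).restrict (p := (pullbackSubalgebra f g).toSubmodule)
    (q := (pullbackSubalgebra f g).toSubmodule) (fun x hx => by
      have hx : f.toAlgHom x.1 = g.toAlgHom x.2 := hx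
      change f.toAlgHom (a x.1) = g.toAlgHom (b x.2)
      rw [ha, hb, hx])

noncomputable instance : DirectSum.Decomposition (pullbackGrading f g) :=
  decompositionOfProjections (pullbackGrading f g)
    (fun n => pullbackEnd f g (A.proj n) (B.proj n) (C.proj n) (map_proj f n) (map_proj g n))
    (fun n x hx => Subtype.ext (Prod.ext (A.proj_of_mem hx.1) (B.proj_of_mem hx.2)))
    (fun m n hmn x hx =>
      Subtype.ext (Prod.ext (A.proj_of_mem_ne hx.1 hmn) (B.proj_of_mem_ne hx.2 hmn)))
    (fun x => by
      classical
      obtain ⟨s, hs⟩ := A.exists_sum_proj x.1.1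
      obtain ⟨t, ht⟩ := B.exists_sum_proj x.1.2
      have hx : x = ∑ n ∈ s ∪ t, pullbackEnd f g (A.proj n) (B.proj n) (C.proj n) (map_proj f n)
          (map_proj g n) x := by
        refine Subtype.ext (Prod.ext ?_ ?_)
        · rw [AddSubmonoidClass.coe_finsetSum, Prod.fst_sum]
          exact (hs _ Finset.subset_union_left).symm
        · rw [AddSubmonoidClass.coe_finsetSum, Prod.snd_sum]
          exact (ht _ Finset.subset_union_right).symm
      rw [hx]
      exact Submodule.sum_mem _ fun n _ => Submodule.mem_iSup_of_mem n
        ⟨A.proj_mem n _, B.proj_mem n _⟩)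

instance : SetLike.GradedMonoid (pullbackGrading f g) where
  one_mem := ⟨A.one_mem_zero, B.one_mem_zero⟩
  mul_mem _ _ _ _ hx hy := ⟨A.mul_mem_grading hx.1 hy.1 rfl, B.mul_mem_grading hx.2 hy.2 rfl⟩

noncomputable instance : GradedAlgebra (pullbackGrading f g) where

/-- The pullback `A ×_C B`. -/
noncomputable def pullback : CDGA k where
  carrier := pullbackSubalgebra f g
  grading := pullbackGrading f g
  d := pullbackEnd f g A.d B.d C.d f.map_d g.map_d
  d_mem hx := ⟨A.d_mem hx.1, B.d_mem hx.2⟩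
  d_d _ := Subtype.ext (Prod.ext (A.d_d _) (B.d_d _))
  leibniz _ hx := Subtype.ext (Prod.ext (A.leibniz _ hx.1) (B.leibniz _ hx.2))
  comm hx hy := Subtype.ext (Prod.ext (A.comm hx.1 hy.1) (B.comm hx.2 hy.2))

/-- The first projection. -/
noncomputable def pullbackFst : pullback f g ⟶ A where
  toAlgHom := (AlgHom.fst k A.carrier B.carrier).comp (pullbackSubalgebra f g).val
  map_mem hx := hx.1
  map_d _ := rfl

/-- The second projection. -/
noncomputable def pullbackSnd : pullback f g ⟶ B where
  toAlgHom := (AlgHom.snd k A.carrier B.carrier).comp (pullbackSubalgebra f g).val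
  map_mem hx := hx.2
  map_d _ := rfl

/-- The morphism to a pullback with given components. -/
noncomputable def pullbackLift {M : CDGA k} (u : M ⟶ A) (v : M ⟶ B) (h : u ≫ f = v ≫ g) :
    M ⟶ pullback f g where
  toAlgHom := AlgHom.codRestrict (u.toAlgHom.prod v.toAlgHom) (pullbackSubalgebra f g)
    (fun x => AlgHom.congr_fun (congrArg Hom.toAlgHom h) x)
  map_mem hx := ⟨u.map_mem hx, v.map_mem hx⟩
  map_d x := Subtype.ext (Prod.ext (u.map_d x) (v.map_d x))

lemma pullback_condition : pullbackFst f g ≫ f = pullbackSnd f g ≫ g :=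
  hom_ext fun x => x.2

@[simp] lemma pullbackLift_fst {M : CDGA k} (u : M ⟶ A) (v : M ⟶ B) (h : u ≫ f = v ≫ g) :
    pullbackLift f g u v h ≫ pullbackFst f g = u := rfl

@[simp] lemma pullbackLift_snd {M : CDGA k} (u : M ⟶ A) (v : M ⟶ B) (h : u ≫ f = v ≫ g) :
    pullbackLift f g u v h ≫ pullbackSnd f g = v := rfl

lemma exists_pullback {a : A.carrier} {b : B.carrier} (h : f.toAlgHom a = g.toAlgHom b) :
    ∃ x : (pullback f g).carrier, (pullbackFst f g).toAlgHom x = a ∧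
      (pullbackSnd f g).toAlgHom x = b :=
  ⟨(⟨(a, b), h⟩ : pullbackSubalgebra f g), rfl, rfl⟩

lemma pullback_elem_ext {x y : (pullback f g).carrier}
    (h : (pullbackFst f g).toAlgHom x = (pullbackFst f g).toAlgHom y)
    (h' : (pullbackSnd f g).toAlgHom x = (pullbackSnd f g).toAlgHom y) : x = y :=
  Subtype.ext (Prod.ext h h')

end Pullback

/-! ### The mapping path factorisation -/

/-- Surjective morphisms with acyclic kernel. -/
structure IsAcyclicFibration {A B : CDGA k} (p : A ⟶ B) : Prop where
  surjective : Function.Surjective p.toAlgHom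
  acyclic : ∀ a, A.d a = 0 → p.toAlgHom a = 0 → ∃ c, A.d c = a ∧ p.toAlgHom c = 0

variable [CharZero k]

lemma isAcyclicFibration_mappingPath {Y X : CDGA k} (w : Y ⟶ X) (hw : IsQuasiIso w) :
    IsAcyclicFibration (pullbackSnd w (pathEval X 0) ≫ pathEval X 1) where
  surjective x := by
    obtain ⟨z, -, hz⟩ := exists_pullback w (pathEval X 0) (a := 0)
      (b := X.pathConst.toAlgHom x * X.pathT) (by simp)
    exact ⟨z, by simp [hz]⟩
  acyclic z hd hz := by
    have hcond := AlgHom.congr_fun (congrArg Hom.toAlgHom (pullback_condition w (pathEval X 0))) z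
    simp only [comp_apply] at hcond hz
    have hdy := (pullbackFst w (pathEval X 0)).map_d z
    have hdH := (pullbackSnd w (pathEval X 0)).map_d z
    rw [hd, map_zero] at hdy hdH
    set y := (pullbackFst w (pathEval X 0)).toAlgHom z with hy
    set H := (pullbackSnd w (pathEval X 0)).toAlgHom z with hH
    have hc0 : (path X).d (X.pathConst.toAlgHom (w.toAlgHom y)) = 0 := by
      rw [← X.pathConst.map_d, ← w.map_d, ← hdy, map_zero, map_zero]
    obtain ⟨G, hG, hG0⟩ : ∃ G, (path X).d G = H - X.pathConst.toAlgHom (w.toAlgHom y) ∧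
        (pathEval X 0).toAlgHom G = 0 :=
      ⟨X.pathInt (H - X.pathConst.toAlgHom (w.toAlgHom y)), X.eq_d_pathInt
        (by rw [map_sub, ← hdH, hc0, sub_zero]) (by simp [hcond]), X.pathEval_zero_int _⟩
    have he : X.d ((pathEval X 1).toAlgHom G) = - w.toAlgHom y := by
      rw [← (pathEval X 1).map_d, hG, map_sub, hz, pathEval_const, zero_sub]
    obtain ⟨y₁, hy₁⟩ := hw.exists_primitive hdy.symm (b := -(pathEval X 1).toAlgHom G)
      (by rw [map_neg, he, neg_neg])
    obtain ⟨z', hz', x, hx⟩ := hw.exists_cocycle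
      (b := w.toAlgHom y₁ + (pathEval X 1).toAlgHom G)
      (by rw [map_add, ← w.map_d, hy₁, he, add_neg_cancel])
    obtain ⟨c, hc, hc'⟩ := exists_pullback w (pathEval X 0) (a := y₁ - z')
      (b := G + X.pathConst.toAlgHom (w.toAlgHom (y₁ - z')) -
        (path X).d (X.pathConst.toAlgHom x * X.pathT)) (by
          simp [hG0, (pathEval X 0).map_d])
    refine ⟨c, pullback_elem_ext _ _ ?_ ?_, ?_⟩
    · rw [Hom.map_d, hc, map_sub, hy₁, hz', sub_zero]
    · rw [Hom.map_d, hc', map_sub, map_add, (path X).d_d, hG, ← X.pathConst.map_d, ← w.map_d,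
        map_sub Y.d, hy₁, hz', sub_zero, sub_zero, sub_add_cancel]
    · rw [comp_apply, hc']
      simp only [map_sub, map_add, (pathEval X 1).map_d, map_mul, pathEval_const, pathEval_T,
        map_one, mul_one]
      rw [← sub_eq_iff_eq_add'] at hx
      rw [← hx]
      abel

/-- The lifting condition for homotopies along an acyclic fibration. -/
lemma IsAcyclicFibration.exists_path {Y X : CDGA k} {p : Y ⟶ X} (hp : IsAcyclicFibration p)
    {H : (path X).carrier} {y₀ y₁ : Y.carrier}
    (h₀ : (pathEval X 0).toAlgHom H = p.toAlgHom y₀)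
    (h₁ : (pathEval X 1).toAlgHom H = p.toAlgHom y₁) {z : (path Y).carrier}
    (hd : (path Y).d z = 0) (hH : (pathMap p).toAlgHom z = (path X).d H)
    (hz₀ : (pathEval Y 0).toAlgHom z = Y.d y₀) (hz₁ : (pathEval Y 1).toAlgHom z = Y.d y₁) :
    ∃ K, (path Y).d K = z ∧ (pathMap p).toAlgHom K = H ∧ (pathEval Y 0).toAlgHom K = y₀ ∧
      (pathEval Y 1).toAlgHom K = y₁ := by
  obtain ⟨K, hK, hK₀, hK₁⟩ : ∃ K, (pathMap p).toAlgHom K = H ∧ (pathEval Y 0).toAlgHom K = y₀ ∧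
      (pathEval Y 1).toAlgHom K = y₁ := by
    obtain ⟨K, hK⟩ := pathMap_surjective p hp.surjective H
    have hK₀ := pathEval_pathMap_apply p 0 K
    have hK₁ := pathEval_pathMap_apply p 1 K
    rw [hK, h₀] at hK₀
    rw [hK, h₁] at hK₁
    refine ⟨K + Y.pathConst.toAlgHom (y₀ - (pathEval Y 0).toAlgHom K) * (1 - Y.pathT) +
      Y.pathConst.toAlgHom (y₁ - (pathEval Y 1).toAlgHom K) * Y.pathT, ?_, ?_, ?_⟩
    · simp [hK, hK₀, hK₁]
    · simp
    · simp
  have hζ₀ : (pathEval Y 0).toAlgHom (z - (path Y).d K) = 0 := by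
    rw [map_sub, Hom.map_d, hK₀, hz₀, sub_self]
  have hζ : (path Y).d (Y.pathInt (z - (path Y).d K)) = z - (path Y).d K :=
    Y.eq_d_pathInt (by rw [map_sub, hd, (path Y).d_d, sub_zero]) hζ₀
  set κ := Y.pathInt (z - (path Y).d K) with hκ
  have hκ' : (pathMap p).toAlgHom κ = 0 := by
    rw [hκ, pathMap_int, map_sub, Hom.map_d, hK, hH, sub_self, map_zero]
  obtain ⟨c, hc, hc'⟩ := hp.acyclic ((pathEval Y 1).toAlgHom κ)
    (by rw [← Hom.map_d, hζ, map_sub, Hom.map_d, hK₁, hz₁, sub_self])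
    (by rw [← pathEval_pathMap_apply, hκ', map_zero])
  refine ⟨K + κ - (path Y).d (Y.pathConst.toAlgHom c * Y.pathT), ?_, ?_, ?_, ?_⟩
  · rw [map_sub, map_add, (path Y).d_d, hζ, sub_zero, add_sub_cancel]
  · rw [map_sub, map_add, Hom.map_d, hK, hκ']
    simp [hc']
  · rw [map_sub, map_add, Hom.map_d, hK₀, hκ, pathEval_zero_int]
    simp
  · rw [map_sub, map_add, Hom.map_d, hK₁]
    simp [hc]

end CDGA

/-- An operator on sequences whose value at `n` only depends on the terms before `n` has a fixed
point. -/
lemma exists_fixedPoint_of_causal {X : ℕ → Type*} [∀ i, Nonempty (X i)]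
    (Ψ : (∀ i, X i) → ∀ i, X i)
    (hΨ : ∀ n g g', (∀ i < n, g i = g' i) → Ψ g n = Ψ g' n) : ∃ g, Ψ g = g := by
  let g₀ : ∀ i, X i := fun i => Classical.arbitrary _
  have key : ∀ n i, i < n → Ψ^[n] g₀ i = Ψ^[n + 1] g₀ i := by
    intro n
    induction n with
    | zero => intro i hi; omega
    | succ n ih =>
      intro i hi
      rw [Function.iterate_succ_apply', Function.iterate_succ_apply' Ψ (n + 1)]
      exact hΨ i _ _ fun j hj => ih j (by omega)
  have key' : ∀ n m i, i < n → Ψ^[n] g₀ i = Ψ^[n + m] g₀ i := by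
    intro n m i hi
    induction m with
    | zero => rfl
    | succ m ih => rw [ih, key (n + m) i (by omega)]; rfl
  refine ⟨fun i => Ψ^[i + 1] g₀ i, funext fun i => ?_⟩
  rw [Function.iterate_succ_apply']
  refine hΨ i _ _ fun j hj => ?_
  have h := key' (j + 1) (i - (j + 1)) j (by omega)
  rwa [show j + 1 + (i - (j + 1)) = i by omega] at h

/-- Over a field, every linear map has a pseudo-inverse. -/
lemma LinearMap.exists_pseudoInverse {k P Q : Type*} [Field k] [AddCommGroup P] [Module k P]
    [AddCommGroup Q] [Module k Q] (T : P →ₗ[k] Q) : ∃ s : Q →ₗ[k] P, ∀ x, T (s (T x)) = T x := by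
  obtain ⟨r, hr⟩ := T.rangeRestrict.exists_rightInverse_of_surjective T.range_rangeRestrict
  obtain ⟨s, hs⟩ := LinearMap.exists_extend r
  refine ⟨s, fun x => ?_⟩
  have h1 : s (T x) = r (T.rangeRestrict x) := LinearMap.congr_fun hs (T.rangeRestrict x)
  have h2 : T.rangeRestrict (r (T.rangeRestrict x)) = T.rangeRestrict x :=
    LinearMap.congr_fun hr _
  rw [h1]
  exact congrArg Subtype.val h2

/-! ### Free graded commutative algebras -/

namespace CDGA

section Free

variable (k : Type u) [Field k] (V : ℕ → Type u) [∀ i, AddCommGroup (V i)] [∀ i, Module k (V i)]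

/-- The inclusion of the generators of degree `i`. -/
noncomputable def freeι (i : ℕ) : V i →ₗ[k] FreeGradedCommutative k V :=
  (RingQuot.mkAlgHom k (FreeRel k V)).toLinearMap ∘ₗ TensorAlgebra.ι k ∘ₗ DirectSum.lof k ℕ V i

lemma freeι_mul (i j : ℕ) (v : V i) (w : V j) : freeι k V i v * freeι k V j w =
    (-1 : k) ^ (i * j) • (freeι k V j w * freeι k V i v) := by
  have h := RingQuot.mkAlgHom_rel k (FreeRel.swap (k := k) i j v w)
  rwa [map_smul, map_mul, map_mul] at h

variable {k V} {B : Type*} [Semiring B] [Algebra k B]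

/-- The universal property of the free graded commutative algebra. -/
noncomputable def freeDesc (g : ∀ i, V i →ₗ[k] B)
    (hg : ∀ i j v w, g i v * g j w = (-1 : k) ^ (i * j) • (g j w * g i v)) :
    FreeGradedCommutative k V →ₐ[k] B :=
  RingQuot.liftAlgHom k ⟨TensorAlgebra.lift k (DirectSum.toModule k ℕ B g), by
    rintro _ _ ⟨i, j, v, w⟩
    simp only [map_mul, map_smul, TensorAlgebra.lift_ι_apply, DirectSum.toModule_lof]
    exact hg i j v w⟩

@[simp] lemma freeDesc_ι (g : ∀ i, V i →ₗ[k] B)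
    (hg : ∀ i j v w, g i v * g j w = (-1 : k) ^ (i * j) • (g j w * g i v)) (i : ℕ) (v : V i) :
    freeDesc g hg (freeι k V i v) = g i v := by
  simp [freeDesc, freeι]

lemma free_algHom_ext {f g : FreeGradedCommutative k V →ₐ[k] B}
    (h : ∀ i v, f (freeι k V i v) = g (freeι k V i v)) : f = g := by
  refine RingQuot.ringQuot_ext' k _ _ (TensorAlgebra.hom_ext (DirectSum.linearMap_ext k ?_))
  exact fun i => LinearMap.ext fun v => h i v

lemma free_adjoin_eq_top :
    Algebra.adjoin k {x : FreeGradedCommutative k V | ∃ i v, x = freeι k V i v} = ⊤ := by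
  set S := Algebra.adjoin k {x : FreeGradedCommutative k V | ∃ i v, x = freeι k V i v}
  have hι : ∀ i v, freeι k V i v ∈ S := fun i v => Algebra.subset_adjoin ⟨i, v, rfl⟩
  let ι' : ∀ i, V i →ₗ[k] S := fun i => (freeι k V i).codRestrict (Subalgebra.toSubmodule S) (hι i)
  let g : FreeGradedCommutative k V →ₐ[k] S := freeDesc ι'
    (fun i j v w => Subtype.ext (freeι_mul k V i j v w))
  have h : S.val.comp g = AlgHom.id k _ := free_algHom_ext fun i v => by
    rw [AlgHom.comp_apply, freeDesc_ι]
    rfl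
  rw [eq_top_iff]
  intro x _
  have hx := AlgHom.congr_fun h x
  rw [AlgHom.comp_apply, AlgHom.id_apply] at hx
  rw [← hx]
  exact (g x).2

end Free

variable {k : Type u} [Field k]

lemma proj_mul (A : CDGA k) (n : ℕ) (a b : A.carrier) :
    A.proj n (a * b) = ∑ ij ∈ Finset.HasAntidiagonal.antidiagonal n, A.proj ij.1 a * A.proj ij.2 b := by
  induction a using A.induction_homogeneous with
  | h0 => simp
  | hadd a a' h h' => simp only [add_mul, map_add, h, h', Finset.sum_add_distrib]
  | h i a ha =>
    induction b using A.induction_homogeneous with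
    | h0 => simp
    | hadd b b' h h' => simp only [mul_add, map_add, h, h', Finset.sum_add_distrib]
    | h j b hb =>
      by_cases hn : i + j = n
      · rw [A.proj_of_mem (A.mul_mem_grading ha hb hn), Finset.sum_eq_single (i, j)]
        · rw [A.proj_of_mem ha, A.proj_of_mem hb]
        · rintro ⟨i', j'⟩ h hne
          by_cases hi : i = i'
          · subst hi
            rw [A.proj_of_mem_ne hb (n := j') (by rintro rfl; exact hne rfl), mul_zero]
          · rw [A.proj_of_mem_ne ha hi, zero_mul]
        · intro h
          exact absurd (Finset.HasAntidiagonal.mem_antidiagonal.2 hn) h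
      · rw [A.proj_of_mem_ne (A.mul_mem_grading ha hb rfl) hn, Finset.sum_eq_zero]
        rintro ⟨i', j'⟩ h
        rw [Finset.HasAntidiagonal.mem_antidiagonal] at h
        by_cases hi : i = i'
        · subst hi
          rw [A.proj_of_mem_ne hb (n := j') (by rintro rfl; exact hn h), mul_zero]
        · rw [A.proj_of_mem_ne ha hi, zero_mul]

/-- An algebra morphism which preserves the degrees of generators preserves degrees. -/
lemma map_mem_of_generators {A B : CDGA k} (f : A.carrier →ₐ[k] B.carrier) {S : Set A.carrier}
    (hS : Algebra.adjoin k S = ⊤)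
    (h : ∀ x ∈ S, ∃ i, x ∈ A.grading i ∧ f x ∈ B.grading i) (i : ℕ) (a : A.carrier)
    (ha : a ∈ A.grading i) : f a ∈ B.grading i := by
  have key : ∀ a ∈ Algebra.adjoin k S, ∀ n, f (A.proj n a) = B.proj n (f a) := by
    intro a ha
    have homog : ∀ a i, a ∈ A.grading i → f a ∈ B.grading i →
        ∀ n, f (A.proj n a) = B.proj n (f a) := by
      intro a i ha hb n
      by_cases hn : i = n
      · subst hn; rw [A.proj_of_mem ha, B.proj_of_mem hb]
      · rw [A.proj_of_mem_ne ha hn, B.proj_of_mem_ne hb hn, map_zero]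
    induction ha using Algebra.adjoin_induction with
    | mem x hx =>
      obtain ⟨i, hi, hi'⟩ := h x hx
      exact homog x i hi hi'
    | algebraMap c =>
      refine homog _ 0 (A.algebraMap_mem_zero c) ?_
      rw [AlgHom.commutes]
      exact B.algebraMap_mem_zero c
    | add x y _ _ hx hy => intro n; simp only [map_add, hx, hy]
    | mul x y _ _ hx hy => intro n; simp only [proj_mul, map_mul, map_sum, hx, hy]
  have := key a (by rw [hS]; trivial) i
  rw [A.proj_of_mem ha] at this
  rw [this]
  exact B.proj_mem _ _

/-- An algebra morphism commutes with the differentials on a subalgebra if it does so on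
generators. -/
lemma map_d_of_generators {A B : CDGA k} (f : A.carrier →ₐ[k] B.carrier)
    (hf : ∀ i, ∀ a ∈ A.grading i, f a ∈ B.grading i) {S : Set A.carrier}
    (h : ∀ x ∈ S, f (A.d x) = B.d (f x)) {a : A.carrier} (ha : a ∈ Algebra.adjoin k S) :
    f (A.d a) = B.d (f a) := by
  induction ha using Algebra.adjoin_induction with
  | mem x hx => exact h x hx
  | algebraMap c => rw [d_algebraMap, AlgHom.commutes, d_algebraMap, map_zero]
  | add x y _ _ hx hy => simp only [map_add, hx, hy]
  | mul x y _ _ hx hy => simp only [d_mul, map_add, map_mul, hx, hy, map_sign f hf]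

/-- The elements of `V` of degree less than `n`. -/
def lowGenerators (A : CDGA k) (V : ℕ → Submodule k A.carrier) (n : ℕ) : Set A.carrier :=
  {x | ∃ i < n, x ∈ V i}

lemma lowGenerators_mono (A : CDGA k) (V : ℕ → Submodule k A.carrier) {m n : ℕ} (h : m ≤ n) :
    A.lowGenerators V m ⊆ A.lowGenerators V n := by
  rintro x ⟨i, hi, hx⟩
  exact ⟨i, hi.trans_le h, hx⟩

/-- `A` is freely generated by `V`. -/
structure FreelyGenerated (A : CDGA k) (V : ℕ → Submodule k A.carrier) : Prop where
  le : ∀ i, V i ≤ A.grading i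
  bijective : Function.Bijective (A.freeMap V le)

namespace FreelyGenerated

variable {A : CDGA k} {V : ℕ → Submodule k A.carrier} (hA : A.FreelyGenerated V)
include hA

lemma freeMap_ι (i : ℕ) (v : V i) : A.freeMap V hA.le (freeι k (fun i => V i) i v) = v := by
  simp [freeMap, freeι]

lemma adjoin_eq_top : Algebra.adjoin k {x | ∃ i, x ∈ V i} = ⊤ := by
  have h := congrArg (Subalgebra.map (A.freeMap V hA.le))
    (free_adjoin_eq_top (k := k) (V := fun i => V i))
  rw [AlgHom.map_adjoin, Algebra.map_top, (AlgHom.range_eq_top _).2 hA.bijective.2] at h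
  rw [← h]
  congr 1
  ext x
  constructor
  · rintro ⟨i, hx⟩
    exact ⟨_, ⟨i, ⟨x, hx⟩, rfl⟩, hA.freeMap_ι i ⟨x, hx⟩⟩
  · rintro ⟨_, ⟨i, v, rfl⟩, rfl⟩
    refine ⟨i, ?_⟩
    rw [hA.freeMap_ι]
    exact v.2

lemma exists_algHom {B : Type*} [Ring B] [Algebra k B] (g : ∀ i, V i →ₗ[k] B)
    (hg : ∀ i j v w, g i v * g j w = (-1 : k) ^ (i * j) • (g j w * g i v)) :
    ∃ G : A.carrier →ₐ[k] B, ∀ i (v : V i), G v = g i v := by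
  let e := AlgEquiv.ofBijective _ hA.bijective
  refine ⟨(freeDesc g hg).comp e.symm.toAlgHom, fun i v => ?_⟩
  have h : e.symm (v : A.carrier) = freeι k (fun i => V i) i v := by
    rw [AlgEquiv.symm_apply_eq]
    exact (hA.freeMap_ι i v).symm
  change freeDesc g hg (e.symm v) = _
  rw [h, freeDesc_ι]

lemma proj_mem_adjoin (a : A.carrier) (n : ℕ) :
    A.proj n a ∈ Algebra.adjoin k (A.lowGenerators V (n + 1)) := by
  have mono : ∀ {m n}, m ≤ n → Algebra.adjoin k (A.lowGenerators V m) ≤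
      Algebra.adjoin k (A.lowGenerators V n) := fun h =>
    Algebra.adjoin_mono (A.lowGenerators_mono V h)
  have ha : a ∈ Algebra.adjoin k {x | ∃ i, x ∈ V i} := by rw [hA.adjoin_eq_top]; trivial
  induction ha using Algebra.adjoin_induction generalizing n with
  | mem x hx =>
    obtain ⟨i, hi⟩ := hx
    by_cases h : i = n
    · subst h
      rw [A.proj_of_mem (hA.le i hi)]
      exact Algebra.subset_adjoin ⟨i, by omega, hi⟩
    · rw [A.proj_of_mem_ne (hA.le i hi) h]
      exact Subalgebra.zero_mem _
  | algebraMap c =>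
    rcases n with _ | n
    · rw [A.proj_of_mem (A.algebraMap_mem_zero c)]
      exact Subalgebra.algebraMap_mem _ c
    · rw [A.proj_of_mem_ne (A.algebraMap_mem_zero c) (by omega)]
      exact Subalgebra.zero_mem _
  | add x y _ _ hx hy => rw [map_add]; exact Subalgebra.add_mem _ (hx n) (hy n)
  | mul x y _ _ hx hy =>
    rw [proj_mul]
    refine Subalgebra.sum_mem _ fun ij hij => ?_
    rw [Finset.HasAntidiagonal.mem_antidiagonal] at hij
    exact Subalgebra.mul_mem _ (mono (by omega) (hx ij.1)) (mono (by omega) (hy ij.2))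

lemma mem_adjoin {n : ℕ} {a : A.carrier} (ha : a ∈ A.grading n) :
    a ∈ Algebra.adjoin k (A.lowGenerators V (n + 1)) := by
  rw [← A.proj_of_mem ha]
  exact hA.proj_mem_adjoin a n

end FreelyGenerated

lemma mem_plus (A : CDGA k) {n : ℕ} {a : A.carrier} (ha : a ∈ A.grading (n + 1)) : a ∈ A.plus :=
  Submodule.mem_iSup_of_mem (p := fun i => A.grading (i + 1)) n ha

lemma IsSullivanMinimal.exists_freelyGenerated {M : CDGA k} (hM : M.IsSullivanMinimal) :
    ∃ V, M.FreelyGenerated V := by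
  obtain ⟨V, hV, h⟩ := hM.free
  exact ⟨V, hV, h⟩

/-- In a `1`-connected Sullivan minimal algebra, the differential of an element of degree `n` is
a polynomial in elements of degree less than `n`. -/
lemma IsSullivanMinimal.d_mem_adjoin {M : CDGA k} (hM : M.IsSullivanMinimal) {n : ℕ}
    {a : M.carrier} (ha : a ∈ M.grading n) :
    M.d a ∈ Algebra.adjoin k {x : M.carrier | ∃ i < n, x ∈ M.grading i} := by
  rcases n with _ | n
  · have h := M.d_mem ha
    rw [zero_add, hM.grading_one, Submodule.mem_bot] at h
    rw [h]
    exact Subalgebra.zero_mem _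
  · set S := Algebra.adjoin k {x : M.carrier | ∃ i < n + 1, x ∈ M.grading i}
    have h : M.plus * M.plus ≤ S.toSubmodule.comap (M.proj (n + 2)) := by
      rw [plus, Submodule.iSup_mul]
      refine iSup_le fun i => ?_
      rw [Submodule.mul_iSup]
      refine iSup_le fun j => ?_
      rw [Submodule.mul_le]
      intro x hx y hy
      change M.proj (n + 2) (x * y) ∈ S
      by_cases hij : i + 1 + (j + 1) = n + 2
      · rw [M.proj_of_mem (M.mul_mem_grading hx hy hij)]
        rcases i with _ | i
        · rw [zero_add, hM.grading_one, Submodule.mem_bot] at hx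
          rw [hx, zero_mul]
          exact Subalgebra.zero_mem _
        rcases j with _ | j
        · rw [zero_add, hM.grading_one, Submodule.mem_bot] at hy
          rw [hy, mul_zero]
          exact Subalgebra.zero_mem _
        exact Subalgebra.mul_mem _ (Algebra.subset_adjoin ⟨_, by omega, hx⟩)
          (Algebra.subset_adjoin ⟨_, by omega, hy⟩)
      · rw [M.proj_of_mem_ne (M.mul_mem_grading hx hy rfl) hij]
        exact Subalgebra.zero_mem _
    have h' := h (hM.d_plus ⟨a, M.mem_plus ha, rfl⟩)
    change M.proj (n + 2) (M.d a) ∈ S at h'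
    rwa [M.proj_of_mem (M.d_mem ha)] at h'

lemma IsSullivanMinimal.d_mem_adjoin_lowGenerators {M : CDGA k} (hM : M.IsSullivanMinimal)
    {V : ℕ → Submodule k M.carrier} (hV : M.FreelyGenerated V) {n : ℕ} {a : M.carrier}
    (ha : a ∈ M.grading n) : M.d a ∈ Algebra.adjoin k (M.lowGenerators V n) := by
  refine Algebra.adjoin_le ?_ (hM.d_mem_adjoin ha)
  rintro x ⟨i, hi, hx⟩
  exact Algebra.adjoin_mono (M.lowGenerators_mono V hi) (hV.mem_adjoin hx)

/-- The lifting property of `1`-connected Sullivan minimal algebras. -/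
theorem IsSullivanMinimal.exists_lift {M E : CDGA k} (hM : M.IsSullivanMinimal)
    {N : Type*} [Ring N] [Algebra k N] (dN : N →ₗ[k] N) (p : E.carrier →ₐ[k] N)
    (f : M.carrier →ₐ[k] N) (hf : ∀ x, f (M.d x) = dN (f x))
    (H : ∀ n, ∀ v ∈ M.grading n, ∀ z ∈ E.grading (n + 1), E.d z = 0 → p z = dN (f v) →
      ∃ y ∈ E.grading n, p y = f v ∧ E.d y = z) :
    ∃ g : M ⟶ E, ∀ x, p (g.toAlgHom x) = f x := by
  obtain ⟨V, hV⟩ := hM.exists_freelyGenerated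
  let T : ∀ n, E.grading n →ₗ[k] N × E.carrier := fun n =>
    (p.toLinearMap.prod E.d) ∘ₗ (E.grading n).subtype
  choose s hs using fun n => (T n).exists_pseudoInverse
  have hL : ∀ g : ∀ i, V i →ₗ[k] E.grading i,
      ∃ G : M.carrier →ₐ[k] E.carrier, ∀ i (v : V i), G v = g i v := fun g =>
    hV.exists_algHom (fun i => (E.grading i).subtype ∘ₗ g i)
      fun i j v w => E.comm (g i v).2 (g j w).2
  choose L hL using hL
  let Ψ : (∀ i, V i →ₗ[k] E.grading i) → ∀ i, V i →ₗ[k] E.grading i := fun g i =>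
    s i ∘ₗ (f.toLinearMap.prod ((L g).toLinearMap ∘ₗ M.d)) ∘ₗ (V i).subtype
  obtain ⟨g, hg⟩ := exists_fixedPoint_of_causal Ψ (by
    intro n g g' h
    refine LinearMap.ext fun v => congrArg (s n) (Prod.ext rfl ?_)
    change L g (M.d v) = L g' (M.d v)
    have hv := hM.d_mem_adjoin_lowGenerators hV (hV.le n v.2)
    have hle : Algebra.adjoin k (M.lowGenerators V n) ≤ AlgHom.equalizer (L g) (L g') := by
      refine Algebra.adjoin_le ?_
      rintro x ⟨i, hi, hx⟩
      change L g x = L g' x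
      rw [hL g i ⟨x, hx⟩, hL g' i ⟨x, hx⟩, h i hi]
    exact hle hv)
  have hmem : ∀ i, ∀ a ∈ M.grading i, L g a ∈ E.grading i := by
    refine map_mem_of_generators (L g) hV.adjoin_eq_top ?_
    rintro x ⟨i, hx⟩
    refine ⟨i, hV.le i hx, ?_⟩
    rw [hL g i ⟨x, hx⟩]
    exact (g i ⟨x, hx⟩).2
  have key : ∀ n, ∀ v ∈ V n, p (L g v) = f v ∧ L g (M.d v) = E.d (L g v) := by
    intro n
    induction n using Nat.strong_induction_on with
    | _ n ih =>
      intro v hv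
      have hdv := hM.d_mem_adjoin_lowGenerators hV (hV.le n hv)
      have h1 : p (L g (M.d v)) = f (M.d v) := by
        have hle : Algebra.adjoin k (M.lowGenerators V n) ≤ AlgHom.equalizer (p.comp (L g)) f :=
          Algebra.adjoin_le fun x ⟨i, hi, hx⟩ => (ih i hi x hx).1
        exact hle hdv
      have h2 : L g (M.d (M.d v)) = E.d (L g (M.d v)) :=
        map_d_of_generators (L g) hmem (S := M.lowGenerators V n)
          (fun x ⟨i, hi, hx⟩ => (ih i hi x hx).2) hdv
      obtain ⟨y, hy, hpy, hdy⟩ := H n v (hV.le n hv) (L g (M.d v))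
        (hmem _ _ (M.d_mem (hV.le n hv))) (by rw [← h2, M.d_d, map_zero]) (by rw [h1, hf])
      have h3 := hs n ⟨y, hy⟩
      have h4 : T n ⟨y, hy⟩ = (f v, L g (M.d v)) := Prod.ext hpy hdy
      have h5 : L g v = s n (f v, L g (M.d v)) := by
        rw [hL g n ⟨v, hv⟩]
        conv_lhs => rw [← hg]
        rfl
      rw [h4] at h3
      rw [h5]
      exact ⟨congrArg Prod.fst h3, (congrArg Prod.snd h3).symm⟩
  have htop : ∀ x : M.carrier, x ∈ Algebra.adjoin k {x | ∃ i, x ∈ V i} := fun x => by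
    rw [hV.adjoin_eq_top]; trivial
  refine ⟨⟨L g, fun {i a} ha => hmem i a ha, fun a => map_d_of_generators (L g) hmem
    (S := {x | ∃ i, x ∈ V i}) (fun x ⟨i, hx⟩ => (key i x hx).2) (htop a)⟩, fun x => ?_⟩
  have hle : Algebra.adjoin k {x | ∃ i, x ∈ V i} ≤ AlgHom.equalizer (p.comp (L g)) f :=
    Algebra.adjoin_le fun x ⟨i, hx⟩ => (key i x hx).1
  exact hle (htop x)

end CDGA

namespace CDGA
variable {k : Type u} [Field k]

lemma IsSullivanMinimal.exists_lift_of_isAcyclicFibration {M E B : CDGA k}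
    (hM : M.IsSullivanMinimal) {p : E ⟶ B} (hp : IsAcyclicFibration p) (f : M ⟶ B) :
    ∃ g : M ⟶ E, g ≫ p = f := by
  obtain ⟨g, hg⟩ := hM.exists_lift B.d p.toAlgHom f.toAlgHom f.map_d (by
    intro n v hv z hz hd hpz
    obtain ⟨y₀, hy₀⟩ := hp.surjective (f.toAlgHom v)
    obtain ⟨c, hc, hc'⟩ := hp.acyclic (z - E.d y₀) (by rw [map_sub, hd, E.d_d, sub_zero])
      (by rw [map_sub, hpz, p.map_d, hy₀, sub_self])
    refine ⟨E.proj n (y₀ + c), E.proj_mem _ _, ?_, ?_⟩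
    · rw [map_proj, map_add, hy₀, hc', add_zero, B.proj_of_mem (f.map_mem hv)]
    · rw [d_proj, map_add, hc, add_sub_cancel, E.proj_of_mem hz])
  exact ⟨g, hom_ext hg⟩

lemma eqvGen_comp_right {A B C : CDGA k} {f f' : A ⟶ B} (g : B ⟶ C)
    (h : Relation.EqvGen RightHomotopic f f') :
    Relation.EqvGen RightHomotopic (f ≫ g) (f' ≫ g) := by
  induction h with
  | rel f f' h => exact .rel _ _ (h.comp_right g)
  | refl f => exact .refl _
  | symm f f' _ ih => exact ih.symm
  | trans f f' f'' _ _ ih ih' => exact ih.trans _ _ _ ih'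

variable [CharZero k]

lemma IsSullivanMinimal.rightHomotopic_of_isAcyclicFibration {M Y X : CDGA k}
    (hM : M.IsSullivanMinimal) {p : Y ⟶ X} (hp : IsAcyclicFibration p) (g₀ g₁ : M ⟶ Y)
    (h : RightHomotopic (g₀ ≫ p) (g₁ ≫ p)) : RightHomotopic g₀ g₁ := by
  obtain ⟨H, h₀, h₁⟩ := h
  have h₀' : ∀ x, (pathEval X 0).toAlgHom (H.toAlgHom x) = p.toAlgHom (g₀.toAlgHom x) :=
    fun x => AlgHom.congr_fun (congrArg Hom.toAlgHom h₀) x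
  have h₁' : ∀ x, (pathEval X 1).toAlgHom (H.toAlgHom x) = p.toAlgHom (g₁.toAlgHom x) :=
    fun x => AlgHom.congr_fun (congrArg Hom.toAlgHom h₁) x
  obtain ⟨K, hK⟩ := hM.exists_lift (E := path Y)
    ((path X).d.prodMap (Y.d.prodMap Y.d))
    ((pathMap p).toAlgHom.prod ((pathEval Y 0).toAlgHom.prod (pathEval Y 1).toAlgHom))
    (H.toAlgHom.prod (g₀.toAlgHom.prod g₁.toAlgHom))
    (fun x => Prod.ext (H.map_d x) (Prod.ext (g₀.map_d x) (g₁.map_d x))) (by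
      intro n v hv z hz hd hpz
      obtain ⟨K, hdK, hK, hK₀, hK₁⟩ := hp.exists_path (h₀' v) (h₁' v) hd (congrArg Prod.fst hpz)
        (congrArg (fun q => q.2.1) hpz) (congrArg (fun q => q.2.2) hpz)
      refine ⟨(path Y).proj n K, (path Y).proj_mem _ _, Prod.ext ?_ (Prod.ext ?_ ?_), ?_⟩
      · change (pathMap p).toAlgHom _ = H.toAlgHom v
        rw [map_proj, hK, (path X).proj_of_mem (H.map_mem hv)]
      · change (pathEval Y 0).toAlgHom _ = g₀.toAlgHom v
        rw [map_proj, hK₀, Y.proj_of_mem (g₀.map_mem hv)]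
      · change (pathEval Y 1).toAlgHom _ = g₁.toAlgHom v
        rw [map_proj, hK₁, Y.proj_of_mem (g₁.map_mem hv)]
      · rw [d_proj, hdK, (path Y).proj_of_mem hz])
  exact ⟨K, hom_ext fun x => congrArg (fun q => q.2.1) (hK x),
    hom_ext fun x => congrArg (fun q => q.2.2) (hK x)⟩

lemma IsSullivanMinimal.eqvGen_of_isAcyclicFibration {M Y X : CDGA k}
    (hM : M.IsSullivanMinimal) {p : Y ⟶ X} (hp : IsAcyclicFibration p) {f f' : M ⟶ X}
    (h : Relation.EqvGen RightHomotopic f f') :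
    ∀ g g' : M ⟶ Y, g ≫ p = f → g' ≫ p = f' → Relation.EqvGen RightHomotopic g g' := by
  induction h with
  | rel f f' h =>
    rintro g g' rfl rfl
    exact .rel _ _ (hM.rightHomotopic_of_isAcyclicFibration hp g g' h)
  | refl f =>
    intro g g' hg hg'
    refine .rel _ _ (hM.rightHomotopic_of_isAcyclicFibration hp g g' ?_)
    rw [hg, hg']
    exact .refl f
  | symm f f' _ ih => exact fun g g' hg hg' => (ih g' g hg' hg).symm
  | trans f f' f'' _ _ ih ih' =>
    intro g g'' hg hg''
    obtain ⟨g', hg'⟩ := hM.exists_lift_of_isAcyclicFibration hp f'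
    exact (ih g g' hg hg').trans _ _ _ (ih' g' g'' hg' hg'')

lemma IsSullivanMinimal.exists_homotopy_lift {M Y X : CDGA k} (hM : M.IsSullivanMinimal)
    {w : Y ⟶ X} (hw : IsQuasiIso w) (f : M ⟶ X) : ∃ g : M ⟶ Y, RightHomotopic (g ≫ w) f := by
  obtain ⟨g, hg⟩ := hM.exists_lift_of_isAcyclicFibration (isAcyclicFibration_mappingPath w hw) f
  exact ⟨g ≫ pullbackFst w (pathEval X 0), g ≫ pullbackSnd w (pathEval X 0), by
    rw [Category.assoc, Category.assoc, pullback_condition], by rw [Category.assoc, hg]⟩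

lemma IsSullivanMinimal.eqvGen_of_comp {M Y X : CDGA k} (hM : M.IsSullivanMinimal)
    {w : Y ⟶ X} (hw : IsQuasiIso w) {g g' : M ⟶ Y}
    (h : Relation.EqvGen RightHomotopic (g ≫ w) (g' ≫ w)) :
    Relation.EqvGen RightHomotopic g g' := by
  let j : Y ⟶ pullback w (pathEval X 0) := pullbackLift w (pathEval X 0) (𝟙 Y) (w ≫ X.pathConst)
    (by rw [Category.assoc, pathConst_pathEval, Category.id_comp, Category.comp_id])
  have hj : j ≫ pullbackSnd w (pathEval X 0) ≫ pathEval X 1 = w := by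
    rw [← Category.assoc, pullbackLift_snd, Category.assoc, pathConst_pathEval, Category.comp_id]
  have h' := hM.eqvGen_of_isAcyclicFibration (isAcyclicFibration_mappingPath w hw) h (g ≫ j)
    (g' ≫ j) (by rw [Category.assoc, hj]) (by rw [Category.assoc, hj])
  have h'' := eqvGen_comp_right (pullbackFst w (pathEval X 0)) h'
  rwa [Category.assoc, Category.assoc, pullbackLift_fst, Category.comp_id, Category.comp_id]
    at h''

end CDGA

namespace Adgc₁
variable {k : Type u} [Field k]
open CDGA

lemma homotopic_iff {A B : Adgc₁ k} (f g : A ⟶ B) :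
    homotopic k f g ↔ Relation.EqvGen RightHomotopic f.hom g.hom := by
  constructor
  · intro h
    induction h with
    | rel f g h => exact .rel _ _ h
    | refl f => exact .refl _
    | symm f g _ ih => exact ih.symm
    | trans f g h _ _ ih ih' => exact ih.trans _ _ _ ih'
  · intro h
    have key : ∀ f g : A.obj ⟶ B.obj, Relation.EqvGen RightHomotopic f g →
        homotopic k (ObjectProperty.homMk f : A ⟶ B) (ObjectProperty.homMk g) := by
      intro f g h
      induction h with
      | rel f g h => exact .rel _ _ h
      | refl f => exact .refl _
      | symm f g _ ih => exact ih.symm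
      | trans f g h _ _ ih ih' => exact ih.trans _ _ _ ih'
    exact key _ _ h

variable [CharZero k]

theorem isCofibrantObject_of_isSullivanMinimal {M : Adgc₁ k} (hM : M.obj.IsSullivanMinimal) :
    IsCofibrantObject (strong k) (weak k) M := by
  intro Y X w hw
  constructor
  · intro φ φ' h
    obtain ⟨g, rfl⟩ := strong_Q_map_surjective φ
    obtain ⟨g', rfl⟩ := strong_Q_map_surjective φ'
    simp only [← Functor.map_comp, strong_Q_map_eq_iff, homotopic_iff] at h ⊢
    exact hM.eqvGen_of_comp hw h
  · intro φ
    obtain ⟨f, rfl⟩ := strong_Q_map_surjective φ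
    obtain ⟨g, hg⟩ := hM.exists_homotopy_lift hw f.hom
    refine ⟨(strong k).Q.map (ObjectProperty.homMk g), ?_⟩
    simp only [← Functor.map_comp, strong_Q_map_eq_iff]
    exact .rel _ _ hg

end Adgc₁

namespace CDGA
variable {k : Type u} [Field k]

lemma sign_mem_adjoin (A : CDGA k) {S : Set A.carrier}
    (h : ∀ x ∈ S, A.sign x ∈ Algebra.adjoin k S) {a : A.carrier} (ha : a ∈ Algebra.adjoin k S) :
    A.sign a ∈ Algebra.adjoin k S := by
  induction ha using Algebra.adjoin_induction with
  | mem x hx => exact h x hx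
  | algebraMap c =>
    rw [sign_apply A (A.algebraMap_mem_zero c), pow_zero, one_smul]
    exact Subalgebra.algebraMap_mem _ c
  | add x y _ _ hx hy => rw [map_add]; exact Subalgebra.add_mem _ hx hy
  | mul x y _ _ hx hy => rw [sign_mul]; exact Subalgebra.mul_mem _ hx hy

lemma d_mem_adjoin_of_generators (A : CDGA k) {S : Set A.carrier}
    (h : ∀ x ∈ S, A.sign x ∈ Algebra.adjoin k S) (h' : ∀ x ∈ S, A.d x ∈ Algebra.adjoin k S)
    {a : A.carrier} (ha : a ∈ Algebra.adjoin k S) : A.d a ∈ Algebra.adjoin k S := by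
  induction ha using Algebra.adjoin_induction with
  | mem x hx => exact h' x hx
  | algebraMap c => rw [d_algebraMap]; exact Subalgebra.zero_mem _
  | add x y _ _ hx hy => rw [map_add]; exact Subalgebra.add_mem _ hx hy
  | mul x y hx' hy' hx hy =>
    rw [d_mul]
    exact Subalgebra.add_mem _ (Subalgebra.mul_mem _ hx hy')
      (Subalgebra.mul_mem _ (A.sign_mem_adjoin h hx') hy)

/-- A quasi-isomorphism between `1`-connected Sullivan minimal algebras is bijective. -/
theorem IsSullivanMinimal.bijective_of_isQuasiIso {M M' : CDGA k} (hM : M.IsSullivanMinimal)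
    (hM' : M'.IsSullivanMinimal) {w : M ⟶ M'} (hw : IsQuasiIso w) :
    Function.Bijective w.toAlgHom := by
  obtain ⟨V, hV⟩ := hM'.exists_freelyGenerated
  rw [isQuasiIso_iff] at hw
  let T : ∀ n, M.grading n →ₗ[k] M'.carrier := fun n => w.toAlgHom.toLinearMap ∘ₗ
    (M.grading n).subtype
  choose s hs using fun n => (T n).exists_pseudoInverse
  obtain ⟨θ, hθ⟩ := hV.exists_algHom (fun i => (M.grading i).subtype ∘ₗ s i ∘ₗ (V i).subtype)
    (fun i j v w => M.comm (s i v).2 (s j w).2)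
  have hθmem : ∀ i, ∀ a ∈ M'.grading i, θ a ∈ M.grading i := by
    refine map_mem_of_generators θ hV.adjoin_eq_top ?_
    rintro x ⟨i, hx⟩
    refine ⟨i, hV.le i hx, ?_⟩
    rw [hθ i ⟨x, hx⟩]
    exact (s i x).2
  have key : ∀ n, (∀ x ∈ M.grading n, w.toAlgHom x = 0 → x = 0) ∧
      ∀ z ∈ M'.grading n, ∃ x ∈ M.grading n, w.toAlgHom x = z := by
    intro n
    induction n using Nat.strong_induction_on with
    | _ n ih =>
      have hθw : ∀ a ∈ Algebra.adjoin k (M'.lowGenerators V n), w.toAlgHom (θ a) = a := by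
        have hle : Algebra.adjoin k (M'.lowGenerators V n) ≤
            AlgHom.equalizer (w.toAlgHom.comp θ) (AlgHom.id k _) := by
          refine Algebra.adjoin_le ?_
          rintro x ⟨i, hi, hx⟩
          change w.toAlgHom (θ x) = x
          rw [hθ i ⟨x, hx⟩]
          obtain ⟨y, hy, rfl⟩ := (ih i hi).2 x (hV.le i hx)
          exact hs i ⟨y, hy⟩
        exact hle
      have hwθ : ∀ a ∈ Algebra.adjoin k {x : M.carrier | ∃ i < n, x ∈ M.grading i},
          θ (w.toAlgHom a) = a := by
        have hle : Algebra.adjoin k {x : M.carrier | ∃ i < n, x ∈ M.grading i} ≤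
            AlgHom.equalizer (θ.comp w.toAlgHom) (AlgHom.id k _) := by
          refine Algebra.adjoin_le ?_
          rintro x ⟨i, hi, hx⟩
          change θ (w.toAlgHom x) = x
          have hwx := w.map_mem hx
          rw [← sub_eq_zero]
          refine (ih i hi).1 _ (Submodule.sub_mem _ (hθmem i _ hwx) hx) ?_
          rw [map_sub, hθw _ (Algebra.adjoin_mono (M'.lowGenerators_mono V hi)
            (hV.mem_adjoin hwx)), sub_self]
        exact hle
      have hexact : ∀ m ≤ n, ∀ u, M'.d u ∈ M'.grading m →
          ∃ u', M.d u' ∈ M.grading m ∧ w.toAlgHom (M.d u') = M'.d u := by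
        rintro (_ | m) hm u hu
        · refine ⟨0, ?_, ?_⟩
          · rw [map_zero]; exact Submodule.zero_mem _
          · rw [map_zero, map_zero, M'.eq_zero_of_exact_of_mem_zero hu rfl]
        · obtain ⟨u₁, hu₁, hu₁'⟩ := M'.exists_homogeneous_primitive hu rfl
          obtain ⟨u', hu', rfl⟩ := (ih m hm).2 u₁ hu₁
          exact ⟨u', M.d_mem hu', by rw [w.map_d, ← hu₁']⟩
      constructor
      · intro x hx hwx
        have hdx : M.d x = 0 := by
          rw [← hwθ _ (hM.d_mem_adjoin hx), w.map_d, hwx, map_zero, map_zero]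
        obtain ⟨y, hy⟩ := hw.1 n x hx hdx 0 (by rw [hwx, map_zero])
        rcases n with _ | n
        · exact M.eq_zero_of_exact_of_mem_zero hx hy
        obtain ⟨y, hy', rfl⟩ := M.exists_homogeneous_primitive hx hy
        obtain ⟨c, hc, hdc, u, hu⟩ := hw.2 n (w.toAlgHom y) (w.map_mem hy')
          (by rw [← w.map_d, hwx])
        rw [← sub_eq_iff_eq_add'] at hu
        obtain ⟨u', hu', hwu'⟩ := hexact n (by omega) u (by
          rw [← hu]
          exact Submodule.sub_mem _ (w.map_mem hy') (w.map_mem hc))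
        have h := (ih n (by omega)).1 (y - c - M.d u')
          (Submodule.sub_mem _ (Submodule.sub_mem _ hy' hc) hu')
          (by rw [map_sub, map_sub, hwu', hu, sub_self])
        rw [sub_sub, sub_eq_zero] at h
        rw [h, map_add, hdc, M.d_d, add_zero]
      · intro z hz
        have hdz := hM'.d_mem_adjoin hz
        have hdz' := hM'.d_mem_adjoin_lowGenerators hV hz
        have hm : M.d (θ (M'.d z)) = 0 := by
          have hS : θ (M'.d z) ∈ Algebra.adjoin k {x : M.carrier | ∃ i < n, x ∈ M.grading i} := by
            have hle : Algebra.adjoin k {x : M'.carrier | ∃ i < n, x ∈ M'.grading i} ≤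
                (Algebra.adjoin k {x : M.carrier | ∃ i < n, x ∈ M.grading i}).comap θ :=
              Algebra.adjoin_le fun x ⟨i, hi, hx⟩ =>
                Algebra.subset_adjoin ⟨i, hi, hθmem i x hx⟩
            exact hle hdz
          have hdS := M.d_mem_adjoin_of_generators
            (S := {x : M.carrier | ∃ i < n, x ∈ M.grading i})
            (fun x ⟨i, hi, hx⟩ => Algebra.subset_adjoin ⟨i, hi, M.sign_mem hx⟩)
            (fun x ⟨i, hi, hx⟩ => Algebra.adjoin_mono
              (s := {y : M.carrier | ∃ j < i, y ∈ M.grading j})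
              (t := {y : M.carrier | ∃ j < n, y ∈ M.grading j})
              (fun y ⟨j, hj, hy⟩ => ⟨j, hj.trans hi, hy⟩) (hM.d_mem_adjoin hx)) hS
          rw [← hwθ _ hdS, w.map_d, hθw _ hdz', M'.d_d, map_zero]
        obtain ⟨x, hx⟩ := hw.1 (n + 1) (θ (M'.d z)) (hθmem _ _ (M'.d_mem hz)) hm z (hθw _ hdz')
        obtain ⟨x, hx', hx⟩ := M.exists_homogeneous_primitive (hθmem _ _ (M'.d_mem hz)) hx
        obtain ⟨c, hc, hdc, u, hu⟩ := hw.2 n (z - w.toAlgHom x)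
          (Submodule.sub_mem _ hz (w.map_mem hx'))
          (by rw [map_sub, ← w.map_d, ← hx, hθw _ hdz', sub_self])
        rw [← sub_eq_iff_eq_add'] at hu
        obtain ⟨u', hu', hwu'⟩ := hexact n le_rfl u (by
          rw [← hu]
          exact Submodule.sub_mem _ (Submodule.sub_mem _ hz (w.map_mem hx')) (w.map_mem hc))
        refine ⟨x + c + M.d u', Submodule.add_mem _ (Submodule.add_mem _ hx' hc) hu', ?_⟩
        rw [map_add, map_add, hwu', ← hu]
        abel
  constructor
  · rw [injective_iff_map_eq_zero]
    intro a ha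
    refine M.ext_proj fun n => ?_
    rw [map_zero]
    exact (key n).1 _ (M.proj_mem _ _) (by rw [map_proj, ha, map_zero])
  · intro b
    have hb : b ∈ LinearMap.range w.toAlgHom.toLinearMap := M'.mem_of_proj_mem _ fun n => by
      obtain ⟨x, -, hx⟩ := (key n).2 _ (M'.proj_mem n b)
      exact ⟨x, hx⟩
    exact hb

end CDGA

namespace CDGA

/-! ### The grading of the free graded commutative algebra -/

section FreeGrading

variable (k : Type u) [Field k] (V : ℕ → Type u) [∀ i, AddCommGroup (V i)] [∀ i, Module k (V i)]

/-- Induction on the elements of a free graded commutative algebra. -/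
lemma free_induction {p : FreeGradedCommutative k V → Prop}
    (algebraMap : ∀ c : k, p (algebraMap k _ c)) (ι : ∀ i v, p (freeι k V i v))
    (add : ∀ x y, p x → p y → p (x + y)) (mul : ∀ x y, p x → p y → p (x * y))
    (x : FreeGradedCommutative k V) : p x := by
  have hx : x ∈ Algebra.adjoin k {x : FreeGradedCommutative k V | ∃ i v, x = freeι k V i v} := by
    rw [free_adjoin_eq_top]; trivial
  induction hx using Algebra.adjoin_induction with
  | mem x hx => obtain ⟨i, v, rfl⟩ := hx; exact ι i v
  | algebraMap c => exact algebraMap c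
  | add x y _ _ hx hy => exact add x y hx hy
  | mul x y _ _ hx hy => exact mul x y hx hy

open Polynomial in
/-- The algebra morphism `x ↦ x Tⁿ` for `x` of degree `n`. -/
noncomputable def freeWeight :
    FreeGradedCommutative k V →ₐ[k] Polynomial (FreeGradedCommutative k V) :=
  freeDesc (fun i => ((monomial i).restrictScalars k) ∘ₗ freeι k V i) (by
    intro i j v w
    simp only [LinearMap.comp_apply, LinearMap.restrictScalars_apply, monomial_mul_monomial,
      smul_monomial]
    rw [freeι_mul, add_comm])

open Polynomial in
@[simp] lemma freeWeight_ι (i : ℕ) (v : V i) :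
    freeWeight k V (freeι k V i v) = monomial i (freeι k V i v) := by
  simp [freeWeight]

open Polynomial in
/-- The homogeneous elements of degree `n`. -/
noncomputable def freeGrading (n : ℕ) : Submodule k (FreeGradedCommutative k V) :=
  LinearMap.eqLocus (freeWeight k V).toLinearMap ((monomial n).restrictScalars k)

open Polynomial in
lemma mem_freeGrading {n : ℕ} {x : FreeGradedCommutative k V} :
    x ∈ freeGrading k V n ↔ freeWeight k V x = monomial n x := Iff.rfl

lemma freeι_mem (i : ℕ) (v : V i) : freeι k V i v ∈ freeGrading k V i :=
  freeWeight_ι k V i v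

instance : SetLike.GradedMonoid (freeGrading k V) where
  one_mem := by rw [mem_freeGrading, map_one]; rfl
  mul_mem i j x y hx hy := by
    rw [mem_freeGrading] at hx hy ⊢
    rw [map_mul, hx, hy, Polynomial.monomial_mul_monomial]

/-- The homogeneous component of degree `n`. -/
noncomputable def freeComponent (n : ℕ) :
    FreeGradedCommutative k V →ₗ[k] FreeGradedCommutative k V :=
  ((Polynomial.lcoeff _ n).restrictScalars k) ∘ₗ (freeWeight k V).toLinearMap

lemma freeComponent_apply (n : ℕ) (x : FreeGradedCommutative k V) :
    freeComponent k V n x = (freeWeight k V x).coeff n := rfl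

lemma freeComponent_of_mem {m n : ℕ} {x : FreeGradedCommutative k V}
    (hx : x ∈ freeGrading k V m) : freeComponent k V n x = if m = n then x else 0 := by
  rw [freeComponent_apply, (mem_freeGrading k V).1 hx, Polynomial.coeff_monomial]

lemma free_mem_iSup (Q : ℕ → Submodule k (FreeGradedCommutative k V)) (one : 1 ∈ Q 0)
    (ι : ∀ i v, freeι k V i v ∈ Q i) (mul : ∀ i j, ∀ x ∈ Q i, ∀ y ∈ Q j, x * y ∈ Q (i + j))
    (x : FreeGradedCommutative k V) : x ∈ ⨆ n, Q n := by
  induction x using free_induction with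
  | algebraMap c =>
    rw [Algebra.algebraMap_eq_smul_one]
    exact Submodule.smul_mem _ _ (Submodule.mem_iSup_of_mem 0 one)
  | ι i v => exact Submodule.mem_iSup_of_mem i (ι i v)
  | add x y hx hy => exact Submodule.add_mem _ hx hy
  | mul x y hx hy =>
    have h : (⨆ n, Q n) * (⨆ n, Q n) ≤ ⨆ n, Q n := by
      rw [Submodule.iSup_mul]
      refine iSup_le fun i => ?_
      rw [Submodule.mul_iSup]
      refine iSup_le fun j => ?_
      rw [Submodule.mul_le]
      exact fun a ha b hb => Submodule.mem_iSup_of_mem (i + j) (mul i j a ha b hb)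
    exact h (Submodule.mul_mem_mul hx hy)

noncomputable instance : DirectSum.Decomposition (freeGrading k V) :=
  decompositionOfProjections (freeGrading k V) (freeComponent k V)
    (fun n x hx => by rw [freeComponent_of_mem k V hx, if_pos rfl])
    (fun m n h x hx => by rw [freeComponent_of_mem k V hx, if_neg h])
    (free_mem_iSup k V _ (SetLike.GradedOne.one_mem (A := freeGrading k V)) (freeι_mem k V)
      fun _ _ _ hx _ hy => SetLike.GradedMul.mul_mem hx hy)

noncomputable instance : GradedAlgebra (freeGrading k V) where

lemma freeComponent_mul_comm {m : ℕ} {c : FreeGradedCommutative k V}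
    (hc : ∀ i v, freeι k V i v * c = (-1 : k) ^ (i * m) • (c * freeι k V i v))
    (a : FreeGradedCommutative k V) (n : ℕ) :
    freeComponent k V n a * c = (-1 : k) ^ (n * m) • (c * freeComponent k V n a) := by
  induction a using free_induction generalizing n with
  | algebraMap r =>
    rw [freeComponent_apply, AlgHom.commutes, Polynomial.algebraMap_apply, Polynomial.coeff_C]
    split_ifs with h
    · subst h
      rw [zero_mul, pow_zero, one_smul, Algebra.commutes]
    · rw [zero_mul, mul_zero, smul_zero]
  | ι i v =>
    rw [freeComponent_of_mem k V (freeι_mem k V i v)]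
    split_ifs with h
    · subst h; exact hc i v
    · rw [zero_mul, mul_zero, smul_zero]
  | add x y hx hy => rw [map_add, add_mul, mul_add, hx, hy, smul_add]
  | mul x y hx hy =>
    have h : freeComponent k V n (x * y) = ∑ ij ∈ Finset.HasAntidiagonal.antidiagonal n,
        freeComponent k V ij.1 x * freeComponent k V ij.2 y := by
      simp only [freeComponent_apply, map_mul, Polynomial.coeff_mul]
    rw [h, Finset.sum_mul, Finset.mul_sum, Finset.smul_sum]
    refine Finset.sum_congr rfl fun ij hij => ?_
    rw [Finset.HasAntidiagonal.mem_antidiagonal] at hij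
    rw [mul_assoc, hy, mul_smul_comm, ← mul_assoc, hx, smul_mul_assoc, smul_smul, ← pow_add,
      ← hij, mul_assoc, add_mul, add_comm]

lemma freeGrading_comm {i j : ℕ} {a b : FreeGradedCommutative k V} (ha : a ∈ freeGrading k V i)
    (hb : b ∈ freeGrading k V j) : a * b = (-1 : k) ^ (i * j) • (b * a) := by
  have h : ∀ l v, freeι k V l v * b = (-1 : k) ^ (l * j) • (b * freeι k V l v) := by
    intro l v
    have := freeComponent_mul_comm k V (m := l) (c := freeι k V l v)
      (fun i w => freeι_mul k V i l w v) b j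
    rw [freeComponent_of_mem k V hb, if_pos rfl] at this
    rw [this, smul_smul, mul_comm j l, ← mul_pow]
    simp
  have := freeComponent_mul_comm k V h a i
  rwa [freeComponent_of_mem k V ha, if_pos rfl] at this

/-- The free graded commutative algebra with zero differential. -/
noncomputable abbrev free : CDGA k where
  carrier := FreeGradedCommutative k V
  grading := freeGrading k V
  d := 0
  d_mem _ := Submodule.zero_mem _
  d_d _ := rfl
  leibniz _ _ := by simp
  comm := freeGrading_comm k V

variable {k V}

/-- A graded algebra morphism out of a free graded commutative algebra. -/
lemma freeDesc_mem {B : CDGA k} (g : ∀ i, V i →ₗ[k] B.carrier)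
    (hg : ∀ i j v w, g i v * g j w = (-1 : k) ^ (i * j) • (g j w * g i v))
    (hmem : ∀ i v, g i v ∈ B.grading i) (n : ℕ) (x : FreeGradedCommutative k V)
    (hx : x ∈ freeGrading k V n) : freeDesc g hg x ∈ B.grading n := by
  have h : ∀ i v, freeDesc g hg (freeι k V i v) ∈ B.grading i := fun i v => by
    rw [freeDesc_ι]
    exact hmem i v
  refine map_mem_of_generators (A := free k V) (freeDesc g hg) free_adjoin_eq_top ?_ n x hx
  rintro _ ⟨i, v, rfl⟩
  exact ⟨i, freeι_mem k V i v, h i v⟩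

variable (k V) in
/-- The degree involution. -/
noncomputable def freeSign : FreeGradedCommutative k V →ₐ[k] FreeGradedCommutative k V :=
  freeDesc (fun i => (-1 : k) ^ i • freeι k V i) (fun i j v w => by
    simp only [LinearMap.smul_apply, smul_mul_smul_comm, freeι_mul k V i j v w]
    rw [smul_comm, mul_comm ((-1 : k) ^ j)])

lemma freeSign_ι (i : ℕ) (v : V i) :
    freeSign k V (freeι k V i v) = (-1 : k) ^ i • freeι k V i v := by
  rw [freeSign, freeDesc_ι]
  rfl

/-- A property of the homogeneous elements which holds for the products of generators. -/
lemma free_homogeneous_induction (Q : ℕ → Submodule k (FreeGradedCommutative k V)) (one : 1 ∈ Q 0)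
    (ι : ∀ i v, freeι k V i v ∈ Q i)
    (mul : ∀ i j, ∀ x ∈ freeGrading k V i, ∀ y ∈ freeGrading k V j, x ∈ Q i → y ∈ Q j →
      x * y ∈ Q (i + j)) {n : ℕ} {x : FreeGradedCommutative k V} (hx : x ∈ freeGrading k V n) :
    x ∈ Q n := by
  have h := free_mem_iSup k V (fun n => freeGrading k V n ⊓ Q n)
    ⟨SetLike.GradedOne.one_mem (A := freeGrading k V), one⟩
    (fun i v => ⟨freeι_mem k V i v, ι i v⟩)
    (fun i j x hx y hy => ⟨SetLike.GradedMul.mul_mem hx.1 hy.1, mul i j x hx.1 y hy.1 hx.2 hy.2⟩) x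
  have hle : ⨆ n, (freeGrading k V n ⊓ Q n) ≤ (Q n).comap (freeComponent k V n) := by
    refine iSup_le fun i y hy => ?_
    rw [Submodule.mem_comap, freeComponent_of_mem k V hy.1]
    split_ifs with hi
    · exact hi ▸ hy.2
    · exact Submodule.zero_mem _
  have h' := hle h
  rwa [Submodule.mem_comap, freeComponent_of_mem k V hx, if_pos rfl] at h'

lemma freeSign_of_mem {n : ℕ} {x : FreeGradedCommutative k V} (hx : x ∈ freeGrading k V n) :
    freeSign k V x = (-1 : k) ^ n • x := by
  refine free_homogeneous_induction
    (fun n => LinearMap.eqLocus (freeSign k V).toLinearMap ((-1 : k) ^ n • LinearMap.id))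
    ?_ freeSign_ι ?_ hx
  · rw [LinearMap.mem_eqLocus]
    simp
  · intro i j x _ y _ hx hy
    rw [LinearMap.mem_eqLocus] at hx hy ⊢
    simp only [AlgHom.toLinearMap_apply, LinearMap.smul_apply, LinearMap.id_apply, map_mul]
      at hx hy ⊢
    rw [hx, hy, smul_mul_smul_comm, pow_add]

/-! ### Derivations of free graded commutative algebras -/

variable (δ : ∀ i, V i →ₗ[k] FreeGradedCommutative k V)

/-- The matrix `[(-1)^i v, δ v; 0, v]`. -/
noncomputable def derivationMatrix (i : ℕ) :
    V i →ₗ[k] Matrix (Fin 2) (Fin 2) (FreeGradedCommutative k V) where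
  toFun v := !![(-1 : k) ^ i • freeι k V i v, δ i v; 0, freeι k V i v]
  map_add' v w := by
    ext a b
    fin_cases a <;> fin_cases b <;> simp
  map_smul' c v := by
    ext a b
    fin_cases a <;> fin_cases b <;> simp [smul_comm c]

lemma derivationMatrix_apply (i : ℕ) (v : V i) : derivationMatrix δ i v =
    !![(-1 : k) ^ i • freeι k V i v, δ i v; 0, freeι k V i v] := rfl

variable (hδ : ∀ i v, δ i v ∈ freeGrading k V (i + 1))
include hδ

lemma derivationMatrix_comm (i j : ℕ) (v : V i) (w : V j) :
    derivationMatrix δ i v * derivationMatrix δ j w =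
      (-1 : k) ^ (i * j) • (derivationMatrix δ j w * derivationMatrix δ i v) := by
  have h1 := freeGrading_comm k V (freeι_mem k V i v) (hδ j w)
  have h2 := freeGrading_comm k V (hδ i v) (freeι_mem k V j w)
  have h3 := freeι_mul k V i j v w
  rw [derivationMatrix_apply, derivationMatrix_apply, Matrix.mul_fin_two, Matrix.mul_fin_two]
  ext a b
  fin_cases a <;> fin_cases b
  · simp [h3, smul_smul]
    ring_nf
  · simp only [Fin.zero_eta, Fin.mk_one, Matrix.of_apply, Matrix.cons_val_zero,
      Matrix.cons_val_one, Matrix.smul_apply, smul_mul_assoc, h1, h2, smul_add, smul_smul,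
      ← pow_add]
    rw [add_comm]
    congr 2
    · congr 1
      ring
    · rw [show i + i * (j + 1) = i * j + 2 * i by ring, pow_add, pow_mul _ 2]
      simp
  · simp
  · simp [h3]

/-- The derivation matrices assemble to an algebra morphism. -/
noncomputable def derivationAlgHom :
    FreeGradedCommutative k V →ₐ[k] Matrix (Fin 2) (Fin 2) (FreeGradedCommutative k V) :=
  freeDesc (derivationMatrix δ) (derivationMatrix_comm δ hδ)

/-- The derivation of degree `1` extending a map on generators. -/
noncomputable def freeDerivation : FreeGradedCommutative k V →ₗ[k] FreeGradedCommutative k V where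
  toFun x := derivationAlgHom δ hδ x 0 1
  map_add' x y := by rw [map_add, Matrix.add_apply]
  map_smul' c x := by rw [map_smul, Matrix.smul_apply, RingHom.id_apply]

lemma freeDerivation_ι (i : ℕ) (v : V i) : freeDerivation δ hδ (freeι k V i v) = δ i v := by
  change derivationAlgHom δ hδ (freeι k V i v) 0 1 = _
  rw [derivationAlgHom, freeDesc_ι, derivationMatrix_apply]
  rfl

lemma derivationAlgHom_apply (x : FreeGradedCommutative k V) :
    derivationAlgHom δ hδ x = !![freeSign k V x, freeDerivation δ hδ x; 0, x] := by
  have h : derivationAlgHom δ hδ x 0 0 = freeSign k V x ∧ derivationAlgHom δ hδ x 1 0 = 0 ∧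
      derivationAlgHom δ hδ x 1 1 = x := by
    induction x using free_induction with
    | algebraMap c =>
      rw [AlgHom.commutes, AlgHom.commutes, Matrix.algebraMap_eq_diagonal]
      simp
    | ι i v =>
      rw [freeSign_ι, derivationAlgHom, freeDesc_ι, derivationMatrix_apply]
      exact ⟨rfl, rfl, rfl⟩
    | add x y hx hy =>
      rw [map_add, map_add]
      simp only [Matrix.add_apply, hx, hy, add_zero, and_self]
    | mul x y hx hy =>
      rw [map_mul, map_mul]
      simp only [Matrix.mul_apply, Fin.sum_univ_two, hx, hy]
      simp
  rw [Matrix.eta_fin_two (derivationAlgHom δ hδ x), h.1, h.2.1, h.2.2]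
  rfl

lemma freeDerivation_mul (x y : FreeGradedCommutative k V) :
    freeDerivation δ hδ (x * y) =
      freeDerivation δ hδ x * y + freeSign k V x * freeDerivation δ hδ y := by
  have h : derivationAlgHom δ hδ (x * y) 0 1 =
      (derivationAlgHom δ hδ x * derivationAlgHom δ hδ y) 0 1 := by rw [map_mul]
  rw [derivationAlgHom_apply δ hδ x, derivationAlgHom_apply δ hδ y, Matrix.mul_fin_two] at h
  refine h.trans ?_
  simp [add_comm]

lemma freeDerivation_algebraMap (c : k) :
    freeDerivation δ hδ (algebraMap k (FreeGradedCommutative k V) c) = 0 := by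
  change derivationAlgHom δ hδ (algebraMap k (FreeGradedCommutative k V) c) 0 1 = 0
  rw [AlgHom.commutes, Matrix.algebraMap_eq_diagonal]
  simp

lemma freeDerivation_mem {n : ℕ} {x : FreeGradedCommutative k V} (hx : x ∈ freeGrading k V n) :
    freeDerivation δ hδ x ∈ freeGrading k V (n + 1) := by
  refine free_homogeneous_induction
    (fun n => (freeGrading k V (n + 1)).comap (freeDerivation δ hδ)) ?_ ?_ ?_ hx
  · have h := freeDerivation_algebraMap δ hδ 1
    rw [map_one] at h
    rw [Submodule.mem_comap, h]
    exact Submodule.zero_mem _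
  · intro i v
    rw [Submodule.mem_comap, freeDerivation_ι]
    exact hδ i v
  · intro i j x hx' y hy' hx hy
    rw [Submodule.mem_comap, freeDerivation_mul, freeSign_of_mem hx', smul_mul_assoc]
    refine Submodule.add_mem _ ?_ (Submodule.smul_mem _ _ ?_)
    · have := SetLike.GradedMul.mul_mem (A := freeGrading k V) hx hy'
      rwa [show i + 1 + j = i + j + 1 by ring] at this
    · have := SetLike.GradedMul.mul_mem (A := freeGrading k V) hx' hy
      rwa [← add_assoc] at this

lemma freeDerivation_sign (x : FreeGradedCommutative k V) :
    freeDerivation δ hδ (freeSign k V x) = (-1 : k) • freeSign k V (freeDerivation δ hδ x) := by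
  induction x using free_induction with
  | algebraMap c =>
    rw [AlgHom.commutes, freeDerivation_algebraMap δ hδ, map_zero, smul_zero]
  | ι i v =>
    rw [freeSign_ι, map_smul, freeDerivation_ι, freeSign_of_mem (hδ i v), smul_smul, pow_succ]
    simp
  | add x y hx hy => simp only [map_add, hx, hy, smul_add]
  | mul x y hx hy =>
    simp only [map_mul, freeDerivation_mul, hx, hy, map_add, smul_mul_assoc, mul_smul_comm,
      smul_add]

variable (hd : ∀ i v, freeDerivation δ hδ (δ i v) = 0)
include hd

/-- The cdg algebra structure on a free graded commutative algebra given by the differentials of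
the generators. -/
noncomputable abbrev freeCDGA : CDGA k where
  carrier := FreeGradedCommutative k V
  grading := freeGrading k V
  d := freeDerivation δ hδ
  d_mem := freeDerivation_mem δ hδ
  d_d x := by
    induction x using free_induction with
    | algebraMap c => rw [freeDerivation_algebraMap, map_zero]
    | ι i v => rw [freeDerivation_ι, hd]
    | add x y hx hy => rw [map_add, map_add, hx, hy, add_zero]
    | mul x y hx hy =>
      rw [freeDerivation_mul, map_add, freeDerivation_mul, freeDerivation_mul, hx, hy,
        freeDerivation_sign, zero_mul, mul_zero, add_zero, zero_add, smul_mul_assoc]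
      have h (z : FreeGradedCommutative k V) : z + (-1 : k) • z = 0 := by
        nth_rewrite 1 [← one_smul k z]
        rw [← add_smul, add_neg_cancel, zero_smul]
      exact h _
  leibniz b ha := by
    rw [freeDerivation_mul, freeSign_of_mem ha, smul_mul_assoc]
  comm := freeGrading_comm k V

omit hδ hd in
lemma freeMap_freeι (A : CDGA k) (W : ℕ → Submodule k A.carrier) (hW : ∀ i, W i ≤ A.grading i)
    (i : ℕ) (w : W i) : A.freeMap W hW (freeι k (fun i => W i) i w) = w := by
  simp [freeMap, freeι]

omit hδ hd in
/-- A free graded commutative algebra is free on the spans of its generators. -/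
lemma bijective_of_freeι (W : ℕ → Submodule k (FreeGradedCommutative k V))
    (hW : ∀ i, W i = LinearMap.range (freeι k V i))
    (f : FreeGradedCommutative k (fun i => W i) →ₐ[k] FreeGradedCommutative k V)
    (hf : ∀ i (w : W i), f (freeι k (fun i => W i) i w) = w) : Function.Bijective f := by
  have hmem : ∀ i v, freeι k V i v ∈ W i := fun i v => by rw [hW]; exact ⟨v, rfl⟩
  let g : FreeGradedCommutative k V →ₐ[k] FreeGradedCommutative k (fun i => W i) :=
    freeDesc (fun i => freeι k (fun i => W i) i ∘ₗ (freeι k V i).codRestrict (W i) (hmem i))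
      (fun i j v w => freeι_mul k (fun i => W i) i j _ _)
  have hg : ∀ i v, g (freeι k V i v) = freeι k (fun i => W i) i ⟨freeι k V i v, hmem i v⟩ := by
    intro i v
    rw [freeDesc_ι]
    rfl
  have hgf : g.comp f = AlgHom.id k _ := by
    refine free_algHom_ext ?_
    rintro i ⟨w, hw⟩
    obtain ⟨v, rfl⟩ : w ∈ LinearMap.range (freeι k V i) := hW i ▸ hw
    rw [AlgHom.comp_apply, hf, hg, AlgHom.id_apply]
  have hfg : f.comp g = AlgHom.id k _ := by
    refine free_algHom_ext ?_
    intro i v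
    rw [AlgHom.comp_apply, hg, hf, AlgHom.id_apply]
  exact Function.bijective_iff_has_inverse.2
    ⟨g, fun x => AlgHom.congr_fun hgf x, fun x => AlgHom.congr_fun hfg x⟩

lemma isFree_freeCDGA : (freeCDGA δ hδ hd).IsFree := by
  let W : ℕ → Submodule k (FreeGradedCommutative k V) := fun i => LinearMap.range (freeι k V i)
  have hW : ∀ i, W i ≤ freeGrading k V i := by
    rintro i _ ⟨v, rfl⟩
    exact freeι_mem k V i v
  exact ⟨W, hW, bijective_of_freeι (V := V) W (fun i => rfl) _
    (freeMap_freeι (freeCDGA δ hδ hd) W hW)⟩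

end FreeGrading

end CDGA

namespace CDGA

variable {k : Type u} [Field k]

/-! ### Subalgebras generated by homogeneous elements -/

section HomogeneousGenerators

variable (A : CDGA k) {T : Set A.carrier}

lemma proj_algebraMap (n : ℕ) (c : k) : A.proj n (algebraMap k A.carrier c) =
    if n = 0 then algebraMap k A.carrier c else 0 := by
  split_ifs with h
  · subst h
    exact A.proj_of_mem (A.algebraMap_mem_zero c)
  · exact A.proj_of_mem_ne (A.algebraMap_mem_zero c) (Ne.symm h)

lemma proj_mem_adjoin (hT : ∀ x ∈ T, ∃ i, x ∈ A.grading i) {x : A.carrier}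
    (hx : x ∈ Algebra.adjoin k T) (n : ℕ) : A.proj n x ∈ Algebra.adjoin k T := by
  induction hx using Algebra.adjoin_induction generalizing n with
  | mem x hx =>
    obtain ⟨i, hi⟩ := hT x hx
    by_cases h : i = n
    · subst h
      rw [A.proj_of_mem hi]
      exact Algebra.subset_adjoin hx
    · rw [A.proj_of_mem_ne hi h]
      exact Subalgebra.zero_mem _
  | algebraMap c =>
    rw [proj_algebraMap]
    split_ifs
    · exact Subalgebra.algebraMap_mem _ _
    · exact Subalgebra.zero_mem _
  | add x y _ _ hx hy => rw [map_add]; exact Subalgebra.add_mem _ (hx n) (hy n)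
  | mul x y _ _ hx hy =>
    rw [proj_mul]
    exact Subalgebra.sum_mem _ fun ij _ => Subalgebra.mul_mem _ (hx _) (hy _)

/-- A subalgebra generated in degrees at least `2` is connected, and zero in degree `1`. -/
lemma proj_adjoin_low (hT : ∀ x ∈ T, ∃ i, x ∈ A.grading (i + 2)) {x : A.carrier}
    (hx : x ∈ Algebra.adjoin k T) :
    A.proj 1 x = 0 ∧ ∃ c, A.proj 0 x = algebraMap k A.carrier c := by
  induction hx using Algebra.adjoin_induction with
  | mem x hx =>
    obtain ⟨i, hi⟩ := hT x hx
    exact ⟨A.proj_of_mem_ne hi (by omega), 0, by rw [A.proj_of_mem_ne hi (by omega), map_zero]⟩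
  | algebraMap c => exact ⟨by simp [proj_algebraMap], c, by simp [proj_algebraMap]⟩
  | add x y _ _ hx hy =>
    obtain ⟨hx1, c, hx0⟩ := hx
    obtain ⟨hy1, c', hy0⟩ := hy
    exact ⟨by rw [map_add, hx1, hy1, add_zero], c + c', by rw [map_add, hx0, hy0, map_add]⟩
  | mul x y _ _ hx hy =>
    obtain ⟨hx1, c, hx0⟩ := hx
    obtain ⟨hy1, c', hy0⟩ := hy
    refine ⟨?_, c * c', ?_⟩
    · rw [proj_mul, Finset.Nat.antidiagonal_succ]
      simp [hx1, hy1]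
    · rw [proj_mul]
      simp [hx0, hy0]

/-- Adding generators `W` of degree `n + 2` to a subalgebra generated in degrees at least `2`
changes it, in degrees at most `n + 3`, by `W` only. -/
lemma proj_adjoin_union (hT : ∀ x ∈ T, ∃ i, x ∈ A.grading (i + 2)) {n : ℕ}
    {W : Submodule k A.carrier} (hW : W ≤ A.grading (n + 2)) {x : A.carrier}
    (hx : x ∈ Algebra.adjoin k (T ∪ W)) :
    (∀ i ≤ n + 3, i ≠ n + 2 → A.proj i x ∈ Algebra.adjoin k T) ∧
      A.proj (n + 2) x ∈ Subalgebra.toSubmodule (Algebra.adjoin k T) ⊔ W := by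
  have hT' : ∀ x ∈ T, ∃ i, x ∈ A.grading i := fun x hx => ⟨_, (hT x hx).choose_spec⟩
  have hTW : ∀ x ∈ T ∪ W, ∃ i, x ∈ A.grading (i + 2) := by
    rintro x (hx | hx)
    exacts [hT x hx, ⟨n, hW hx⟩]
  have hle : Subalgebra.toSubmodule (Algebra.adjoin k T) ≤
      Subalgebra.toSubmodule (Algebra.adjoin k T) ⊔ W := le_sup_left
  induction hx using Algebra.adjoin_induction with
  | mem x hx =>
    rcases hx with hx | hx
    · have h := A.proj_mem_adjoin hT' (Algebra.subset_adjoin hx)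
      exact ⟨fun i _ _ => h i, hle (h _)⟩
    · refine ⟨fun i _ hi => ?_, ?_⟩
      · rw [A.proj_of_mem_ne (hW hx) hi.symm]
        exact Subalgebra.zero_mem _
      · rw [A.proj_of_mem (hW hx)]
        exact (le_sup_right : W ≤ _) hx
  | algebraMap c =>
    have h := A.proj_mem_adjoin hT' (Subalgebra.algebraMap_mem (Algebra.adjoin k T) c)
    exact ⟨fun i _ _ => h i, hle (h _)⟩
  | add x y _ _ hx hy =>
    refine ⟨fun i hi hi' => ?_, ?_⟩
    · rw [map_add]
      exact Subalgebra.add_mem _ (hx.1 i hi hi') (hy.1 i hi hi')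
    · rw [map_add]
      exact Submodule.add_mem _ hx.2 hy.2
  | mul x y hx' hy' hx hy =>
    obtain ⟨hx1, c, hx0⟩ := A.proj_adjoin_low hTW hx'
    obtain ⟨hy1, c', hy0⟩ := A.proj_adjoin_low hTW hy'
    refine ⟨fun i hi hi' => ?_, ?_⟩
    · rw [proj_mul]
      refine Subalgebra.sum_mem _ fun ⟨a, b⟩ hab => ?_
      rw [Finset.HasAntidiagonal.mem_antidiagonal] at hab
      dsimp only at hab ⊢
      by_cases ha : a = n + 2
      · obtain rfl : b = 1 := by omega
        rw [hy1, mul_zero]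
        exact Subalgebra.zero_mem _
      by_cases hb : b = n + 2
      · obtain rfl : a = 1 := by omega
        rw [hx1, zero_mul]
        exact Subalgebra.zero_mem _
      exact Subalgebra.mul_mem _ (hx.1 a (by omega) ha) (hy.1 b (by omega) hb)
    · rw [proj_mul]
      refine Submodule.sum_mem _ fun ⟨a, b⟩ hab => ?_
      rw [Finset.HasAntidiagonal.mem_antidiagonal] at hab
      dsimp only at hab ⊢
      by_cases ha : a = n + 2
      · obtain rfl : b = 0 := by omega
        rw [ha, hy0, ← Algebra.commutes, ← Algebra.smul_def]
        exact Submodule.smul_mem _ _ hx.2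
      by_cases hb : b = n + 2
      · obtain rfl : a = 0 := by omega
        rw [hb, hx0, ← Algebra.smul_def]
        exact Submodule.smul_mem _ _ hy.2
      exact hle (Subalgebra.mul_mem _ (hx.1 a (by omega) ha) (hy.1 b (by omega) hb))

lemma plus_mul_top : A.plus * ⊤ ≤ A.plus := by
  rw [← (DirectSum.Decomposition.isInternal A.grading).submodule_iSup_eq_top, plus, Submodule.iSup_mul]
  refine iSup_le fun i => ?_
  rw [Submodule.mul_iSup]
  refine iSup_le fun j => Submodule.mul_le.2 fun a ha b hb => ?_
  exact A.mem_plus (n := i + j) (A.mul_mem_grading ha hb (by ring))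

lemma top_mul_plus : ⊤ * A.plus ≤ A.plus := by
  rw [← (DirectSum.Decomposition.isInternal A.grading).submodule_iSup_eq_top, plus, Submodule.mul_iSup]
  refine iSup_le fun i => ?_
  rw [Submodule.iSup_mul]
  refine iSup_le fun j => Submodule.mul_le.2 fun a ha b hb => ?_
  exact A.mem_plus (n := j + i) (A.mul_mem_grading ha hb (by ring))

lemma mul_mem_plus_mul_plus_right {a : A.carrier} (b : A.carrier) (ha : a ∈ A.plus * A.plus) :
    a * b ∈ A.plus * A.plus := by
  have h : A.plus * A.plus * ⊤ ≤ A.plus * A.plus := by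
    rw [mul_assoc]
    exact mul_le_mul_right A.plus_mul_top _
  exact h (Submodule.mul_mem_mul ha trivial)

lemma mul_mem_plus_mul_plus_left (a : A.carrier) {b : A.carrier} (hb : b ∈ A.plus * A.plus) :
    a * b ∈ A.plus * A.plus := by
  have h : ⊤ * (A.plus * A.plus) ≤ A.plus * A.plus := by
    rw [← mul_assoc]
    exact mul_le_mul_left A.top_mul_plus _
  exact h (Submodule.mul_mem_mul trivial hb)

/-- In a subalgebra generated in degrees at most `N`, the elements of degree greater than `N` are
decomposable. -/
lemma proj_mem_plus_mul_plus {N : ℕ} (hT : ∀ x ∈ T, ∃ i ≤ N, x ∈ A.grading i) {x : A.carrier}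
    (hx : x ∈ Algebra.adjoin k T) {n : ℕ} (hn : N < n) : A.proj n x ∈ A.plus * A.plus := by
  induction hx using Algebra.adjoin_induction generalizing n with
  | mem x hx =>
    obtain ⟨i, hi, hx⟩ := hT x hx
    rw [A.proj_of_mem_ne hx (by omega)]
    exact Submodule.zero_mem _
  | algebraMap c =>
    rw [proj_algebraMap, if_neg (by omega)]
    exact Submodule.zero_mem _
  | add x y _ _ hx hy => rw [map_add]; exact Submodule.add_mem _ (hx hn) (hy hn)
  | mul x y _ _ hx hy =>
    rw [proj_mul]
    refine Submodule.sum_mem _ fun ⟨a, b⟩ hab => ?_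
    rw [Finset.HasAntidiagonal.mem_antidiagonal] at hab
    dsimp only at hab ⊢
    rcases a with _ | a
    · exact A.mul_mem_plus_mul_plus_left _ (hy (by omega))
    rcases b with _ | b
    · exact A.mul_mem_plus_mul_plus_right _ (hx (by omega))
    exact Submodule.mul_mem_mul (A.mem_plus (A.proj_mem _ _)) (A.mem_plus (A.proj_mem _ _))

end HomogeneousGenerators

/-! ### The inductive construction of minimal models -/

lemma exists_relative_complement {M : Type*} [AddCommGroup M] [Module k M] (E F : Submodule k M) :
    ∃ C ≤ E, Disjoint C F ∧ E ≤ C ⊔ F := by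
  obtain ⟨C, hC⟩ := Submodule.exists_isCompl ((E ⊓ F).comap E.subtype)
  refine ⟨C.map E.subtype, Submodule.map_subtype_le _ _, ?_, ?_⟩
  · rw [Submodule.disjoint_def]
    rintro _ ⟨c, hc, rfl⟩ hF
    have := (Submodule.disjoint_def.1 hC.disjoint) c ⟨c.2, hF⟩ hc
    rw [this, map_zero]
  · intro x hx
    have : (⟨x, hx⟩ : E) ∈ (E ⊓ F).comap E.subtype ⊔ C := by rw [hC.sup_eq_top]; trivial
    obtain ⟨y, hy, c, hc, h⟩ := Submodule.mem_sup.1 this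
    refine Submodule.mem_sup.2 ⟨c, ⟨c, hc, rfl⟩, y, hy.2, ?_⟩
    rw [add_comm]
    exact congrArg Subtype.val h

/-- A graded commutative algebra `L` over `A` with a derivation and, in each degree, a supply of
generators with arbitrary images in `L` and `A`. -/
structure GeneratorSupply (A : CDGA k) where
  L : CDGA k
  D : L.carrier →ₗ[k] L.carrier
  D_mem : ∀ {n : ℕ} {x : L.carrier}, x ∈ L.grading n → D x ∈ L.grading (n + 1)
  D_mul : ∀ x y, D (x * y) = D x * y + L.sign x * D y
  toBase : L.carrier →ₐ[k] A.carrier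
  toBase_mem : ∀ n, ∀ x ∈ L.grading n, toBase x ∈ A.grading n
  gen : ℕ → L.carrier × A.carrier →ₗ[k] L.carrier
  gen_mem : ∀ n c, gen n c ∈ L.grading n
  D_gen : ∀ n c, D (gen n c) = L.proj (n + 1) c.1
  toBase_gen : ∀ n c, toBase (gen n c) = A.proj n c.2

namespace GeneratorSupply

variable {A : CDGA k} (G : GeneratorSupply A)

lemma D_algebraMap (c : k) : G.D (algebraMap k G.L.carrier c) = 0 := by
  have h := G.D_mul 1 1
  rw [sign_apply G.L G.L.one_mem_zero, pow_zero, one_smul, mul_one, mul_one, one_mul,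
    left_eq_add] at h
  rw [Algebra.algebraMap_eq_smul_one, map_smul, h, smul_zero]

/-- The classes to be killed: pairs of a cocycle `m` of degree `n + 3` in `S` and an element `a`
with `d a` the image of `m`. -/
def cone (n : ℕ) (S : Subalgebra k G.L.carrier) : Submodule k (G.L.carrier × A.carrier) where
  carrier := {c | c.1 ∈ S ∧ c.1 ∈ G.L.grading (n + 3) ∧ G.D c.1 = 0 ∧ c.2 ∈ A.grading (n + 2) ∧
    G.toBase c.1 = A.d c.2}
  zero_mem' := ⟨S.zero_mem, Submodule.zero_mem _, map_zero _, Submodule.zero_mem _, by simp⟩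
  add_mem' := by
    rintro a b ⟨h1, h2, h3, h4, h5⟩ ⟨h1', h2', h3', h4', h5'⟩
    exact ⟨S.add_mem h1 h1', Submodule.add_mem _ h2 h2', by simp [h3, h3'],
      Submodule.add_mem _ h4 h4', by simp [h5, h5']⟩
  smul_mem' := by
    rintro r a ⟨h1, h2, h3, h4, h5⟩
    exact ⟨S.smul_mem h1 r, Submodule.smul_mem _ _ h2, by simp [h3],
      Submodule.smul_mem _ _ h4, by simp [h5]⟩

/-- The elements of the cone which are boundaries. -/
def coneBoundaries (n : ℕ) (S : Subalgebra k G.L.carrier) :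
    Submodule k (G.L.carrier × A.carrier) where
  carrier := {c | ∃ m ∈ S, m ∈ G.L.grading (n + 2) ∧ ∃ b ∈ A.grading (n + 1),
    c = (G.D m, G.toBase m + A.d b)}
  zero_mem' := ⟨0, S.zero_mem, Submodule.zero_mem _, 0, Submodule.zero_mem _,
    by simp only [map_zero, add_zero]; rfl⟩
  add_mem' := by
    rintro _ _ ⟨m, h1, h2, b, h3, rfl⟩ ⟨m', h1', h2', b', h3', rfl⟩
    refine ⟨m + m', S.add_mem h1 h1', Submodule.add_mem _ h2 h2', b + b',
      Submodule.add_mem _ h3 h3', ?_⟩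
    rw [map_add, map_add, map_add, Prod.mk_add_mk, add_add_add_comm]
  smul_mem' := by
    rintro r _ ⟨m, h1, h2, b, h3, rfl⟩
    refine ⟨r • m, S.smul_mem h1 r, Submodule.smul_mem _ _ h2, r • b,
      Submodule.smul_mem _ _ h3, ?_⟩
    rw [map_smul, map_smul, map_smul, Prod.smul_mk, smul_add]

/-- The new generators: a complement of the boundaries in the cone. -/
noncomputable def newGenerators (n : ℕ) (S : Subalgebra k G.L.carrier) :
    Submodule k (G.L.carrier × A.carrier) :=
  (exists_relative_complement (G.cone n S) (G.coneBoundaries n S)).choose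

lemma newGenerators_le (n : ℕ) (S : Subalgebra k G.L.carrier) : G.newGenerators n S ≤ G.cone n S :=
  (exists_relative_complement (G.cone n S) (G.coneBoundaries n S)).choose_spec.1

lemma newGenerators_disjoint (n : ℕ) (S : Subalgebra k G.L.carrier) :
    Disjoint (G.newGenerators n S) (G.coneBoundaries n S) :=
  (exists_relative_complement (G.cone n S) (G.coneBoundaries n S)).choose_spec.2.1

lemma cone_le (n : ℕ) (S : Subalgebra k G.L.carrier) :
    G.cone n S ≤ G.newGenerators n S ⊔ G.coneBoundaries n S :=
  (exists_relative_complement (G.cone n S) (G.coneBoundaries n S)).choose_spec.2.2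

/-- The stages of the construction. -/
noncomputable def stage : ℕ → Subalgebra k G.L.carrier
  | 0 => ⊥
  | n + 1 => stage n ⊔ Algebra.adjoin k ((G.newGenerators n (stage n)).map (G.gen (n + 2)))

/-- The space of generators of degree `n + 2`. -/
noncomputable def relations (n : ℕ) : Submodule k (G.L.carrier × A.carrier) :=
  G.newGenerators n (G.stage n)

lemma stage_succ (n : ℕ) : G.stage (n + 1) =
    G.stage n ⊔ Algebra.adjoin k ((G.relations n).map (G.gen (n + 2))) := rfl

lemma stage_mono : Monotone G.stage :=
  monotone_nat_of_le_succ fun n => by rw [stage_succ]; exact le_sup_left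

/-- The generators of the `n`-th stage. -/
def stageGenerators (n : ℕ) : Set G.L.carrier :=
  {x | ∃ m < n, ∃ c ∈ G.relations m, x = G.gen (m + 2) c}

lemma stageGenerators_succ (n : ℕ) : G.stageGenerators (n + 1) =
    G.stageGenerators n ∪ (G.relations n).map (G.gen (n + 2)) := by
  ext x
  constructor
  · rintro ⟨m, hm, c, hc, rfl⟩
    rcases Nat.lt_succ_iff_lt_or_eq.1 hm with h | rfl
    · exact Or.inl ⟨m, h, c, hc, rfl⟩
    · exact Or.inr ⟨c, hc, rfl⟩
  · rintro (⟨m, hm, c, hc, rfl⟩ | ⟨c, hc, rfl⟩)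
    · exact ⟨m, by omega, c, hc, rfl⟩
    · exact ⟨n, by omega, c, hc, rfl⟩

lemma adjoin_stageGenerators (n : ℕ) : Algebra.adjoin k (G.stageGenerators n) = G.stage n := by
  induction n with
  | zero =>
    have : G.stageGenerators 0 = ∅ := by
      ext x
      simp [stageGenerators]
    rw [this, Algebra.adjoin_empty, stage]
  | succ n ih => rw [stageGenerators_succ, Algebra.adjoin_union, ih, stage_succ]

lemma mem_grading_of_stageGenerators {n : ℕ} :
    ∀ x ∈ G.stageGenerators n, ∃ i, x ∈ G.L.grading (i + 2) := by
  rintro _ ⟨m, _, c, _, rfl⟩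
  exact ⟨m, G.gen_mem _ _⟩

lemma sign_mem_stage {n : ℕ} {x : G.L.carrier} (hx : x ∈ G.stage n) : G.L.sign x ∈ G.stage n := by
  rw [← adjoin_stageGenerators] at hx ⊢
  refine G.L.sign_mem_adjoin (fun x hx => ?_) hx
  obtain ⟨i, hi⟩ := G.mem_grading_of_stageGenerators x hx
  rw [sign_apply G.L hi]
  exact Subalgebra.smul_mem _ (Algebra.subset_adjoin hx) _

lemma D_gen_of_mem {n : ℕ} {c : G.L.carrier × A.carrier} (hc : c ∈ G.relations n) :
    G.D (G.gen (n + 2) c) = c.1 := by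
  rw [D_gen, G.L.proj_of_mem (G.newGenerators_le _ _ hc).2.1]

lemma toBase_gen_of_mem {n : ℕ} {c : G.L.carrier × A.carrier} (hc : c ∈ G.relations n) :
    G.toBase (G.gen (n + 2) c) = c.2 := by
  rw [toBase_gen, A.proj_of_mem (G.newGenerators_le _ _ hc).2.2.2.1]

lemma D_mem_stage {n : ℕ} {x : G.L.carrier} (hx : x ∈ G.stage n) : G.D x ∈ G.stage n := by
  suffices h : ∀ y ∈ Algebra.adjoin k (G.stageGenerators n), G.D y ∈ G.stage n from
    h x (by rwa [adjoin_stageGenerators])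
  intro y hy
  induction hy using Algebra.adjoin_induction with
  | mem x hx =>
    obtain ⟨m, hm, c, hc, rfl⟩ := hx
    rw [D_gen_of_mem G hc]
    exact G.stage_mono hm.le (G.newGenerators_le _ _ hc).1
  | algebraMap c => rw [D_algebraMap]; exact Subalgebra.zero_mem _
  | add x y hx' hy' hx hy =>
    rw [map_add]
    exact Subalgebra.add_mem _ hx hy
  | mul x y hx' hy' hx hy =>
    rw [adjoin_stageGenerators] at hx' hy'
    rw [D_mul]
    exact Subalgebra.add_mem _ (Subalgebra.mul_mem _ hx hy')
      (Subalgebra.mul_mem _ (G.sign_mem_stage hx') hy)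

lemma toBase_D {n : ℕ} {x : G.L.carrier} (hx : x ∈ G.stage n) :
    G.toBase (G.D x) = A.d (G.toBase x) := by
  rw [← adjoin_stageGenerators] at hx
  induction hx using Algebra.adjoin_induction with
  | mem x hx =>
    obtain ⟨m, hm, c, hc, rfl⟩ := hx
    rw [D_gen_of_mem G hc, toBase_gen_of_mem G hc]
    exact (G.newGenerators_le _ _ hc).2.2.2.2
  | algebraMap c => rw [D_algebraMap, map_zero, AlgHom.commutes, d_algebraMap]
  | add x y _ _ hx hy => rw [map_add, map_add, map_add, map_add, hx, hy]
  | mul x y _ _ hx hy =>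
    rw [D_mul, map_add, map_mul, map_mul, map_mul, d_mul, hx, hy,
      map_sign G.toBase G.toBase_mem]

lemma D_D_of_stageGenerators {n : ℕ} {x : G.L.carrier} (hx : x ∈ G.stageGenerators n) :
    G.D (G.D x) = 0 := by
  obtain ⟨m, hm, c, hc, rfl⟩ := hx
  rw [D_gen_of_mem G hc]
  exact (G.newGenerators_le _ _ hc).2.2.1

/-- The `n`-th stage has the cohomology of `A` up to degree `n + 1`, and its cohomology embeds in
degree `n + 2`. -/
structure IsGoodStage (n : ℕ) : Prop where
  surj : ∀ i ≤ n + 1, ∀ b ∈ A.grading i, A.d b = 0 →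
    ∃ x ∈ G.stage n, x ∈ G.L.grading i ∧ G.D x = 0 ∧ ∃ c, b = G.toBase x + A.d c
  inj : ∀ i ≤ n + 2, ∀ x ∈ G.stage n, x ∈ G.L.grading i → G.D x = 0 →
    ∀ b, G.toBase x = A.d b → ∃ y ∈ G.stage n, x = G.D y

lemma isGoodStage_zero (hA : A.IsOneConnected) : G.IsGoodStage 0 where
  surj i hi b hb hd := by
    obtain rfl | rfl : i = 0 ∨ i = 1 := by omega
    · obtain ⟨c, rfl⟩ := hA.exists_algebraMap hb hd
      exact ⟨algebraMap k _ c, Subalgebra.algebraMap_mem _ _, G.L.algebraMap_mem_zero c,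
        G.D_algebraMap c, 0, by rw [AlgHom.commutes, map_zero, add_zero]⟩
    · obtain ⟨c, rfl⟩ := hA.exists_primitive hb hd
      exact ⟨0, Subalgebra.zero_mem _, Submodule.zero_mem _, map_zero _, c,
        by rw [map_zero, zero_add]⟩
  inj i hi x hx hxi hd b hb := by
    obtain ⟨c, rfl⟩ := Algebra.mem_bot.1 (show x ∈ (⊥ : Subalgebra k G.L.carrier) from hx)
    refine ⟨0, Subalgebra.zero_mem _, ?_⟩
    rw [map_zero]
    by_cases h : i = 0
    · subst h
      rw [AlgHom.commutes] at hb
      have := A.eq_zero_of_exact_of_mem_zero (A.algebraMap_mem_zero c) hb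
      rw [(map_eq_zero_iff _ hA.algebraMap_injective).1 this, map_zero]
    · exact G.L.eq_zero_of_mem_of_mem hxi (G.L.algebraMap_mem_zero c) h

lemma gen_mem_stage {n : ℕ} {c : G.L.carrier × A.carrier} (hc : c ∈ G.relations n) :
    G.gen (n + 2) c ∈ G.stage (n + 1) := by
  rw [← adjoin_stageGenerators]
  exact Algebra.subset_adjoin ⟨n, Nat.lt_succ_self n, c, hc, rfl⟩

lemma exists_of_mem_cone {n : ℕ} {c : G.L.carrier × A.carrier} (hc : c ∈ G.cone n (G.stage n)) :
    ∃ x ∈ G.stage (n + 1), x ∈ G.L.grading (n + 2) ∧ G.D x = c.1 ∧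
      ∃ b, c.2 = G.toBase x + A.d b := by
  obtain ⟨e, he, _, ⟨m, hm, hm', b, hb, rfl⟩, rfl⟩ := Submodule.mem_sup.1 (G.cone_le _ _ hc)
  refine ⟨G.gen (n + 2) e + m,
    Subalgebra.add_mem _ (G.gen_mem_stage he) (G.stage_mono (Nat.le_succ n) hm),
    Submodule.add_mem _ (G.gen_mem _ _) hm', ?_, b, ?_⟩
  · rw [map_add, D_gen_of_mem G he, Prod.fst_add]
  · rw [map_add, toBase_gen_of_mem G he, Prod.snd_add, add_assoc]

lemma IsGoodStage.succ {G : GeneratorSupply A} {n : ℕ} (h : G.IsGoodStage n) :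
    G.IsGoodStage (n + 1) where
  surj i hi b hb hd := by
    by_cases hin : i ≤ n + 1
    · obtain ⟨x, hx, h⟩ := h.surj i hin b hb hd
      exact ⟨x, G.stage_mono (Nat.le_succ n) hx, h⟩
    obtain rfl : i = n + 2 := by omega
    obtain ⟨x, hx, hx', hD, h⟩ := G.exists_of_mem_cone (n := n) (c := (0, b))
      ⟨Subalgebra.zero_mem _, Submodule.zero_mem _, map_zero _, hb, by
        dsimp only
        rw [hd, map_zero]⟩
    exact ⟨x, hx, hx', hD, h⟩
  inj i hi x hx hxi hd b hb := by
    have hx' := hx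
    rw [← adjoin_stageGenerators, stageGenerators_succ] at hx'
    obtain ⟨h1, h2⟩ := G.L.proj_adjoin_union G.mem_grading_of_stageGenerators (n := n)
      (W := (G.relations n).map (G.gen (n + 2))) (by
        rintro _ ⟨c, _, rfl⟩
        exact G.gen_mem _ _) hx'
    rw [adjoin_stageGenerators] at h1 h2
    have old (hx : x ∈ G.stage n) (hin : i ≤ n + 2) : ∃ y ∈ G.stage (n + 1), x = G.D y := by
      obtain ⟨y, hy, h⟩ := h.inj i hin x hx hxi hd b hb
      exact ⟨y, G.stage_mono (Nat.le_succ n) hy, h⟩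
    by_cases hin : i = n + 2
    · subst hin
      rw [G.L.proj_of_mem hxi] at h2
      obtain ⟨s, hs, _, ⟨c, hc, rfl⟩, hsc⟩ := Submodule.mem_sup.1 h2
      obtain ⟨b, hb', hb⟩ := A.exists_homogeneous_primitive
        (G.toBase_mem _ _ hxi) hb
      have hc0 : c = 0 := by
        refine (Submodule.disjoint_def.1 (G.newGenerators_disjoint n (G.stage n))) c hc
          ⟨-s, Subalgebra.neg_mem _ hs, ?_, b, hb', ?_⟩
        · rw [show -s = G.gen (n + 2) c - x by rw [← hsc]; abel]
          exact Submodule.sub_mem _ (G.gen_mem _ _) hxi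
        · rw [← hsc, map_add, D_gen_of_mem G hc] at hd
          rw [← hsc, map_add, toBase_gen_of_mem G hc] at hb
          refine Prod.ext ?_ ?_
          · rw [map_neg]
            exact (neg_eq_of_add_eq_zero_right hd).symm
          · rw [← hb]
            dsimp only
            rw [map_neg, neg_add_cancel_left]
      rw [hc0, map_zero, add_zero] at hsc
      exact old (hsc ▸ hs) le_rfl
    · have hxn : x ∈ G.stage n := by
        have := h1 i hi hin
        rwa [G.L.proj_of_mem hxi] at this
      by_cases hin' : i ≤ n + 2
      · exact old hxn hin'
      obtain rfl : i = n + 3 := by omega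
      obtain ⟨b, hb', hb⟩ := A.exists_homogeneous_primitive (G.toBase_mem _ _ hxi) hb
      obtain ⟨y, hy, -, hD, -⟩ := G.exists_of_mem_cone (n := n) (c := (x, b))
        ⟨hxn, hxi, hd, hb', hb⟩
      exact ⟨y, hy, hD.symm⟩

lemma isGoodStage (hA : A.IsOneConnected) (n : ℕ) : G.IsGoodStage n := by
  induction n with
  | zero => exact G.isGoodStage_zero hA
  | succ n ih => exact ih.succ

end GeneratorSupply

end CDGA

namespace CDGA

variable {k : Type u} [Field k]

/-! ### Existence of minimal models -/

open Cardinal in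
lemma cardinalMk_freeGradedCommutative_le (V : ℕ → Type u) [∀ i, AddCommGroup (V i)]
    [∀ i, Module k (V i)] :
    #(FreeGradedCommutative k V) ≤ max (max #k #(Σ i, V i)) ℵ₀ := by
  let f : FreeAlgebra k (Σ i, V i) →ₐ[k] FreeGradedCommutative k V :=
    FreeAlgebra.lift k fun x => freeι k V x.1 x.2
  have hf : Function.Surjective f := by
    rw [← AlgHom.range_eq_top, eq_top_iff, ← free_adjoin_eq_top, Algebra.adjoin_le_iff]
    rintro _ ⟨i, v, rfl⟩
    exact ⟨FreeAlgebra.ι k ⟨i, v⟩, FreeAlgebra.lift_ι_apply _ _⟩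
  refine (mk_le_of_surjective hf).trans ?_
  exact FreeAlgebra.cardinalMk_le_max k (Σ i, V i)

open Cardinal in
/-- There are vector spaces `U` which contain `Λ(U) × X`, where `U` is placed in every degree. -/
lemma exists_injective_free_prod (X : Type u) [AddCommGroup X] [Module k X] :
    ∃ (U : Type u) (_ : AddCommGroup U) (_ : Module k U)
      (J : FreeGradedCommutative k (fun _ : ℕ => U) × X →ₗ[k] U), Function.Injective J := by
  let ι : Type u := (X ⊕ k) ⊕ ULift.{u} ℕ
  let U : Type u := ι →₀ k
  have hι : ℵ₀ ≤ #ι := aleph0_le_mk ι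
  have hk : #k ≤ #ι := mk_le_of_injective (f := fun c => Sum.inl (Sum.inr c)) fun a b h => by
    exact Sum.inr_injective (Sum.inl_injective h)
  have hX : #X ≤ #ι := mk_le_of_injective (f := fun c => Sum.inl (Sum.inl c)) fun a b h => by
    exact Sum.inl_injective (Sum.inl_injective h)
  have hU : #U = #ι := by
    rw [mk_finsupp_of_infinite, max_eq_left hk]
  have hΛ : #(FreeGradedCommutative k (fun _ : ℕ => U)) ≤ #ι := by
    refine (cardinalMk_freeGradedCommutative_le _).trans (max_le (max_le hk ?_) hι)
    rw [mk_sigma, sum_const, hU, mk_nat, lift_aleph0, lift_uzero]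
    exact mul_le_of_le hι hι le_rfl
  let b := Module.Basis.ofVectorSpace k (FreeGradedCommutative k (fun _ : ℕ => U) × X)
  have hb : #(Module.Basis.ofVectorSpaceIndex k
      (FreeGradedCommutative k (fun _ : ℕ => U) × X)) ≤ #ι := by
    refine (mk_subtype_le _).trans ?_
    rw [mk_prod, lift_id, lift_id]
    exact mul_le_of_le hι hΛ hX
  obtain ⟨e⟩ := (Cardinal.le_def _ _).1 hb
  exact ⟨U, inferInstance, inferInstance, Finsupp.lmapDomain k k e ∘ₗ b.repr.toLinearMap,
    (Finsupp.mapDomain_injective e.injective).comp b.repr.injective⟩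

section

variable {V : ℕ → Type u} [∀ i, AddCommGroup (V i)] [∀ i, Module k (V i)]

lemma free_sign (x : FreeGradedCommutative k V) : (free k V).sign x = freeSign k V x := by
  have h : (free k V).sign = (freeSign k V).toLinearMap := (free k V).linearMap_ext
    fun n a ha => (sign_apply (free k V) ha).trans (freeSign_of_mem ha).symm
  exact LinearMap.congr_fun h x

lemma free_algebraMap_injective :
    Function.Injective (algebraMap k (FreeGradedCommutative k V)) := by
  let f : FreeGradedCommutative k V →ₐ[k] k := freeDesc (fun _ => 0) (by simp)
  intro a b h
  simpa using congrArg f h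

variable {W : ℕ → Type u} [∀ i, AddCommGroup (W i)] [∀ i, Module k (W i)]

variable (k) in
/-- The functoriality of the free graded commutative algebra. -/
noncomputable def freeMapHom (g : ∀ i, V i →ₗ[k] W i) :
    FreeGradedCommutative k V →ₐ[k] FreeGradedCommutative k W :=
  freeDesc (fun i => freeι k W i ∘ₗ g i) fun i j v w => freeι_mul k W i j (g i v) (g j w)

lemma freeMapHom_ι (g : ∀ i, V i →ₗ[k] W i) (i : ℕ) (v : V i) :
    freeMapHom k g (freeι k V i v) = freeι k W i (g i v) :=
  freeDesc_ι _ _ i v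

lemma freeMapHom_mem (g : ∀ i, V i →ₗ[k] W i) {n : ℕ} {x : FreeGradedCommutative k V}
    (hx : x ∈ freeGrading k V n) : freeMapHom k g x ∈ freeGrading k W n :=
  freeDesc_mem (B := free k W) _ _ (fun i v => freeι_mem k W i (g i v)) n x hx

lemma freeMapHom_sign (g : ∀ i, V i →ₗ[k] W i) (x : FreeGradedCommutative k V) :
    freeMapHom k g (freeSign k V x) = freeSign k W (freeMapHom k g x) := by
  have := map_sign (A := free k V) (B := free k W) (freeMapHom k g)
    (fun _ _ hx => freeMapHom_mem g hx) x
  rwa [free_sign, free_sign] at this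

end

section MinimalModel

variable {A : CDGA k} {U : Type u} [AddCommGroup U] [Module k U]
  (J : FreeGradedCommutative k (fun _ : ℕ => U) × A.carrier →ₗ[k] U)
  (l : U →ₗ[k] FreeGradedCommutative k (fun _ : ℕ => U) × A.carrier) (hJ : l ∘ₗ J = LinearMap.id)

/-- The supply of generators given by a vector space `U` containing `Λ(U) × A`. -/
noncomputable abbrev generatorSupply : GeneratorSupply A where
  L := free k (fun _ => U)
  D := freeDerivation
    (fun i => (free k (fun _ => U)).proj (i + 1) ∘ₗ LinearMap.fst k _ A.carrier ∘ₗ l)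
    (fun i u => (free k (fun _ => U)).proj_mem (i + 1) (l u).1)
  D_mem := freeDerivation_mem _ _
  D_mul x y := by
    rw [free_sign]
    exact freeDerivation_mul _ _ x y
  toBase := freeDesc
    (fun i => A.proj i ∘ₗ LinearMap.snd k (FreeGradedCommutative k (fun _ : ℕ => U)) _ ∘ₗ l)
    (fun i j v w => A.comm (A.proj_mem i (l v).2) (A.proj_mem j (l w).2))
  toBase_mem := freeDesc_mem _ _ fun i v => A.proj_mem i (l v).2
  gen n := freeι k (fun _ => U) n ∘ₗ J
  gen_mem n c := freeι_mem k (fun _ => U) n (J c)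
  D_gen n c := by
    have h : l (J c) = c := LinearMap.congr_fun hJ c
    refine (freeDerivation_ι (V := fun _ : ℕ => U) _ _ n (J c)).trans ?_
    simp only [LinearMap.comp_apply, h]
    rfl
  toBase_gen n c := by
    have h : l (J c) = c := LinearMap.congr_fun hJ c
    refine (freeDesc_ι (V := fun _ : ℕ => U) _ _ n (J c)).trans ?_
    simp only [LinearMap.comp_apply, h]
    rfl

/-- The generators of the minimal model. -/
noncomputable def modelGenerators : ℕ → Submodule k U
  | 0 => ⊥
  | 1 => ⊥
  | n + 2 => ((generatorSupply J l hJ).relations n).map J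

/-- The minimal model, as a subalgebra of the supply of generators. -/
noncomputable def modelInclusion :
    FreeGradedCommutative k (fun i => modelGenerators J l hJ i) →ₐ[k]
      FreeGradedCommutative k (fun _ : ℕ => U) :=
  freeMapHom k fun i => (modelGenerators J l hJ i).subtype

/-- A retraction of the inclusion of the generators. -/
noncomputable def generatorRetraction (i : ℕ) : U →ₗ[k] modelGenerators J l hJ i :=
  ((modelGenerators J l hJ i).subtype.exists_leftInverse_of_injective
    (Submodule.ker_subtype _)).choose

lemma generatorRetraction_coe (i : ℕ) (v : modelGenerators J l hJ i) :
    generatorRetraction J l hJ i v = v :=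
  LinearMap.congr_fun ((modelGenerators J l hJ i).subtype.exists_leftInverse_of_injective
    (Submodule.ker_subtype _)).choose_spec v

/-- A retraction of the inclusion of the minimal model. -/
noncomputable def modelRetraction :
    FreeGradedCommutative k (fun _ : ℕ => U) →ₐ[k]
      FreeGradedCommutative k (fun i => modelGenerators J l hJ i) :=
  freeMapHom k (generatorRetraction J l hJ)

lemma modelInclusion_ι (i : ℕ) (v : modelGenerators J l hJ i) :
    modelInclusion J l hJ (freeι k (fun i => modelGenerators J l hJ i) i v) =
      freeι k (fun _ => U) i v :=
  freeMapHom_ι (W := fun _ : ℕ => U) (fun i => (modelGenerators J l hJ i).subtype) i v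

lemma modelRetraction_ι (i : ℕ) (v : modelGenerators J l hJ i) :
    modelRetraction J l hJ (freeι k (fun _ => U) i v) =
      freeι k (fun i => modelGenerators J l hJ i) i v := by
  refine (freeMapHom_ι _ i _).trans ?_
  rw [generatorRetraction_coe]

lemma modelRetraction_modelInclusion
    (x : FreeGradedCommutative k (fun i => modelGenerators J l hJ i)) :
    modelRetraction J l hJ (modelInclusion J l hJ x) = x := by
  have h : (modelRetraction J l hJ).comp (modelInclusion J l hJ) = AlgHom.id k _ :=
    free_algHom_ext fun i v => by
      rw [AlgHom.comp_apply, modelInclusion_ι, modelRetraction_ι, AlgHom.id_apply]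
  exact AlgHom.congr_fun h x

lemma modelInclusion_injective : Function.Injective (modelInclusion J l hJ) :=
  Function.LeftInverse.injective (modelRetraction_modelInclusion J l hJ)

lemma modelInclusion_ι_mem (n : ℕ) (v : modelGenerators J l hJ n) :
    freeι k (fun _ => U) n v.1 ∈ Algebra.adjoin k
      ((generatorSupply J l hJ).stageGenerators (n - 1)) := by
  obtain ⟨v, hv⟩ := v
  match n, hv with
  | 0, hv =>
    obtain rfl := (Submodule.mem_bot k).1 hv
    rw [map_zero]
    exact Subalgebra.zero_mem _
  | 1, hv =>
    obtain rfl := (Submodule.mem_bot k).1 hv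
    rw [map_zero]
    exact Subalgebra.zero_mem _
  | n + 2, hv =>
    obtain ⟨c, hc, rfl⟩ := hv
    exact Algebra.subset_adjoin ⟨n, by omega, c, hc, rfl⟩

lemma exists_modelInclusion_mem_stage
    (x : FreeGradedCommutative k (fun i => modelGenerators J l hJ i)) :
    ∃ n, modelInclusion J l hJ x ∈ (generatorSupply J l hJ).stage n := by
  induction x using free_induction with
  | algebraMap c => exact ⟨0, by rw [AlgHom.commutes]; exact Subalgebra.algebraMap_mem _ _⟩
  | ι i v =>
    refine ⟨i - 1, ?_⟩
    rw [modelInclusion_ι, ← GeneratorSupply.adjoin_stageGenerators]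
    exact modelInclusion_ι_mem J l hJ i v
  | add x y hx hy =>
    obtain ⟨m, hx⟩ := hx
    obtain ⟨n, hy⟩ := hy
    refine ⟨max m n, ?_⟩
    rw [map_add]
    exact Subalgebra.add_mem _ (GeneratorSupply.stage_mono _ (le_max_left _ _) hx)
      (GeneratorSupply.stage_mono _ (le_max_right _ _) hy)
  | mul x y hx hy =>
    obtain ⟨m, hx⟩ := hx
    obtain ⟨n, hy⟩ := hy
    refine ⟨max m n, ?_⟩
    rw [map_mul]
    exact Subalgebra.mul_mem _ (GeneratorSupply.stage_mono _ (le_max_left _ _) hx)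
      (GeneratorSupply.stage_mono _ (le_max_right _ _) hy)

/-- The generators of the minimal model of degree at most `n + 1`. -/
def lowModelGenerators (n : ℕ) :
    Set (FreeGradedCommutative k (fun i => modelGenerators J l hJ i)) :=
  {x | ∃ m < n, ∃ v, x = freeι k (fun i => modelGenerators J l hJ i) (m + 2) v}

lemma modelRetraction_mem_adjoin {n : ℕ} {x : FreeGradedCommutative k (fun _ : ℕ => U)}
    (hx : x ∈ (generatorSupply J l hJ).stage n) :
    modelRetraction J l hJ x ∈ Algebra.adjoin k (lowModelGenerators J l hJ n) := by
  rw [← GeneratorSupply.adjoin_stageGenerators] at hx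
  have h : modelRetraction J l hJ x ∈ Subalgebra.map (modelRetraction J l hJ) (Algebra.adjoin k
    ((generatorSupply J l hJ).stageGenerators n)) := ⟨x, hx, rfl⟩
  rw [AlgHom.map_adjoin] at h
  refine Algebra.adjoin_mono ?_ h
  rintro _ ⟨_, ⟨m, hm, c, hc, rfl⟩, rfl⟩
  exact ⟨m, hm, ⟨J c, c, hc, rfl⟩, modelRetraction_ι J l hJ (m + 2) ⟨J c, c, hc, rfl⟩⟩

lemma modelInclusion_modelRetraction {n : ℕ} {x : FreeGradedCommutative k (fun _ : ℕ => U)}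
    (hx : x ∈ (generatorSupply J l hJ).stage n) :
    modelInclusion J l hJ (modelRetraction J l hJ x) = x := by
  rw [← GeneratorSupply.adjoin_stageGenerators] at hx
  induction hx using Algebra.adjoin_induction with
  | mem x hx =>
    obtain ⟨m, hm, c, hc, rfl⟩ := hx
    refine (congrArg _ (modelRetraction_ι J l hJ (m + 2) ⟨J c, c, hc, rfl⟩)).trans ?_
    exact modelInclusion_ι J l hJ _ _
  | algebraMap c => rw [AlgHom.commutes, AlgHom.commutes]
  | add x y _ _ hx hy => rw [map_add, map_add, hx, hy]
  | mul x y _ _ hx hy => rw [map_mul, map_mul, hx, hy]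

/-- The differential of the generators of the minimal model. -/
noncomputable def modelDelta (i : ℕ) : modelGenerators J l hJ i →ₗ[k]
    FreeGradedCommutative k (fun i => modelGenerators J l hJ i) :=
  (modelRetraction J l hJ).toLinearMap ∘ₗ (generatorSupply J l hJ).D ∘ₗ freeι k (fun _ => U) i ∘ₗ
    (modelGenerators J l hJ i).subtype

lemma modelDelta_mem (i : ℕ) (v : modelGenerators J l hJ i) :
    modelDelta J l hJ i v ∈ freeGrading k (fun i => modelGenerators J l hJ i) (i + 1) :=
  freeMapHom_mem _ ((generatorSupply J l hJ).D_mem (freeι_mem k (fun _ => U) i v.1))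

lemma D_generator_mem_stage (n : ℕ) (v : modelGenerators J l hJ (n + 2)) :
    (generatorSupply J l hJ).D (freeι k (fun _ => U) (n + 2) v.1) ∈
      (generatorSupply J l hJ).stage n := by
  obtain ⟨_, c, hc, rfl⟩ := v
  have h := (generatorSupply J l hJ).D_gen_of_mem hc
  rw [show (generatorSupply J l hJ).gen (n + 2) c = freeι k (fun _ => U) (n + 2) (J c) from rfl]
    at h
  rw [h]
  exact (GeneratorSupply.newGenerators_le _ _ _ hc).1

lemma modelDelta_mem_adjoin (n : ℕ) (v : modelGenerators J l hJ (n + 2)) :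
    modelDelta J l hJ (n + 2) v ∈ Algebra.adjoin k (lowModelGenerators J l hJ n) :=
  modelRetraction_mem_adjoin J l hJ (D_generator_mem_stage J l hJ n v)

lemma modelInclusion_freeDerivation
    (x : FreeGradedCommutative k (fun i => modelGenerators J l hJ i)) :
    modelInclusion J l hJ (freeDerivation (modelDelta J l hJ) (modelDelta_mem J l hJ) x) =
      (generatorSupply J l hJ).D (modelInclusion J l hJ x) := by
  induction x using free_induction with
  | algebraMap c =>
    rw [freeDerivation_algebraMap, map_zero, AlgHom.commutes]
    exact ((generatorSupply J l hJ).D_algebraMap c).symm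
  | ι i v =>
    rw [freeDerivation_ι]
    obtain ⟨n, hn⟩ := exists_modelInclusion_mem_stage J l hJ
      (freeι k (fun i => modelGenerators J l hJ i) i v)
    have h := modelInclusion_modelRetraction J l hJ ((generatorSupply J l hJ).D_mem_stage hn)
    rw [← h, modelInclusion_ι]
    rfl
  | add x y hx hy =>
    rw [map_add, map_add, hx, hy, map_add]
    exact (map_add (generatorSupply J l hJ).D _ _).symm
  | mul x y hx hy =>
    rw [freeDerivation_mul, map_add, map_mul, map_mul, hx, hy, map_mul]
    refine Eq.trans ?_ ((generatorSupply J l hJ).D_mul _ _).symm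
    congr 2
    exact (freeMapHom_sign _ x).trans (free_sign _).symm

lemma freeDerivation_modelDelta (i : ℕ) (v : modelGenerators J l hJ i) :
    freeDerivation (modelDelta J l hJ) (modelDelta_mem J l hJ) (modelDelta J l hJ i v) = 0 := by
  apply modelInclusion_injective J l hJ
  rw [modelInclusion_freeDerivation, map_zero,
    ← freeDerivation_ι (modelDelta J l hJ) (modelDelta_mem J l hJ) i v,
    modelInclusion_freeDerivation, modelInclusion_ι]
  obtain ⟨v, hv⟩ := v
  match i, hv with
  | 0, hv =>
    obtain rfl := (Submodule.mem_bot k).1 hv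
    simp only [map_zero]
  | 1, hv =>
    obtain rfl := (Submodule.mem_bot k).1 hv
    simp only [map_zero]
  | n + 2, hv =>
    obtain ⟨c, hc, rfl⟩ := hv
    exact (generatorSupply J l hJ).D_D_of_stageGenerators (n := n + 1)
      ⟨n, Nat.lt_succ_self n, c, hc, rfl⟩

/-- The minimal model. -/
noncomputable abbrev minimalModel : CDGA k :=
  freeCDGA (modelDelta J l hJ) (modelDelta_mem J l hJ) (freeDerivation_modelDelta J l hJ)

/-- The comparison morphism of the minimal model. -/
noncomputable def minimalModelHom : minimalModel J l hJ ⟶ A where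
  toAlgHom := (generatorSupply J l hJ).toBase.comp (modelInclusion J l hJ)
  map_mem h := (generatorSupply J l hJ).toBase_mem _ _ (freeMapHom_mem _ h)
  map_d x := by
    obtain ⟨n, hn⟩ := exists_modelInclusion_mem_stage J l hJ x
    refine Eq.trans ?_ ((generatorSupply J l hJ).toBase_D hn)
    exact congrArg _ (modelInclusion_freeDerivation J l hJ x)

lemma isQuasiIso_minimalModelHom (hA : A.IsOneConnected) :
    IsQuasiIso (minimalModelHom J l hJ) := by
  have D_incl := modelInclusion_freeDerivation J l hJ
  have incl_retr (n : ℕ) (x) (hx : x ∈ (generatorSupply J l hJ).stage n) :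
    modelInclusion J l hJ (modelRetraction J l hJ x) = x := modelInclusion_modelRetraction J l hJ hx
  have good := (generatorSupply J l hJ).isGoodStage hA
  rw [isQuasiIso_iff]
  refine ⟨fun i a ha hd b hb => ?_, fun i b hb hd => ?_⟩
  · obtain ⟨n, hn⟩ := exists_modelInclusion_mem_stage J l hJ a
    obtain ⟨y, hy, h⟩ := (good (max n i)).inj i
      ((le_max_right n i).trans (Nat.le_add_right _ 2)) _
      (GeneratorSupply.stage_mono _ (le_max_left n i) hn) (freeMapHom_mem _ ha)
      (by
        refine (D_incl a).symm.trans ?_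
        exact (congrArg _ hd).trans (map_zero _)) b hb
    refine ⟨modelRetraction J l hJ y, modelInclusion_injective J l hJ ?_⟩
    refine h.trans (Eq.trans ?_ (D_incl _).symm)
    rw [incl_retr _ y hy]
  · obtain ⟨x, hx, hxi, hD, c, hc⟩ := (good i).surj i (Nat.le_succ i) b hb hd
    refine ⟨modelRetraction J l hJ x, freeMapHom_mem _ hxi, modelInclusion_injective J l hJ ?_,
      c, ?_⟩
    · refine (D_incl _).trans ?_
      rw [incl_retr _ x hx, map_zero]
      exact hD
    · refine hc.trans ?_
      congr 1
      refine congrArg (generatorSupply J l hJ).toBase ?_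
      exact (incl_retr _ x hx).symm

lemma isSullivanMinimal_minimalModel : (minimalModel J l hJ).IsSullivanMinimal := by
  have hT : ∀ x ∈ {x | ∃ i v, x = freeι k (fun i => modelGenerators J l hJ i) i v},
      ∃ i, x ∈ (minimalModel J l hJ).grading (i + 2) := by
    rintro _ ⟨i, ⟨v, hv⟩, rfl⟩
    match i, hv with
    | 0, hv =>
      obtain rfl := (Submodule.mem_bot k).1 hv
      exact ⟨0, (map_zero (freeι k (fun i => modelGenerators J l hJ i) 0)).symm ▸
        Submodule.zero_mem _⟩
    | 1, hv =>
      obtain rfl := (Submodule.mem_bot k).1 hv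
      exact ⟨0, (map_zero (freeι k (fun i => modelGenerators J l hJ i) 1)).symm ▸
        Submodule.zero_mem _⟩
    | n + 2, hv => exact ⟨n, freeι_mem k (fun i => modelGenerators J l hJ i) (n + 2) ⟨v, hv⟩⟩
  have htop (x : (minimalModel J l hJ).carrier) : x ∈ Algebra.adjoin k
      {x | ∃ i v, x = freeι k (fun i => modelGenerators J l hJ i) i v} := by
    refine Eq.mpr (congrArg (x ∈ ·) free_adjoin_eq_top) ?_
    trivial
  have hd (x : (minimalModel J l hJ).carrier) : (minimalModel J l hJ).d x ∈
      (minimalModel J l hJ).plus * (minimalModel J l hJ).plus := by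
    induction htop x using Algebra.adjoin_induction with
    | mem x hx =>
      obtain ⟨i, ⟨v, hv⟩, rfl⟩ := hx
      match i, hv with
      | 0, hv =>
        obtain rfl := (Submodule.mem_bot k).1 hv
        refine Eq.mpr (congrArg (· ∈ _) ?_) (Submodule.zero_mem _)
        exact (freeDerivation_ι _ _ 0 _).trans (map_zero (modelDelta J l hJ 0))
      | 1, hv =>
        obtain rfl := (Submodule.mem_bot k).1 hv
        refine Eq.mpr (congrArg (· ∈ _) ?_) (Submodule.zero_mem _)
        exact (freeDerivation_ι _ _ 1 _).trans (map_zero (modelDelta J l hJ 1))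
      | n + 2, hv =>
        have h := proj_mem_plus_mul_plus (minimalModel J l hJ) (N := n + 1) (n := n + 3) (by
          rintro _ ⟨m, hm, v, rfl⟩
          exact ⟨m + 2, by omega, freeι_mem k (fun i => modelGenerators J l hJ i) (m + 2) v⟩)
          (modelDelta_mem_adjoin J l hJ n ⟨v, hv⟩) (by omega)
        rw [proj_of_mem _ (modelDelta_mem J l hJ (n + 2) ⟨v, hv⟩)] at h
        refine Eq.mpr (congrArg (· ∈ _) ?_) h
        exact freeDerivation_ι _ _ (n + 2) _
    | algebraMap c => rw [d_algebraMap]; exact Submodule.zero_mem _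
    | add x y _ _ hx hy => rw [map_add]; exact Submodule.add_mem _ hx hy
    | mul x y _ _ hx hy =>
      rw [d_mul]
      exact Submodule.add_mem _ (mul_mem_plus_mul_plus_right _ _ hx)
        (mul_mem_plus_mul_plus_left _ _ hy)
  refine ⟨isFree_freeCDGA _ _ _, free_algebraMap_injective, ?_, ?_, ?_⟩
  · ext x
    constructor
    · intro hx
      obtain ⟨-, c, hc⟩ := proj_adjoin_low (minimalModel J l hJ) hT (htop x)
      rw [proj_of_mem _ hx] at hc
      exact ⟨c, hc.symm⟩
    · rintro ⟨c, rfl⟩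
      exact algebraMap_mem_zero _ c
  · rw [eq_bot_iff]
    intro x hx
    obtain ⟨h, -⟩ := proj_adjoin_low (minimalModel J l hJ) hT (htop x)
    rwa [proj_of_mem _ hx] at h
  · rintro _ ⟨x, -, rfl⟩
    exact hd x

end MinimalModel

/-- Every `1`-connected cdg algebra has a `1`-connected Sullivan minimal model. -/
theorem exists_minimalModel {A : CDGA k} (hA : A.IsOneConnected) :
    ∃ (M : CDGA k) (f : M ⟶ A), M.IsSullivanMinimal ∧ IsQuasiIso f := by
  obtain ⟨U, _, _, J, hJ⟩ := exists_injective_free_prod (k := k) A.carrier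
  obtain ⟨l, hl⟩ := J.exists_leftInverse_of_injective (LinearMap.ker_eq_bot.2 hJ)
  exact ⟨_, minimalModelHom J l hl, isSullivanMinimal_minimalModel J l hl,
    isQuasiIso_minimalModelHom J l hl hA⟩

end CDGA

namespace CDGA

variable {k : Type u} [Field k]

/-! ### Invariance of minimality under isomorphism -/

lemma freeMapHom_bijective {V W : ℕ → Type u} [∀ i, AddCommGroup (V i)] [∀ i, Module k (V i)]
    [∀ i, AddCommGroup (W i)] [∀ i, Module k (W i)] (e : ∀ i, V i ≃ₗ[k] W i) :
    Function.Bijective (freeMapHom k fun i => (e i).toLinearMap) := by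
  have h : (freeMapHom k fun i => (e i).symm.toLinearMap).comp
      (freeMapHom k fun i => (e i).toLinearMap) = AlgHom.id k _ := free_algHom_ext fun i v => by
    rw [AlgHom.comp_apply, freeMapHom_ι, freeMapHom_ι, AlgHom.id_apply, LinearEquiv.coe_coe,
      LinearEquiv.coe_coe, LinearEquiv.symm_apply_apply]
  have h' : (freeMapHom k fun i => (e i).toLinearMap).comp
      (freeMapHom k fun i => (e i).symm.toLinearMap) = AlgHom.id k _ :=
    free_algHom_ext fun i v => by
      rw [AlgHom.comp_apply, freeMapHom_ι, freeMapHom_ι, AlgHom.id_apply, LinearEquiv.coe_coe,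
        LinearEquiv.coe_coe, LinearEquiv.apply_symm_apply]
  exact Function.bijective_iff_has_inverse.2 ⟨_, AlgHom.congr_fun h, AlgHom.congr_fun h'⟩

variable {A B : CDGA k} {f : A ⟶ B} (hf : Function.Bijective f.toAlgHom)
include hf

lemma exists_mem_of_bijective {n : ℕ} {b : B.carrier} (hb : b ∈ B.grading n) :
    ∃ a ∈ A.grading n, f.toAlgHom a = b := by
  obtain ⟨a, rfl⟩ := hf.2 b
  exact ⟨A.proj n a, A.proj_mem n a, by rw [map_proj, B.proj_of_mem hb]⟩

lemma IsFree.of_bijective (hA : A.IsFree) : B.IsFree := by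
  obtain ⟨V, hV, h⟩ := hA
  let W : ℕ → Submodule k B.carrier := fun i => (V i).map f.toAlgHom.toLinearMap
  have hW : ∀ i, W i ≤ B.grading i := by
    rintro i _ ⟨v, hv, rfl⟩
    exact f.map_mem (hV i hv)
  let e : ∀ i, V i ≃ₗ[k] W i := fun i => (V i).equivMapOfInjective f.toAlgHom.toLinearMap hf.1
  have he : (B.freeMap W hW).comp (freeMapHom k fun i => (e i).toLinearMap) =
      f.toAlgHom.comp (A.freeMap V hV) := free_algHom_ext fun i v => by
    rw [AlgHom.comp_apply, AlgHom.comp_apply, freeMapHom_ι, freeMap_freeι, freeMap_freeι]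
    rfl
  refine ⟨W, hW, (Function.Bijective.of_comp_iff _ (freeMapHom_bijective e)).1 ?_⟩
  rw [← AlgHom.coe_comp, he, AlgHom.coe_comp]
  exact hf.comp h

lemma IsSullivanMinimal.of_bijective (hA : A.IsSullivanMinimal) : B.IsSullivanMinimal where
  free := hA.free.of_bijective hf
  unit_injective a b h := by
    apply hA.unit_injective
    apply hf.1
    rw [AlgHom.commutes, AlgHom.commutes, h]
  grading_zero := by
    ext b
    constructor
    · intro hb
      obtain ⟨a, ha, rfl⟩ := exists_mem_of_bijective hf hb
      rw [hA.grading_zero] at ha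
      obtain ⟨c, rfl⟩ := ha
      exact ⟨c, (f.toAlgHom.commutes c).symm⟩
    · rintro ⟨c, rfl⟩
      exact B.algebraMap_mem_zero c
  grading_one := by
    rw [eq_bot_iff]
    intro b hb
    obtain ⟨a, ha, rfl⟩ := exists_mem_of_bijective hf hb
    rw [hA.grading_one, Submodule.mem_bot] at ha
    rw [ha, map_zero]
    exact Submodule.zero_mem _
  d_plus := by
    have hle : A.plus.map f.toAlgHom.toLinearMap ≤ B.plus := by
      rw [plus, Submodule.map_iSup]
      refine iSup_le fun i => ?_
      rintro _ ⟨a, ha, rfl⟩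
      exact B.mem_plus (f.map_mem ha)
    rw [plus, Submodule.map_iSup]
    refine iSup_le fun i => ?_
    rintro _ ⟨b, hb, rfl⟩
    obtain ⟨a, ha, rfl⟩ := exists_mem_of_bijective hf hb
    have h := Submodule.mem_map_of_mem (f := f.toAlgHom.toLinearMap)
      (hA.d_plus ⟨a, A.mem_plus ha, rfl⟩)
    rw [Submodule.map_mul] at h
    rw [← f.map_d]
    exact Submodule.mul_le.2 (fun x hx y hy => Submodule.mul_mem_mul (hle hx) (hle hy)) h

end CDGA

namespace Adgc₁

variable {k : Type u} [Field k] [CharZero k]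

open CDGA

lemma isMinimalObject_of_isSullivanMinimal {M : Adgc₁ k} (hM : M.obj.IsSullivanMinimal) :
    IsMinimalObject (strong k) (weak k) M where
  cofibrant := isCofibrantObject_of_isSullivanMinimal hM
  end_inter w := ⟨fun hw => (isIso_iff_bijective w).2 (hM.bijective_of_isQuasiIso hM hw),
    isStrongWeak.weak.of_isIso w⟩

omit [CharZero k] in
lemma exists_minimalModel (X : Adgc₁ k) :
    ∃ (M : Adgc₁ k) (f : M ⟶ X), M.obj.IsSullivanMinimal ∧ weak k f := by
  obtain ⟨M, f, hM, hf⟩ := CDGA.exists_minimalModel X.property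
  exact ⟨⟨M, hf.isOneConnected_iff.2 X.property⟩, ObjectProperty.homMk f, hM, hf⟩

lemma isLeftModel_of_weak {M X : Adgc₁ k} {f : M ⟶ X} (hf : weak k f) :
    IsLeftModel (isStrongWeak (k := k)).le_saturation M X := by
  refine ⟨(strong k).Q.map f, ?_⟩
  have h : (strong k).Q ⋙ strongToWeak (isStrongWeak (k := k)).le_saturation = (weak k).Q :=
    Localization.Construction.fac _ _
  have h' : IsIso (((strong k).Q ⋙ strongToWeak (isStrongWeak (k := k)).le_saturation).map f) := by
    rw [h]
    exact (weak k).Q_inverts f hf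
  exact h'

/-- A weak equivalence between cofibrant objects is a homotopy equivalence. -/
lemma exists_homotopyInverse {N M : Adgc₁ k} (hN : IsCofibrantObject (strong k) (weak k) N)
    (hM : IsCofibrantObject (strong k) (weak k) M) {f : N ⟶ M} (hf : weak k f) :
    ∃ g : M ⟶ N, homotopic k (g ≫ f) (𝟙 M) ∧ homotopic k (f ≫ g) (𝟙 N) := by
  obtain ⟨g', hg'⟩ := (hM f hf).2 (𝟙 _)
  obtain ⟨g, rfl⟩ := strong_Q_map_surjective g'
  refine ⟨g, ?_, ?_⟩
  · rw [← strong_Q_map_eq_iff, Functor.map_comp, CategoryTheory.Functor.map_id]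
    exact hg'
  · rw [← strong_Q_map_eq_iff]
    apply (hN f hf).1
    dsimp only at hg' ⊢
    rw [Functor.map_comp, Category.assoc, hg', CategoryTheory.Functor.map_id, Category.comp_id, Category.id_comp]

lemma isSullivanMinimal_of_isMinimalObject {M : Adgc₁ k}
    (hM : IsMinimalObject (strong k) (weak k) M) : M.obj.IsSullivanMinimal := by
  obtain ⟨N, f, hN, hf⟩ := exists_minimalModel M
  have hN' := isMinimalObject_of_isSullivanMinimal hN
  obtain ⟨g, hgf, hfg⟩ := exists_homotopyInverse hN'.cofibrant hM.cofibrant hf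
  have weak_of {X : Adgc₁ k} {w : X ⟶ X} (h : homotopic k w (𝟙 X)) : weak k w :=
    weak_of_homotopic h.symm (isStrongWeak.weak.of_isIso _ inferInstance)
  have h₁ := (isIso_iff_bijective _).1 ((hM.end_inter _).1 (weak_of hgf))
  have h₂ := (isIso_iff_bijective _).1 ((hN'.end_inter _).1 (weak_of hfg))
  have hbij : Function.Bijective f.hom.toAlgHom :=
    ⟨Function.Injective.of_comp (f := g.hom.toAlgHom) h₂.1,
      Function.Surjective.of_comp (g := g.hom.toAlgHom) h₁.2⟩
  exact hN.of_bijective hbij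

end Adgc₁

theorem theorem4p7 (k : Type u) [Field k] [CharZero k] :
    IsLeftSullivan (Adgc₁.strong k) (Adgc₁.weak k) ∧
      ∀ M : Adgc₁ k, IsMinimalObject (Adgc₁.strong k) (Adgc₁.weak k) M ↔
        M.obj.IsSullivanMinimal := by
  refine ⟨⟨Adgc₁.isStrongWeak, fun X => ?_⟩, fun M =>
    ⟨Adgc₁.isSullivanMinimal_of_isMinimalObject, Adgc₁.isMinimalObject_of_isSullivanMinimal⟩⟩
  obtain ⟨M, f, hM, hf⟩ := Adgc₁.exists_minimalModel X
  exact ⟨M, Adgc₁.isMinimalObject_of_isSullivanMinimal hM, Adgc₁.isLeftModel_of_weak hf⟩
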